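/- **Setting.** Let $Q=(Q_0,Q_1,s,t)$ be a finite simply-laced quiver without loops, with an involution $\tau$ of $Q_0$ and $Q_1$ such that $s(\tau h)=\tau(t(h))$, $t(\tau h)=\tau(s(h))$, $\tau(s(h))=t(h)\iff \tau(h)=h$, and $\tau i\ne i$ for all $i\in Q_0$. Let $Q_1^\tau$ be the set of $\tau$-fixed arrows and fix $Q_0=Q_0^+\sqcup Q_0^-$ with $i\in Q_0^+\iff \tau i\in Q_0^-$. Put $c_{ii}=2$ and $c_{ij}=-\#\{h:\{s(h),t(h)\}=\{i,j\}\}$ for $i\neq j$. Let $v_i,w_i\ge 0$ $(i\in Q_0)$ be integers with $v_{\tau i}=v_i$. Let $\Lambda_i$ and $\alpha_i^\vee$ be the fundamental coweights and simple coroots, so $\langle\alpha_i,\Lambda_j\rangle=\delta_{ij}$, $\langle\alpha_i,\alpha_j^\vee\rangle=c_{ji}$. Let $\delta_{i\to\tau i}=1$ if there is an arrow from $i$ to $\tau i$, and $0$ otherwise, and set $$\mu=\sum_{j}(w_j+w_{\tau j})\Lambda_j+\sum_{h\in Q_1^\tau}(\Lambda_{s(h)}+\Lambda_{t(h)})-\sum_j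 v_j\alpha_j^\vee,\qquad \zeta_i=\hbar^{-1}2^{-c_{i,\tau i}}(-1)^{v_i-1+\delta_{i\to\tau i}+w_i+\sum_{s(h)=i}v_{t(h)}} .$$ **The shifted twisted Yangian.** $\mathbf Y^\tau_\mu(\mathfrak g_Q)$ is the $\mathbb C(\hbar)$-algebra generated by $h_{i,r}$, $b_{i,s}$ ($i\in Q_0$, $r\ge-\langle\alpha_i,\mu\rangle-1$, $s\ge0$), where $h_{i,r}:=0$ for $r<-\langle\alpha_i,\mu\rangle-1$ and $h_{i,r}:=\zeta_i$ for $r=-\langle\alpha_i,\mu\rangle-1$, with the following relations, in which the index of $h$ runs over $\mathbb Z$, the indices of the $b$'s and $k_1,k_2$ over $\mathbb Z_{\ge0}$, and $\{a,b\}=ab+ba$: $$[h_{i,r},h_{j,s}]=0,\qquad h_{i,s}=(-1)^{s+1}h_{\tau i,s},$$ $$[h_{i,r+2},b_{j,s}]-[h_{i,r},b_{j,s+2}]=\tfrac{c_{ij}-c_{\tau i,j}}2\hbar\{h_{i,r+1},b_{j,s}\}+\tfrac{c_{ij}+c_{\tau i,j}}2\hbar\{h_{i,r},b_{j,s+1}\}+\tfrac{c_{ij}c_{\tau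 i,j}}4\hbar^2[h_{i,r},b_{j,s}],$$ $$[b_{i,r+1},b_{j,s}]-[b_{i,r},b_{j,s+1}]=\tfrac{c_{ij}}2\hbar\{b_{i,r},b_{j,s}\}-2\delta_{\tau i,j}(-1)^rh_{j,r+s+1},$$ if $c_{ij}=0$: $[b_{i,r},b_{j,s}]=\delta_{\tau i,j}(-1)^rh_{j,r+s}$; if $c_{ij}=-1$ and $j\ne\tau i$: $\operatorname{Sym}_{k_1,k_2}[b_{i,k_1},[b_{i,k_2},b_{j,r}]]=0$; and if $c_{i,\tau i}=-1$: $$\operatorname{Sym}_{k_1,k_2}[b_{i,k_1},[b_{i,k_2},b_{\tau i,r}]]=\tfrac43\operatorname{Sym}_{k_1,k_2}(-1)^{k_1}\sum_{p\ge0}3^{-p}[b_{i,k_2+p},h_{\tau i,k_1+r-p}].$$ Put $h_i(z)=\hbar\sum_{r\in\mathbb Z}h_{i,r}z^{-r-1}$ and $b_i(z)=\hbar\sum_{s\ge0}b_{i,s}z^{-s-1}$. **The difference algebra.** Let $\mathrm{Diff}_\hbar(T_V^\tau)=\mathbb C(\mathfrak t\times\mathbb A^1)\rtimes X_*(T_V^\tau)$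 be the algebra generated by the field $\mathbb C(\hbar)(x_{i,r}: i\in Q_0^+,1\le r\le v_i)$ and commuting invertible elements $d_{i,r}$ with $d_{i,r}\,f=f|_{x_{i,r}\mapsto x_{i,r}+\hbar}\,d_{i,r}$, having the monomials in the $d_{i,r}^{\pm1}$ as a basis over that field. For $i\in Q_0^-$ put $x_{i,r}=-x_{\tau i,r}$, $d_{i,r}=d_{\tau i,r}^{-1}$. Let $H^*_{G_W}(\mathrm{pt})=\bigotimes_{i\in Q_0}\mathbb Q[w_{i,1},\dots,w_{i,w_i}]^{S_{w_i}}$. Put $V_i(z)=\prod_k(z-x_{i,k})$, $V_{i,r}(z)=V_i(z)/(z-x_{i,r})$, $W_i(z)=\prod_k(z-w_{i,k})$, $$B_i(u)=\sum_{r=1}^{v_i}\frac{1}{-u-x_{i,r}-\frac\hbar2}\prod_{h\in Q_1^\tau,\,s(h)=i}\bigl(2x_{i,r}+\tfrac{3\hbar}2\bigr)\prod_{h\in Q_1,\,s(h)=i}V_{t(h)}\bigl(x_{i,r}+\tfrac\hbar2\bigr)\frac{W_{\tau i}(-x_{i,r}-\frac\hbar2)}{V_{i,r}(x_{i,r})}\,d_{i,r},$$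 $$H_i(u)=(-1)^{v_i-1}\Bigl(\tfrac{2u}{(2u-\frac\hbar2)(2u+\frac\hbar2)}\Bigr)^{c_{i,\tau i}}(-1)^{\delta_{i\to\tau i}}\frac{W_i(-u)W_{\tau i}(u)}{V_i(-u+\frac\hbar2)V_i(-u-\frac\hbar2)}\prod_{s(h)=i}V_{t(h)}(-u)\prod_{s(h)=\tau i}V_{t(h)}(u),$$ expanded as Laurent series in $u^{-1}$ with coefficients in $\mathrm{Diff}_\hbar(T_V^\tau)\otimes H^*_{G_W}(\mathrm{pt})$. **Theorem.** There is a unique homomorphism of algebras over $H^*_{G_W}(\mathrm{pt})(\hbar):=\mathbb C(\hbar)\otimes_{\mathbb Q} H^*_{G_W}(\mathrm{pt})$ $$\psi:\ \mathbf Y^\tau_\mu(\mathfrak g_Q)\otimes_{\mathbb Q} H^*_{G_W}(\mathrm{pt})\longrightarrow \mathrm{Diff}_\hbar(T_V^\tau)\otimes_{\mathbb Q} H^*_{G_W}(\mathrm{pt})$$ that sends $h_i(z)$ to $H_i(z)$ and $b_i(z)$ to $B_i(z)$, coefficient by coefficient, for every $i\in Q_0$. -/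

import Mathlib

open scoped TensorProduct

noncomputable section

namespace GKLO

/-! ### Base field and commutators -/

/-- The field `ℂ(ħ)`. -/
abbrev Ch : Type := RatFunc ℂ

/-- The parameter `ħ ∈ ℂ(ħ)`. -/
def hbar : Ch := RatFunc.X

/-- The anticommutator `{a, b} = a b + b a`; the commutator is Mathlib's `⁅a, b⁆ = a b - b a`. -/
def anticomm {A : Type*} [Ring A] (a b : A) : A := a * b + b * a

/-- Symmetrization `Sym_{k₁,k₂} f(k₁,k₂) = f(k₁,k₂) + f(k₂,k₁)`. -/
def sym₂ {A : Type*} [Ring A] (f : ℕ → ℕ → A) (k₁ k₂ : ℕ) : A := f k₁ k₂ + f k₂ k₁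

/-! ### Cartan matrices with involution and coweights -/

/-- A symmetric generalized Cartan matrix with off-diagonal entries in `{0, -1}` and
an involution of its index set without fixed points that preserves it. -/
structure CartanInvolution (I : Type*) where
  c : I → I → ℤ
  τ : I → I
  c_diag : ∀ i, c i i = 2
  c_symm : ∀ i j, c i j = c j i
  c_off : ∀ i j, i ≠ j → c i j = 0 ∨ c i j = -1
  τ_invol : ∀ i, τ (τ i) = i
  c_τ : ∀ i j, c (τ i) (τ j) = c i j
  τ_ne : ∀ i, τ i ≠ i

/-- The coweight lattice: the lattice with basis the fundamental coweights `Λ i` and the simple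
coroots `α_i^∨` (first and second component), as in the realization of the Cartan matrix
in which `Λ` and `α^∨` together are linearly independent. Only the pairings with the simple
roots enter below. -/
abbrev Coweight (I : Type*) : Type _ := (I → ℤ) × (I → ℤ)

/-- The fundamental coweight `Λ_i`. -/
def fundCoweight {I : Type*} [DecidableEq I] (i : I) : Coweight I := (Pi.single i 1, 0)

/-- The simple coroot `α_i^∨`. -/
def simpleCoroot {I : Type*} [DecidableEq I] (i : I) : Coweight I := (0, Pi.single i 1)

namespace CartanInvolution

variable {I : Type*} (D : CartanInvolution I)

/-- The involution `Λ_i ↦ Λ_{τ i}`, `α_i^∨ ↦ α_{τ i}^∨` of the coweight lattice. -/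
def τCoweight (μ : Coweight I) : Coweight I := (fun i => μ.1 (D.τ i), fun i => μ.2 (D.τ i))

/-- The pairing `⟨α_i, μ⟩`, determined by `⟨α_i, Λ_j⟩ = δ_{ij}` and `⟨α_i, α_j^∨⟩ = c_{ji}`. -/
def pairing [Fintype I] (i : I) (μ : Coweight I) : ℤ := μ.1 i + ∑ j, μ.2 j * D.c j i

end CartanInvolution

/-- The parameters of a shifted twisted Yangian: a `τ`-invariant coweight `μ` and
`ζ_i ∈ ℂ(ħ)ˣ` with `ζ_i = (-1)^⟨α_i, μ⟩ ζ_{τ i}`. -/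
structure ShiftDatum {I : Type*} [Fintype I] (D : CartanInvolution I) where
  μ : Coweight I
  μ_inv : D.τCoweight μ = μ
  ζ : I → Ch
  ζ_ne : ∀ i, ζ i ≠ 0
  ζ_τ : ∀ i, ζ i = (-1 : Ch) ^ D.pairing i μ * ζ (D.τ i)

/-! ### Shifted twisted Yangians -/

/-- Generators `h_{i,r}` and `b_{i,s}`. The symbols `h_{i,r}` are introduced for all `r ∈ ℤ`; those
with `r ≤ -⟨α_i, μ⟩ - 1` are then identified with the constants `0` and `ζ_i`. -/
inductive YGen (I : Type*) : Type _
  | h (i : I) (r : ℤ) : YGen I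
  | b (i : I) (s : ℕ) : YGen I

section Yangian

variable {I : Type*} [Fintype I] [DecidableEq I] {D : CartanInvolution I}

/-- The free algebra on the generators. -/
abbrev YFree (I : Type*) : Type _ := FreeAlgebra Ch (YGen I)

/-- `h_{i,r}` in the free algebra. -/
def fh (i : I) (r : ℤ) : YFree I := FreeAlgebra.ι Ch (YGen.h i r)

/-- `b_{i,s}` in the free algebra. -/
def fb (i : I) (s : ℕ) : YFree I := FreeAlgebra.ι Ch (YGen.b i s)

/-- The defining relations of the shifted twisted Yangian. In `iSerre` the sum over `p ≥ 0` is
cut off at `p ≤ k₁ + r + ⟨α_{τ i}, μ⟩ + 1`: beyond that, `h_{τ i, k₁ + r - p} = 0`. -/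
inductive YRel (S : ShiftDatum D) : YFree I → YFree I → Prop
  | h_low (i : I) (r : ℤ) (hr : r < -D.pairing i S.μ - 1) : YRel S (fh i r) 0
  | h_lead (i : I) :
      YRel S (fh i (-D.pairing i S.μ - 1)) (algebraMap Ch (YFree I) (S.ζ i))
  | h_comm (i j : I) (r s : ℤ) : YRel S ⁅fh i r, fh j s⁆ 0
  | h_tau (i : I) (s : ℤ) : YRel S (fh i s) ((-1 : Ch) ^ (s + 1) • fh (D.τ i) s)
  | hb (i j : I) (r : ℤ) (s : ℕ) :
      YRel S
        (⁅fh i (r + 2), fb j s⁆ - ⁅fh i r, fb j (s + 2)⁆)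
        ((((D.c i j : Ch) - (D.c (D.τ i) j : Ch)) / 2 * hbar) • anticomm (fh i (r + 1)) (fb j s)
          + (((D.c i j : Ch) + (D.c (D.τ i) j : Ch)) / 2 * hbar) •
              anticomm (fh i r) (fb j (s + 1))
          + ((D.c i j : Ch) * (D.c (D.τ i) j : Ch) / 4 * hbar ^ 2) • ⁅fh i r, fb j s⁆)
  | bb (i j : I) (r s : ℕ) :
      YRel S
        (⁅fb i (r + 1), fb j s⁆ - ⁅fb i r, fb j (s + 1)⁆)
        (((D.c i j : Ch) / 2 * hbar) • anticomm (fb i r) (fb j s)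
          - (if D.τ i = j then (2 * (-1 : Ch) ^ r) • fh j ((r : ℤ) + s + 1) else 0))
  | commSerre (i j : I) (hij : D.c i j = 0) (r s : ℕ) :
      YRel S ⁅fb i r, fb j s⁆
        (if D.τ i = j then ((-1 : Ch) ^ r) • fh j ((r : ℤ) + s) else 0)
  | usualSerre (i j : I) (hij : D.c i j = -1) (hj : j ≠ D.τ i) (k₁ k₂ r : ℕ) :
      YRel S (sym₂ (fun k₁ k₂ => ⁅fb i k₁, ⁅fb i k₂, fb j r⁆⁆) k₁ k₂) 0
  | iSerre (i : I) (hi : D.c i (D.τ i) = -1) (k₁ k₂ r : ℕ) :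
      YRel S (sym₂ (fun k₁ k₂ => ⁅fb i k₁, ⁅fb i k₂, fb (D.τ i) r⁆⁆) k₁ k₂)
        ((4 / 3 : Ch) • sym₂ (fun k₁ k₂ => ((-1 : Ch) ^ k₁) •
          ∑ p ∈ Finset.range ((k₁ : ℤ) + r + D.pairing (D.τ i) S.μ + 2).toNat,
            ((3 : Ch) ^ p)⁻¹ • ⁅fb i (k₂ + p), fh (D.τ i) ((k₁ : ℤ) + r - p)⁆) k₁ k₂)

/-- The shifted twisted Yangian, as a `ℂ(ħ)`-algebra. -/
def Yangian (S : ShiftDatum D) : Type _ := RingQuot (YRel S)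

instance (S : ShiftDatum D) : Ring (Yangian S) := inferInstanceAs (Ring (RingQuot (YRel S)))

instance (S : ShiftDatum D) : Algebra Ch (Yangian S) :=
  inferInstanceAs (Algebra Ch (RingQuot (YRel S)))

instance (S : ShiftDatum D) : Algebra ℚ (Yangian S) :=
  Algebra.compHom (Yangian S) (algebraMap ℚ Ch)

/-- The quotient map from the free algebra. -/
def ymk (S : ShiftDatum D) : YFree I →ₐ[Ch] Yangian S := RingQuot.mkAlgHom Ch (YRel S)

/-- The element `h_{i,r}`, `r ∈ ℤ`, of the shifted twisted Yangian. -/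
def yh (S : ShiftDatum D) (i : I) (r : ℤ) : Yangian S := ymk S (fh i r)

/-- The element `b_{i,s}`, `s ≥ 0`, of the shifted twisted Yangian. -/
def yb (S : ShiftDatum D) (i : I) (s : ℕ) : Yangian S := ymk S (fb i s)

theorem yh_eq_zero (S : ShiftDatum D) (i : I) (r : ℤ) (hr : r < -D.pairing i S.μ - 1) :
    yh S i r = 0 := by
  have : ymk S (fh i r) = ymk S 0 := RingQuot.mkAlgHom_rel Ch (YRel.h_low (S := S) i r hr)
  rw [yh, this, map_zero]

/-- `h_i(z) = ħ ∑_{r ∈ ℤ} h_{i,r} z^{-r-1}`. Here and below a Laurent series is a series in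
`z⁻¹`: its `n`-th coefficient is the coefficient of `z^{-n}`. -/
def hSeries (S : ShiftDatum D) (i : I) : LaurentSeries (Yangian S) :=
  HahnSeries.ofSuppBddBelow (fun n : ℤ => hbar • yh S i (n - 1))
    ⟨-D.pairing i S.μ, fun n hn => by
      by_contra hlt
      exact hn (by simp [yh_eq_zero S i (n - 1) (by omega)])⟩

/-- `b_i(z) = ħ ∑_{s ≥ 0} b_{i,s} z^{-s-1}`. -/
def bSeries (S : ShiftDatum D) (i : I) : LaurentSeries (Yangian S) :=
  HahnSeries.ofSuppBddBelow (fun n : ℤ => if 1 ≤ n then hbar • yb S i (n - 1).toNat else 0)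
    ⟨1, fun n hn => by
      by_contra hlt
      exact hn (by simp [hlt])⟩

end Yangian

/-! ### The difference algebra of a torus -/

section Difference

variable {ι : Type*}

variable (ι) in
/-- The field of rational functions on `𝔱 × 𝔸¹`, `𝔱 = ℂ^ι`, as the fraction field
of `ℂ(ħ)[x_i : i ∈ ι]`. -/
def RatField : Type _ := FractionRing (MvPolynomial ι Ch)

instance : Field (RatField ι) := inferInstanceAs (Field (FractionRing (MvPolynomial ι Ch)))

instance : Algebra (MvPolynomial ι Ch) (RatField ι) :=
  inferInstanceAs (Algebra (MvPolynomial ι Ch) (FractionRing (MvPolynomial ι Ch)))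

instance : IsFractionRing (MvPolynomial ι Ch) (RatField ι) :=
  inferInstanceAs (IsFractionRing (MvPolynomial ι Ch) (FractionRing (MvPolynomial ι Ch)))

instance : Algebra Ch (RatField ι) :=
  inferInstanceAs (Algebra Ch (FractionRing (MvPolynomial ι Ch)))

instance : IsScalarTower Ch (MvPolynomial ι Ch) (RatField ι) :=
  inferInstanceAs (IsScalarTower Ch (MvPolynomial ι Ch) (FractionRing (MvPolynomial ι Ch)))

/-- Translation `x_i ↦ x_i + λ_i ħ` on polynomials. -/
def shiftPoly (l : ι → ℤ) : MvPolynomial ι Ch →ₐ[Ch] MvPolynomial ι Ch :=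
  MvPolynomial.aeval fun i => MvPolynomial.X i + MvPolynomial.C ((l i : Ch) * hbar)

theorem shiftPoly_comp (l m : ι → ℤ) :
    (shiftPoly l).comp (shiftPoly m) = shiftPoly (l + m) := by
  ext i
  simp [shiftPoly, add_mul, add_assoc]

theorem shiftPoly_zero : shiftPoly (0 : ι → ℤ) = AlgHom.id Ch _ := by
  ext i
  simp [shiftPoly]

/-- The translations as automorphisms of the polynomial ring. -/
def shiftPolyEquiv : Multiplicative (ι → ℤ) →* (MvPolynomial ι Ch ≃ₐ[Ch] MvPolynomial ι Ch) where
  toFun l := AlgEquiv.ofAlgHom (shiftPoly l.toAdd) (shiftPoly (-l.toAdd))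
    (by rw [shiftPoly_comp, add_neg_cancel, shiftPoly_zero])
    (by rw [shiftPoly_comp, neg_add_cancel, shiftPoly_zero])
  map_one' := by
    ext1 p
    exact DFunLike.congr_fun shiftPoly_zero p
  map_mul' l m := by
    ext1 p
    exact (DFunLike.congr_fun (shiftPoly_comp l.toAdd m.toAdd) p).symm

/-- The translations `f(t, ħ) ↦ f(t + λ ħ, ħ)` as automorphisms of the field of rational
functions. -/
def shiftField : Multiplicative (ι → ℤ) →* (RatField ι ≃ₐ[Ch] RatField ι) :=
  (IsFractionRing.fieldEquivOfAlgEquivHom Ch (RatField ι)).comp shiftPolyEquiv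

/-- The cocharacter lattice `ℤ^ι` acts on rational functions by translations. -/
instance shiftAction : MulSemiringAction (Multiplicative (ι → ℤ)) (RatField ι) :=
  MulSemiringAction.compHom (RatField ι) (shiftField (ι := ι))

instance shiftAction_smulComm : SMulCommClass (Multiplicative (ι → ℤ)) Ch (RatField ι) where
  smul_comm l a f := map_smul (shiftField l) a f

variable (ι) in
/-- The difference algebra `ℂ(𝔱 × 𝔸¹) ⋊ X_*(T)` of the torus with cocharacter lattice `ℤ^ι`, with
`(f(t,ħ) d_λ) (g(t,ħ) d_μ) = f(t,ħ) g(t + λ ħ, ħ) d_{λ+μ}`. -/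
def DiffAlg : Type _ := SkewMonoidAlgebra (RatField ι) (Multiplicative (ι → ℤ))

instance : Ring (DiffAlg ι) :=
  inferInstanceAs (Ring (SkewMonoidAlgebra (RatField ι) (Multiplicative (ι → ℤ))))

instance : Algebra Ch (DiffAlg ι) :=
  inferInstanceAs (Algebra Ch (SkewMonoidAlgebra (RatField ι) (Multiplicative (ι → ℤ))))

instance : Algebra ℚ (DiffAlg ι) :=
  Algebra.compHom (DiffAlg ι) (algebraMap ℚ Ch)

/-- The element `f d_λ` of the difference algebra. -/
def DiffAlg.single (l : ι → ℤ) (f : RatField ι) : DiffAlg ι :=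
  SkewMonoidAlgebra.single (Multiplicative.ofAdd l) f

variable (ι) in
/-- The inclusion of the rational functions, `f ↦ f d_0`. -/
def DiffAlg.ofRat : RatField ι →+* DiffAlg ι :=
  (SkewMonoidAlgebra.singleOneRingHom :
    RatField ι →+* SkewMonoidAlgebra (RatField ι) (Multiplicative (ι → ℤ)))

/-- Multiplication in the difference algebra. -/
theorem diff_mul (l m : ι → ℤ) (f g : RatField ι) :
    DiffAlg.single l f * DiffAlg.single m g =
      DiffAlg.single (l + m) (f * shiftField (Multiplicative.ofAdd l) g) :=
  SkewMonoidAlgebra.single_mul_single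

theorem ofRat_eq_single (f : RatField ι) : DiffAlg.ofRat ι f = DiffAlg.single 0 f := rfl

/-- The translation acts on the coordinates by `x_i ↦ x_i + λ_i ħ`. -/
theorem shiftField_X (l : ι → ℤ) (i : ι) :
    shiftField (Multiplicative.ofAdd l) (algebraMap (MvPolynomial ι Ch) (RatField ι)
      (MvPolynomial.X i)) = algebraMap (MvPolynomial ι Ch) (RatField ι) (MvPolynomial.X i) +
        algebraMap Ch (RatField ι) ((l i : Ch) * hbar) := by
  have h := IsFractionRing.fieldEquivOfAlgEquiv_algebraMap (FA := Ch) (FB := RatField ι)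
    (FC := RatField ι) (shiftPolyEquiv (Multiplicative.ofAdd l)) (MvPolynomial.X i)
  refine h.trans ?_
  have h2 : shiftPolyEquiv (Multiplicative.ofAdd l) (MvPolynomial.X i) =
      MvPolynomial.X i + MvPolynomial.C ((l i : Ch) * hbar) :=
    MvPolynomial.aeval_X _ i
  rw [h2, map_add]
  congr 1

end Difference

/-! ### Quivers with involution -/

/-- A quiver with involution `(Q, τ)`, simply-laced without loops, such that `τ` has no fixed
points on the set of vertices. -/
structure QuiverInvolution (Q₀ Q₁ : Type*) where
  s : Q₁ → Q₀
  t : Q₁ → Q₀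
  τ : Q₀ → Q₀
  τ₁ : Q₁ → Q₁
  τ_invol : ∀ i, τ (τ i) = i
  τ₁_invol : ∀ h, τ₁ (τ₁ h) = h
  s_τ₁ : ∀ h, s (τ₁ h) = τ (t h)
  t_τ₁ : ∀ h, t (τ₁ h) = τ (s h)
  τ_s_iff : ∀ h, τ (s h) = t h ↔ τ₁ h = h
  τ_ne : ∀ i, τ i ≠ i
  no_loop : ∀ h, s h ≠ t h
  simply_laced : ∀ h h', s(s h, t h) = s(s h', t h') → h = h'

namespace QuiverInvolution

theorem τ_inj {Q₀ Q₁ : Type*} (Q : QuiverInvolution Q₀ Q₁) : Function.Injective Q.τ :=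
  fun i j h => by rw [← Q.τ_invol i, h, Q.τ_invol]

variable {Q₀ Q₁ : Type*} [DecidableEq Q₀] [Fintype Q₁]
  (Q : QuiverInvolution Q₀ Q₁)

/-- `c_{ij} = -#{h : {s(h), t(h)} = {i, j}}` for `i ≠ j`, and `c_{ii} = 2`. -/
def c (i j : Q₀) : ℤ :=
  if i = j then 2
  else -((Finset.univ.filter fun h : Q₁ => s(Q.s h, Q.t h) = s(i, j)).card : ℤ)

/-- The Cartan matrix with involution of a quiver with involution. -/
def cartan : CartanInvolution Q₀ where
  c := Q.c
  τ := Q.τ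
  c_diag i := by simp [c]
  c_symm i j := by simp only [c, eq_comm (a := i) (b := j), Sym2.eq_swap (a := i) (b := j)]
  c_off i j hij := by
    have : (Finset.univ.filter fun h : Q₁ => s(Q.s h, Q.t h) = s(i, j)).card ≤ 1 := by
      rw [Finset.card_le_one]
      intro a ha b hb
      simp only [Finset.mem_filter, Finset.mem_univ, true_and] at ha hb
      exact Q.simply_laced a b (ha.trans hb.symm)
    simp only [c, hij, if_false]
    omega
  τ_invol := Q.τ_invol
  c_τ i j := by
    have key : (Finset.univ.filter fun h : Q₁ => s(Q.s h, Q.t h) = s(Q.τ i, Q.τ j)).card =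
        (Finset.univ.filter fun h : Q₁ => s(Q.s h, Q.t h) = s(i, j)).card := by
      refine Finset.card_bij' (fun h _ => Q.τ₁ h) (fun h _ => Q.τ₁ h) ?_ ?_
        (fun h _ => Q.τ₁_invol h) (fun h _ => Q.τ₁_invol h)
      · intro h hh
        simp only [Finset.mem_filter, Finset.mem_univ, true_and, Q.s_τ₁, Q.t_τ₁, Sym2.eq_iff] at hh ⊢
        rcases hh with ⟨h1, h2⟩ | ⟨h1, h2⟩ <;> simp [h1, h2, Q.τ_invol]
      · intro h hh
        simp only [Finset.mem_filter, Finset.mem_univ, true_and, Q.s_τ₁, Q.t_τ₁, Sym2.eq_iff] at hh ⊢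
        rcases hh with ⟨h1, h2⟩ | ⟨h1, h2⟩ <;> simp [h1, h2]
    simp only [c, key, Q.τ_inj.eq_iff]
  τ_ne := Q.τ_ne

/-- `δ_{i → τ i}`: `1` if there is an arrow from `i` to `τ i`, and `0` otherwise. -/
def δ (i : Q₀) : ℕ := by
  classical exact if ∃ h, Q.s h = i ∧ Q.t h = Q.τ i then 1 else 0

end QuiverInvolution

/-- A quiver with involution together with a decomposition `Q₀ = Q₀⁺ ⊔ Q₀⁻` exchanged
by `τ`, and dimension vectors `v` (which is `τ`-invariant) and `w`. -/
structure GaugeDatum (Q₀ Q₁ : Type*) extends QuiverInvolution Q₀ Q₁ where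
  plus : Finset Q₀
  mem_plus_iff : ∀ i, i ∈ plus ↔ τ i ∉ plus
  v : Q₀ → ℕ
  v_τ : ∀ i, v (τ i) = v i
  w : Q₀ → ℕ

namespace GaugeDatum

variable {Q₀ Q₁ : Type*} [Fintype Q₀] [DecidableEq Q₀] [Fintype Q₁] [DecidableEq Q₁]
  (G : GaugeDatum Q₀ Q₁)

/-- The set `Q₁^τ` of arrows fixed by `τ`. -/
def fixedArrows : Finset Q₁ := Finset.univ.filter fun h => G.τ₁ h = h

/-- The set of arrows with source `i`. -/
def arrowsFrom (i : Q₀) : Finset Q₁ := Finset.univ.filter fun h => G.s h = i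

/-- `μ = ∑_j (w_j + w_{τ j}) Λ_j + ∑_{h ∈ Q₁^τ} (Λ_{s(h)} + Λ_{t(h)}) - ∑_j v_j α_j^∨`. -/
def μ : Coweight Q₀ :=
  ∑ j, (G.w j + G.w (G.τ j)) • fundCoweight j
    + ∑ h ∈ G.fixedArrows, (fundCoweight (G.s h) + fundCoweight (G.t h))
    - ∑ j, G.v j • simpleCoroot j

/-- `ζ_i = ħ⁻¹ 2^{-c_{i,τ i}} (-1)^{v_i - 1 + δ_{i → τ i} + w_i + ∑_{s(h) = i} v_{t(h)}}`. -/
def ζ (i : Q₀) : Ch :=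
  hbar⁻¹ * 2 ^ (-G.c i (G.τ i)) *
    (-1) ^ ((G.v i : ℤ) - 1 + G.δ i + G.w i + ∑ h ∈ G.arrowsFrom i, (G.v (G.t h) : ℤ))

theorem c_eq (j i : Q₀) :
    G.c j i = (if j = i then 2 else 0) -
      ∑ h, ((if G.s h = i ∧ G.t h = j then 1 else 0) +
        (if G.t h = i ∧ G.s h = j then 1 else 0)) := by
  by_cases hji : j = i
  · subst hji
    have h0 : ∀ h : Q₁, ((if G.s h = j ∧ G.t h = j then (1 : ℤ) else 0) +
        (if G.t h = j ∧ G.s h = j then 1 else 0)) = 0 := by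
      intro h
      have := G.no_loop h
      rw [if_neg, if_neg] <;> [rfl; (rintro ⟨h1, h2⟩; exact this (h2.trans h1.symm));
        (rintro ⟨h1, h2⟩; exact this (h1.trans h2.symm))]
    simp [QuiverInvolution.c, h0]
  · simp only [QuiverInvolution.c, hji, if_false, Finset.card_filter, zero_sub, Nat.cast_sum]
    congr 1
    refine Finset.sum_congr rfl fun h _ => ?_
    by_cases h1 : G.s h = i ∧ G.t h = j
    · obtain ⟨rfl, rfl⟩ := h1
      simp [Ne.symm hji]
    · by_cases h2 : G.t h = i ∧ G.s h = j
      · obtain ⟨rfl, rfl⟩ := h2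
        simp [hji]
      · have h3 : ¬ (G.s h = j ∧ G.t h = i) := fun h' => h2 h'.symm
        simp [h1, h2, Sym2.eq_iff, h3]

theorem sum_v_c (i : Q₀) :
    ∑ j, (G.v j : ℤ) * G.c j i = 2 * G.v i - ∑ h ∈ G.arrowsFrom i, (G.v (G.t h) : ℤ)
      - ∑ h ∈ G.arrowsFrom (G.τ i), (G.v (G.t h) : ℤ) := by
  have h1 : ∑ h ∈ G.arrowsFrom (G.τ i), (G.v (G.t h) : ℤ) =
      ∑ h, if G.t h = i then (G.v (G.s h) : ℤ) else 0 := by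
    rw [arrowsFrom, Finset.sum_filter]
    refine Fintype.sum_equiv ⟨G.τ₁, G.τ₁, G.τ₁_invol, G.τ₁_invol⟩ _ _ fun h => ?_
    simp only [Equiv.coe_fn_mk, G.t_τ₁, G.s_τ₁, G.v_τ]
    have : G.τ (G.s h) = i ↔ G.s h = G.τ i :=
      ⟨fun h => by rw [← h, G.τ_invol], fun h => by rw [h, G.τ_invol]⟩
    simp [this]
  have h2 : ∀ j, (G.v j : ℤ) * G.c j i = (if j = i then 2 * (G.v i : ℤ) else 0) -
      ∑ h, ((if G.s h = i then (if G.t h = j then (G.v j : ℤ) else 0) else 0) +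
        (if G.t h = i then (if G.s h = j then (G.v j : ℤ) else 0) else 0)) := by
    intro j
    rw [c_eq, mul_sub, Finset.mul_sum]
    congr 1
    · split_ifs with h
      · rw [h, mul_comm]
      · simp
    · refine Finset.sum_congr rfl fun h _ => ?_
      simp only [mul_add, mul_ite, mul_one, mul_zero, ite_and]
  rw [h1, Finset.sum_congr rfl fun j _ => h2 j, Finset.sum_sub_distrib, Finset.sum_comm, sub_sub]
  congr 1
  · simp
  · rw [arrowsFrom, Finset.sum_filter, ← Finset.sum_add_distrib]
    refine Finset.sum_congr rfl fun h _ => ?_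
    rw [Finset.sum_add_distrib]
    congr 1
    · split_ifs <;> simp
    · split_ifs <;> simp

theorem sum_fixed_s (i : Q₀) :
    ∑ h ∈ G.fixedArrows, (if G.s h = i then (1 : ℤ) else 0) = G.δ i := by
  classical
  unfold QuiverInvolution.δ
  split_ifs with hex
  · obtain ⟨h, hs, ht⟩ := hex
    rw [Finset.sum_eq_single h]
    · simp [hs]
    · intro b hb hbh
      rw [if_neg]
      intro hbi
      refine hbh (G.simply_laced b h ?_)
      simp only [fixedArrows, Finset.mem_filter, Finset.mem_univ, true_and] at hb
      rw [← (G.τ_s_iff b).2 hb, hbi, hs, ht]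
    · intro hn
      refine absurd ?_ hn
      simp only [fixedArrows, Finset.mem_filter, Finset.mem_univ, true_and]
      rw [← G.τ_s_iff, hs, ht]
  · rw [Finset.sum_eq_zero]
    · simp
    · intro b hb
      rw [if_neg]
      intro hbi
      simp only [fixedArrows, Finset.mem_filter, Finset.mem_univ, true_and] at hb
      exact hex ⟨b, hbi, by rw [← (G.τ_s_iff b).2 hb, hbi]⟩

theorem sum_fixed_t (i : Q₀) :
    ∑ h ∈ G.fixedArrows, (if G.t h = i then (1 : ℤ) else 0) = G.δ (G.τ i) := by
  rw [← sum_fixed_s]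
  refine Finset.sum_congr rfl fun h hh => ?_
  simp only [fixedArrows, Finset.mem_filter, Finset.mem_univ, true_and] at hh
  rw [← (G.τ_s_iff h).2 hh]
  have : G.τ (G.s h) = i ↔ G.s h = G.τ i :=
    ⟨fun h => by rw [← h, G.τ_invol], fun h => by rw [h, G.τ_invol]⟩
  simp [this]

theorem μ_fst (i : Q₀) : G.μ.1 i = G.w i + G.w (G.τ i) + G.δ i + G.δ (G.τ i) := by
  rw [← sum_fixed_s, ← sum_fixed_t, add_assoc ((G.w i : ℤ) + _), ← Finset.sum_add_distrib]
  simp [μ, fundCoweight, simpleCoroot, Prod.fst_sum, Finset.sum_apply, Pi.single_apply,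
    Finset.sum_add_distrib, eq_comm]

theorem μ_snd (i : Q₀) : G.μ.2 i = -(G.v i : ℤ) := by
  simp [μ, fundCoweight, simpleCoroot, Prod.snd_sum, Finset.sum_apply, Pi.single_apply]

theorem μ_inv : G.cartan.τCoweight G.μ = G.μ := by
  refine Prod.ext (funext fun i => ?_) (funext fun i => ?_)
  · change G.μ.1 (G.τ i) = G.μ.1 i
    rw [μ_fst, μ_fst, G.τ_invol]
    ring
  · change G.μ.2 (G.τ i) = G.μ.2 i
    rw [μ_snd, μ_snd, G.v_τ]

theorem pairing_μ (i : Q₀) :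
    G.cartan.pairing i G.μ = G.w i + G.w (G.τ i) + G.δ i + G.δ (G.τ i) - 2 * G.v i
      + ∑ h ∈ G.arrowsFrom i, (G.v (G.t h) : ℤ)
      + ∑ h ∈ G.arrowsFrom (G.τ i), (G.v (G.t h) : ℤ) := by
  have h := G.sum_v_c i
  have h2 : ∑ j, G.μ.2 j * G.cartan.c j i = -∑ j, (G.v j : ℤ) * G.c j i := by
    rw [← Finset.sum_neg_distrib]
    refine Finset.sum_congr rfl fun j _ => ?_
    rw [μ_snd, neg_mul]
    rfl
  rw [CartanInvolution.pairing, h2, h, μ_fst]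
  ring

theorem hbar_ne_zero : hbar ≠ 0 := RatFunc.X_ne_zero

theorem ζ_τ (i : Q₀) : G.ζ i = (-1 : Ch) ^ G.cartan.pairing i G.μ * G.ζ (G.τ i) := by
  have hc : G.c (G.τ i) (G.τ (G.τ i)) = G.c i (G.τ i) := G.cartan.c_τ i (G.τ i)
  have hpar : ∀ a b : ℤ, Even (a - b) → (-1 : Ch) ^ a = (-1) ^ b := by
    intro a b hab
    have : (-1 : Ch) ^ (a - b) = 1 := hab.neg_one_zpow
    rwa [zpow_sub₀ (by simp), div_eq_one_iff_eq (zpow_ne_zero _ (by simp))] at this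
  rw [ζ, ζ, hc, G.pairing_μ, mul_left_comm, ← zpow_add₀ (by simp : (-1 : Ch) ≠ 0)]
  congr 1
  apply hpar
  rw [G.v_τ]
  refine ⟨G.v i - G.w (G.τ i) - G.δ (G.τ i)
    - ∑ h ∈ G.arrowsFrom (G.τ i), (G.v (G.t h) : ℤ), ?_⟩
  ring

/-- The parameters `(μ, ζ)` attached to the quiver and the dimension vectors. -/
def shiftDatum : ShiftDatum G.cartan where
  μ := G.μ
  μ_inv := G.μ_inv
  ζ := G.ζ
  ζ_ne i := mul_ne_zero (mul_ne_zero (inv_ne_zero hbar_ne_zero)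
    (zpow_ne_zero _ two_ne_zero)) (zpow_ne_zero _ (by simp))
  ζ_τ := G.ζ_τ

/-! ### The torus `T_V^τ`, the ring `H_{G_W}^*(pt)` and the operators `B_i(u)`, `H_i(u)` -/

/-- The index set of the coordinates `x_{i,r}`, `i ∈ Q₀⁺`, `1 ≤ r ≤ v_i`. -/
abbrev Coord : Type _ := Σ i : {i // i ∈ G.plus}, Fin (G.v i)

/-- For `i ∈ Q₀⁻` and `1 ≤ r ≤ v_i`, the coordinate index `(τ i, r)`. -/
def negCoord (i : Q₀) (hi : i ∉ G.plus) (r : Fin (G.v i)) : G.Coord :=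
  ⟨⟨G.τ i, by rw [G.mem_plus_iff, G.τ_invol]; exact hi⟩, Fin.cast (G.v_τ i).symm r⟩

/-- The field of rational functions on `Lie(T_V^τ) × 𝔸¹`. -/
abbrev K : Type _ := RatField G.Coord

/-- The difference algebra of `T_V^τ`. -/
abbrev Diff : Type _ := DiffAlg G.Coord

/-- `x_{i,r}` for `i ∈ Q₀`; for `i ∈ Q₀⁻` it is `-x_{τ i,r}`. -/
def x (i : Q₀) (r : Fin (G.v i)) : G.K :=
  if hi : i ∈ G.plus then algebraMap (MvPolynomial G.Coord Ch) G.K (MvPolynomial.X ⟨⟨i, hi⟩, r⟩)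
  else -algebraMap (MvPolynomial G.Coord Ch) G.K (MvPolynomial.X (G.negCoord i hi r))

/-- The cocharacter `ε_{i,r}` for `i ∈ Q₀`; for `i ∈ Q₀⁻` it is `-ε_{τ i,r}`. -/
def ε (i : Q₀) (r : Fin (G.v i)) : G.Coord → ℤ :=
  if hi : i ∈ G.plus then Pi.single ⟨⟨i, hi⟩, r⟩ 1 else -Pi.single (G.negCoord i hi r) 1

/-- The difference operator `d_{i,r}` for `i ∈ Q₀`; for `i ∈ Q₀⁻` it is `d_{τ i,r}⁻¹`. -/
def d (i : Q₀) (r : Fin (G.v i)) : G.Diff :=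
  DiffAlg.single (G.ε i r) 1

/-- The index set of the variables `w_{i,k}`, `i ∈ Q₀`, `1 ≤ k ≤ w_i`. -/
abbrev WCoord : Type _ := Σ i : Q₀, Fin (G.w i)

/-- `H_{G_W}^*(pt) = ⨂_i ℚ[w_{i,1}, …, w_{i,w_i}]^{S_{w_i}}`, as the algebra of invariants
of `∏_i S_{w_i}` in `ℚ[w_{i,k}]`. -/
def HW : Subalgebra ℚ (MvPolynomial G.WCoord ℚ) where
  carrier := {p | ∀ σ : (i : Q₀) → Equiv.Perm (Fin (G.w i)),
    MvPolynomial.rename (Equiv.sigmaCongrRight σ) p = p}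
  mul_mem' ha hb σ := by rw [map_mul, ha σ, hb σ]
  add_mem' ha hb σ := by rw [map_add, ha σ, hb σ]
  algebraMap_mem' q σ := AlgHom.commutes _ q

/-- `W_i(z) = ∏_k (z - w_{i,k})` as a polynomial over `ℚ[w_{i,k}]`. -/
def Wfull (i : Q₀) : Polynomial (MvPolynomial G.WCoord ℚ) :=
  ∏ k : Fin (G.w i), (Polynomial.X - Polynomial.C (MvPolynomial.X ⟨i, k⟩))

theorem coeff_Wfull_mem (i : Q₀) (n : ℕ) : (G.Wfull i).coeff n ∈ G.HW := by
  intro σ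
  have h : (G.Wfull i).map (MvPolynomial.rename (R := ℚ)
      (Equiv.sigmaCongrRight σ)).toRingHom = G.Wfull i := by
    rw [Wfull, Polynomial.map_prod]
    refine Fintype.prod_equiv (σ i) _ _ fun k => ?_
    simp
  conv_rhs => rw [← h, Polynomial.coeff_map]
  rfl

/-- `W_i(z) = ∏_k (z - w_{i,k})` as a polynomial over `H_{G_W}^*(pt)`. -/
def W (i : Q₀) : Polynomial G.HW :=
  ∑ n ∈ Finset.range (G.w i + 1), Polynomial.monomial n ⟨(G.Wfull i).coeff n, G.coeff_Wfull_mem i n⟩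

theorem map_W (i : Q₀) : (G.W i).map G.HW.val.toRingHom = G.Wfull i := by
  have hdeg : (G.Wfull i).natDegree < G.w i + 1 := by
    rw [Wfull, Polynomial.natDegree_prod_of_monic _ _ fun k _ => Polynomial.monic_X_sub_C _]
    simp
  conv_rhs => rw [(G.Wfull i).as_sum_range' _ hdeg]
  simp [W, Polynomial.map_sum]

/-- The algebra `Diff_ħ(T_V^τ) ⊗ H_{G_W}^*(pt)`. -/
abbrev DiffW : Type _ := G.Diff ⊗[ℚ] G.HW

/-- The inclusion of the rational functions, `f ↦ f ⊗ 1`. -/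
def ofK : G.K →+* G.DiffW :=
  (Algebra.TensorProduct.includeLeftRingHom).comp (DiffAlg.ofRat G.Coord)

/-- The inclusion of `H_{G_W}^*(pt)`, `f ↦ 1 ⊗ f`. -/
def ofHW : G.HW →+* G.DiffW := (Algebra.TensorProduct.includeRight : G.HW →ₐ[ℚ] G.DiffW).toRingHom

/-- `ħ` as a rational function. -/
def ħ : G.K := algebraMap Ch G.K hbar

/-- `V_i(z) = ∏_k (z - x_{i,k})`. -/
def V (i : Q₀) : Polynomial G.K := ∏ k, (Polynomial.X - Polynomial.C (G.x i k))

/-- `V_{i,r}(z) = V_i(z) / (z - x_{i,r})`. -/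
def Vr (i : Q₀) (r : Fin (G.v i)) : Polynomial G.K :=
  ∏ k ∈ Finset.univ.erase r, (Polynomial.X - Polynomial.C (G.x i k))

/-- The summand of `B_i(u)` without its factor `1 / (-u - x_{i,r} - ħ/2)`. -/
def y (i : Q₀) (r : Fin (G.v i)) : G.DiffW :=
  G.ofK ((∏ _h ∈ G.arrowsFrom i ∩ G.fixedArrows, (2 * G.x i r + 3 * G.ħ / 2))
      * (∏ h ∈ G.arrowsFrom i, (G.V (G.t h)).eval (G.x i r + G.ħ / 2)))
    * (G.W (G.τ i)).eval₂ G.ofHW (G.ofK (-G.x i r - G.ħ / 2))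
    * G.ofK ((G.Vr i r).eval (G.x i r))⁻¹
    * (G.d i r ⊗ₜ[ℚ] 1)

/-- The variable `u` in Laurent series in `u⁻¹`: the coefficient at `n` is that of `u^{-n}`. -/
def u (R : Type*) [Ring R] : LaurentSeries R := HahnSeries.single (-1) 1

/-- `B_i(u) = ∑_r 1 / (-u - x_{i,r} - ħ/2) ⋯ d_{i,r}`, expanded in `u⁻¹`. -/
def B (i : Q₀) : LaurentSeries G.DiffW :=
  ∑ r, ((-u G.K - HahnSeries.C (G.x i r) - HahnSeries.C (G.ħ / 2))⁻¹).map G.ofK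
    * HahnSeries.C (G.y i r)

/-- The factor of `H_i(u)` that does not involve `W`, expanded in `u⁻¹` over the field `K`. -/
def HV (i : Q₀) : LaurentSeries G.K :=
  (-1) ^ ((G.v i : ℤ) - 1)
    * (2 * u G.K / ((2 * u G.K - HahnSeries.C (G.ħ / 2)) * (2 * u G.K + HahnSeries.C (G.ħ / 2))))
        ^ G.c i (G.τ i)
    * (-1) ^ G.δ i
    * (((G.V i).eval₂ HahnSeries.C (-u G.K + HahnSeries.C (G.ħ / 2)))
        * ((G.V i).eval₂ HahnSeries.C (-u G.K - HahnSeries.C (G.ħ / 2))))⁻¹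
    * (∏ h ∈ G.arrowsFrom i, (G.V (G.t h)).eval₂ HahnSeries.C (-u G.K))
    * (∏ h ∈ G.arrowsFrom (G.τ i), (G.V (G.t h)).eval₂ HahnSeries.C (u G.K))

/-- `H_i(u)`, expanded in `u⁻¹`. -/
def H (i : Q₀) : LaurentSeries G.DiffW :=
  (G.HV i).map G.ofK
    * (G.W i).eval₂ (HahnSeries.C.comp G.ofHW) (-u G.DiffW)
    * (G.W (G.τ i)).eval₂ (HahnSeries.C.comp G.ofHW) (u G.DiffW)

/-- The algebra `Y_μ^τ(𝔤_Q) ⊗ H_{G_W}^*(pt)`. -/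
abbrev YangianW : Type _ := Yangian G.shiftDatum ⊗[ℚ] G.HW

/-- `h_i(z)` as a series with coefficients in `Y_μ^τ(𝔤_Q) ⊗ H_{G_W}^*(pt)`. -/
def hSeriesW (i : Q₀) : LaurentSeries G.YangianW :=
  (hSeries G.shiftDatum i).map
    (Algebra.TensorProduct.includeLeftRingHom : Yangian G.shiftDatum →+* G.YangianW)

/-- `b_i(z)` as a series with coefficients in `Y_μ^τ(𝔤_Q) ⊗ H_{G_W}^*(pt)`. -/
def bSeriesW (i : Q₀) : LaurentSeries G.YangianW :=
  (bSeries G.shiftDatum i).map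
    (Algebra.TensorProduct.includeLeftRingHom : Yangian G.shiftDatum →+* G.YangianW)

end GaugeDatum
end GKLO
end

/-!
Uniqueness holds because `ħ` is invertible: the generators of the Yangian are `ħ⁻¹` times the
coefficients of the series `h_i(z)` and `b_i(z)`, so the values on these series and
on `H_{G_W}^*(pt)` determine a homomorphism (`algHom_yangianW_ext`). For existence one has to
check that the coefficients of `H_i(u)` and `B_i(u)` satisfy the defining relations of the Yangian;
`freeLift_eq_of_rel` restates these relations without the factors `ħ⁻¹`, and `freeLift_rel` verifies
them.

*Relations among the `b`'s.* The coefficients of `-B_i(u)` are the modes `∑_a q_{i,a}^s y_{i,a}` of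
difference operators `y_{i,a}`, where `q_{i,a} = -x_{i,a} - ħ/2`, and `y_{i,a}` is semilinear over
the translation of `x_{i,a}` by `ħ`. Operators on different coordinates of the torus satisfy
the quadratic exchange relation
`(q - q' - c ħ/2) y y' = (q - q' + c ħ/2) y' y` (`exchange_y`): a translation changes at most two linear
factors of each `V_j`, those in the denominators `V_{i,a}` account for `c = 2`, and those of the arrows
for `c = -1`. `ExchangeSystem` abstracts this situation, and the relations between modes reduce to identities between rational functions for pairs and
triples of operators (`bb_of_ne`, `bb_self`, `lie_modeSum_of_ne`, `usualSerre`).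

*Mirror operators.* The exception is formed by `y_{i,a}` and `y_{τ i,a}`, which translate the same
coordinate in opposite directions, so that their products are functions (`y_mul_y_τ`). Up to an
explicit factor these products are the residues of `H_{τ i}(u)` at the points `x_{i,a} ± ħ/2`
(`residue_inl`, `residue_inr`); if `c_{i,τ i} = -1`, then `H_{τ i}(u)` may also have a pole
at `u = 0`, which is removed by multiplication with `u`. By Lagrange interpolation
(`coeff_partialFractions`) the residues give the coefficients of `H_{τ i}(u)` at negative powers
of `u` (`H_coeff_τ_eq_sum`), and this is what the right-hand sides of the relations between `b_i` and
`b_{τ i}` require (`lie_X_τ`, `X_X_τ_rel`).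

*Relations with the `h`'s.* A translation multiplies the scalar factor `HV` of `H_i(u)` by a ratio of
products of linear factors (`mapHom_HV`), which is the relation between `h` and `b` (`H_X_rel`). The
leading term of `H_i(u)` (`hasLead_HV`) accounts for `μ` and `ζ`, and the substitution `u ↦ -u` exchanges
`H_i` and `H_{τ i}` (`evalNeg_HV`).

*The Serre relation for `i` and `τ i`.* The symmetrized double commutators are combinations of
cubic expressions `zTerm` and `zTermSelf`, and the sums over `p` on the right are combinations of the
elements `geomLie`, the coefficients of the product of `[y, H_{τ i}(u)]` with a geometric series
of ratio `q/3u`. Both families satisfy the same recursion of order one, which for `geomLie` is its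
definition, and the same recursion of order two, which for `geomLie` follows from the exchange relation
of `H_{τ i}` with `y`. Hence their difference satisfies two homogeneous linear recursions whose
characteristic polynomials have no common root, so it vanishes (`geomLie_eq`). In particular
the part of `H_{τ i}(u)` that is polynomial in `u` need not be known.
-/

noncomputable section

namespace GKLO

/-! ### Systems of difference operators with quadratic exchange relations -/

section Exchange

variable {K A P : Type*} [Field K] [Ring A] [Module K A]

/-- A family of operators `y p` on a left `K`-space, each semilinear over the endomorphism `σ p`
of `K`. The spectral parameter `q p` of `y p` is shifted by `-ħ` under `σ p`, and by `+ħ` under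
`σ (τ p)`. Two operators that are not attached to the same torus coordinate satisfy the exchange
relation of Yangian type with structure constant `c`. -/
structure ExchangeSystem (τ : P → P) (c : P → P → K) (ħ : K) (σ : P → K →+* K) (q : P → K)
    (y : P → A) : Prop where
  twist : ∀ p (α : K) (z : A), y p * α • z = σ p α • (y p * z)
  ħ_ne : ħ ≠ 0
  σ_ħ : ∀ p, σ p ħ = ħ
  σ_self : ∀ p, σ p (q p) = q p - ħ
  σ_ne : ∀ p p', p' ≠ p → p' ≠ τ p → σ p (q p') = q p'
  q_τ : ∀ p, q (τ p) = -q p - ħ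
  τ_invol : ∀ p, τ (τ p) = p
  exch : ∀ p p', p' ≠ p → p' ≠ τ p →
    (q p - q p' - c p p' / 2 * ħ) • (y p * y p') = (q p - q p' + c p p' / 2 * ħ) • (y p' * y p)

variable [CharZero K] [IsScalarTower K A A]
  {τ : P → P} {c : P → P → K} {ħ : K} {σ : P → K →+* K} {q : P → K} {y : P → A}

omit [Field K] [Module K A] [CharZero K] [IsScalarTower K A A] in
theorem sum_lie_sum' {α β : Type*} [Fintype α] [Fintype β] (F : α → A) (F' : β → A) :
    ⁅∑ a, F a, ∑ b, F' b⁆ = ∑ a, ∑ b, ⁅F a, F' b⁆ := by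
  simp only [Ring.lie_def, Finset.sum_mul_sum, Finset.sum_sub_distrib]
  rw [Finset.sum_comm (s := (Finset.univ : Finset β))]

/-- The mode `∑_a q(f a)^k y(f a)` of the generating series of the operators `y (f a)`. -/
def modeSum {α : Type*} [Fintype α] (q : P → K) (y : P → A) (f : α → P) (k : ℕ) : A :=
  ∑ a, q (f a) ^ k • y (f a)

/-- The defect of the relation between modes of two series of operators, for one pair of summands. -/
def bbTerm (q : P → K) (y : P → A) (ħ k : K) (r s : ℕ) (p p' : P) : A :=
  ⁅q p ^ (r + 1) • y p, q p' ^ s • y p'⁆ - ⁅q p ^ r • y p, q p' ^ (s + 1) • y p'⁆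
    - (k / 2 * ħ) • anticomm (q p ^ r • y p) (q p' ^ s • y p')

omit [CharZero K] [IsScalarTower K A A] in
theorem sum_bbTerm {α β : Type*} [Fintype α] [Fintype β] (k : K) (r s : ℕ) (f : α → P)
    (g : β → P) :
    ⁅modeSum q y f (r + 1), modeSum q y g s⁆ - ⁅modeSum q y f r, modeSum q y g (s + 1)⁆
      - (k / 2 * ħ) • anticomm (modeSum q y f r) (modeSum q y g s)
      = ∑ a, ∑ b, bbTerm q y ħ k r s (f a) (g b) := by
  simp only [modeSum, bbTerm, anticomm, sum_lie_sum', Finset.sum_sub_distrib,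
    ← Finset.smul_sum, Finset.sum_mul_sum, Finset.sum_add_distrib]
  rw [Finset.sum_comm (s := (Finset.univ : Finset β))]

namespace ExchangeSystem

variable (S : ExchangeSystem τ c ħ σ q y)
include S

/-- A difference `q p - q p' + κ` with `κ` fixed by `σ p` is changed by `σ p`, hence nonzero. -/
theorem sub_ne (p p' : P) (h : p' ≠ p) (h' : p' ≠ τ p) (κ : K) (hκ : σ p κ = κ) :
    q p - q p' + κ ≠ 0 := by
  intro h0
  have h1 := congrArg (σ p) h0
  rw [map_add, map_sub, S.σ_self, S.σ_ne p p' h h', hκ, map_zero] at h1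
  exact S.ħ_ne (by linear_combination h0 - h1)

theorem two_mul_ne (p : P) (κ : K) (hκ : σ p κ = κ) : 2 * q p + κ ≠ 0 := by
  intro h0
  have h1 := congrArg (σ p) h0
  rw [map_add, map_mul, S.σ_self, hκ, map_zero, map_ofNat] at h1
  exact S.ħ_ne (by linear_combination (h0 - h1) / 2)

/-- Exchange in solved form. -/
theorem swap (p p' : P) (h : p' ≠ p) (h' : p' ≠ τ p) (k : K) (hk : c p p' = k)
    (hσ : σ p (k / 2 * ħ) = k / 2 * ħ) :
    y p * y p' = ((q p - q p' + k / 2 * ħ) / (q p - q p' - k / 2 * ħ)) • (y p' * y p) := by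
  have hne : q p - q p' - k / 2 * ħ ≠ 0 := by
    have := S.sub_ne p p' h h' (-(k / 2 * ħ)) (by rw [map_neg, hσ])
    rwa [← sub_eq_add_neg] at this
  have := S.exch p p' h h'
  rw [hk] at this
  rw [div_eq_inv_mul, mul_smul, ← this, smul_smul, inv_mul_cancel₀ hne, one_smul]

theorem mul_smul_of_ne (p p' : P) (h : p' ≠ p) (h' : p' ≠ τ p) (m n : ℕ) :
    (q p ^ m • y p) * (q p' ^ n • y p') = (q p ^ m * q p' ^ n) • (y p * y p') := by
  rw [smul_mul_assoc, S.twist, map_pow, S.σ_ne p p' h h', smul_smul]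

theorem mul_smul_self (p : P) (m n : ℕ) :
    (q p ^ m • y p) * (q p ^ n • y p) = (q p ^ m * (q p - ħ) ^ n) • (y p * y p) := by
  rw [smul_mul_assoc, S.twist, map_pow, S.σ_self, smul_smul]

theorem σ_τ (p : P) : σ p (q (τ p)) = -q p := by
  rw [S.q_τ, map_sub, map_neg, S.σ_self, S.σ_ħ]
  ring

theorem mul_smul_τ (p : P) (m n : ℕ) :
    (q p ^ m • y p) * (q (τ p) ^ n • y (τ p)) =
      (q p ^ m * (-q p) ^ n) • (y p * y (τ p)) := by
  rw [smul_mul_assoc, S.twist, map_pow, S.σ_τ, smul_smul]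

theorem mul_smul_τ' (p : P) (m n : ℕ) :
    (q (τ p) ^ m • y (τ p)) * (q p ^ n • y p) =
      (q (τ p) ^ m * (-q (τ p)) ^ n) • (y (τ p) * y p) := by
  have := S.mul_smul_τ (τ p) m n
  rwa [S.τ_invol] at this

theorem ne_symm' {p p' : P} (h' : p' ≠ τ p) : p ≠ τ p' := fun h => h' (by rw [h, S.τ_invol])

theorem bbTerm_of_ne (p p' : P) (h : p' ≠ p) (h' : p' ≠ τ p) (r s : ℕ) :
    bbTerm q y ħ (c p p') r s p p' = 0 := by
  have h1 := S.exch p p' h h'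
  simp only [bbTerm, anticomm, Ring.lie_def, S.mul_smul_of_ne p p' h h',
    S.mul_smul_of_ne p' p h.symm (S.ne_symm' h')]
  linear_combination (norm := module) (q p ^ r * q p' ^ s) • h1

theorem bbTerm_self (p : P) (r s : ℕ) : bbTerm q y ħ 2 r s p p = 0 := by
  simp only [bbTerm, anticomm, Ring.lie_def, S.mul_smul_self]
  module

theorem bbTerm_τ (p : P) (r s : ℕ) :
    bbTerm q y ħ (-1) r s p (τ p) = (-1 : K) ^ r • (((-q p) ^ (r + s) * (2 * q p + ħ / 2)) •
      (y p * y (τ p)) + (q (τ p) ^ (r + s) * (2 * q (τ p) + ħ / 2)) • (y (τ p) * y p)) := by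
  simp only [bbTerm, anticomm, Ring.lie_def, S.mul_smul_τ, S.mul_smul_τ']
  match_scalars
  · rcases neg_one_pow_eq_or K s with hs | hs <;> rcases neg_one_pow_eq_or K r with hr | hr <;>
    · rw [neg_pow (q p) s, neg_pow (q p) (s + 1), neg_pow (q p) (r + s), pow_add (-1) r s, pow_succ (-1) s, hs, hr]
      ring
  · rw [neg_pow (q (τ p)) r, neg_pow (q (τ p)) (r + 1)]
    ring

/-- The commutation relation of modes at two vertices whose coordinates are unrelated. -/
theorem bb_of_ne {α β : Type*} [Fintype α] [Fintype β] (k : K) (r s : ℕ) (f : α → P) (g : β → P)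
    (h : ∀ a b, g b ≠ f a) (h' : ∀ a b, g b ≠ τ (f a)) (hc : ∀ a b, c (f a) (g b) = k) :
    ⁅modeSum q y f (r + 1), modeSum q y g s⁆ - ⁅modeSum q y f r, modeSum q y g (s + 1)⁆
      = (k / 2 * ħ) • anticomm (modeSum q y f r) (modeSum q y g s) := by
  rw [← sub_eq_zero, sum_bbTerm]
  refine Finset.sum_eq_zero fun a _ => Finset.sum_eq_zero fun b _ => ?_
  rw [← hc a b, S.bbTerm_of_ne _ _ (h a b) (h' a b)]

/-- The commutation relation of modes at one vertex. The summands with equal indices are not covered by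
the exchange relation; they satisfy the relation because of the shift of `q p` under `σ p`. -/
theorem bb_self {α : Type*} [Fintype α] (r s : ℕ) (f : α → P) (hf : Function.Injective f)
    (h' : ∀ a b, f b ≠ τ (f a)) (hc : ∀ a b, c (f a) (f b) = 2) :
    ⁅modeSum q y f (r + 1), modeSum q y f s⁆ - ⁅modeSum q y f r, modeSum q y f (s + 1)⁆
      = ((2 : K) / 2 * ħ) • anticomm (modeSum q y f r) (modeSum q y f s) := by
  rw [← sub_eq_zero, sum_bbTerm]
  refine Finset.sum_eq_zero fun a _ => Finset.sum_eq_zero fun b _ => ?_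
  rcases eq_or_ne b a with rfl | hab
  · exact S.bbTerm_self _ r s
  · rw [← hc a b, S.bbTerm_of_ne _ _ (hf.ne hab) (h' a b)]

/-- The commutation relation of modes at a vertex and its mirror image with structure constant `-1`.
The pairs of operators on the same coordinate give the correction by products of mirror operators. -/
theorem bb_τ {α : Type*} [Fintype α] (r s : ℕ) (f : α → P) (hf : Function.Injective f)
    (h' : ∀ a b, f b ≠ τ (f a)) (hc : ∀ a b, c (f a) (τ (f b)) = -1) :
    ⁅modeSum q y f (r + 1), modeSum q y (τ ∘ f) s⁆
        - ⁅modeSum q y f r, modeSum q y (τ ∘ f) (s + 1)⁆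
      = (-1 / 2 * ħ) • anticomm (modeSum q y f r) (modeSum q y (τ ∘ f) s) +
        (-1 : K) ^ r • ∑ a, (((-q (f a)) ^ (r + s) * (2 * q (f a) + ħ / 2)) •
          (y (f a) * y (τ (f a))) + (q (τ (f a)) ^ (r + s) * (2 * q (τ (f a)) + ħ / 2)) •
          (y (τ (f a)) * y (f a))) := by
  rw [← sub_eq_iff_eq_add', sum_bbTerm, Finset.smul_sum]
  refine Finset.sum_congr rfl fun a _ => ?_
  rw [Finset.sum_eq_single a]
  · exact S.bbTerm_τ _ r s
  · intro b _ hb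
    rw [← hc a b]
    refine S.bbTerm_of_ne _ _ (fun h => h' a b ?_) (fun h => hb (hf ?_)) r s
    · rw [← h]; exact (S.τ_invol _).symm
    · rw [← S.τ_invol (f b), ← S.τ_invol (f a)]; exact congrArg τ h
  · simp

theorem lie_of_ne (p p' : P) (h : p' ≠ p) (h' : p' ≠ τ p) (hc : c p p' = 0) (r s : ℕ) :
    ⁅q p ^ r • y p, q p' ^ s • y p'⁆ = 0 := by
  have h1 := S.swap p p' h h' 0 hc (by simp)
  have h2 := S.sub_ne p p' h h' 0 (by simp)
  rw [zero_div, zero_mul, add_zero, sub_zero, div_self (by simpa using h2), one_smul] at h1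
  rw [Ring.lie_def, S.mul_smul_of_ne p p' h h', S.mul_smul_of_ne p' p h.symm (S.ne_symm' h'), h1,
    mul_comm, sub_self]

theorem lie_modeSum_of_ne {α β : Type*} [Fintype α] [Fintype β] (r s : ℕ) (f : α → P) (g : β → P)
    (h : ∀ a b, g b ≠ f a) (h' : ∀ a b, g b ≠ τ (f a)) (hc : ∀ a b, c (f a) (g b) = 0) :
    ⁅modeSum q y f r, modeSum q y g s⁆ = 0 := by
  simp only [modeSum, sum_lie_sum']
  exact Finset.sum_eq_zero fun a _ => Finset.sum_eq_zero fun b _ =>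
    S.lie_of_ne _ _ (h _ _) (h' _ _) (hc _ _) r s

/-- The commutator of modes at a vertex and its mirror image with structure constant `0`: only
the pairs of operators on the same coordinate contribute. -/
theorem lie_modeSum_τ {α : Type*} [Fintype α] (r s : ℕ) (f : α → P) (hf : Function.Injective f)
    (h' : ∀ a b, f b ≠ τ (f a)) (hc : ∀ a b, c (f a) (τ (f b)) = 0) :
    ⁅modeSum q y f r, modeSum q y (τ ∘ f) s⁆ =
      (-1 : K) ^ r • ∑ a, ((-q (f a)) ^ (r + s) • (y (f a) * y (τ (f a)))
        - q (τ (f a)) ^ (r + s) • (y (τ (f a)) * y (f a))) := by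
  simp only [modeSum, sum_lie_sum', Finset.smul_sum]
  refine Finset.sum_congr rfl fun a _ => ?_
  rw [Finset.sum_eq_single a]
  · simp only [Function.comp, Ring.lie_def, S.mul_smul_τ, S.mul_smul_τ']
    match_scalars
    · rcases neg_one_pow_eq_or K s with hs | hs <;> rcases neg_one_pow_eq_or K r with hr | hr <;>
      · rw [neg_pow (q (f a)) s, neg_pow (q (f a)) (r + s), pow_add (-1) r s, hs, hr]
        ring
    · rw [neg_pow (q (τ (f a))) r]
      ring
  · intro b _ hb
    refine S.lie_of_ne _ _ (fun h => h' a b ?_) (fun h => hb (hf ?_)) (hc a b) r s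
    · rw [← h]; exact (S.τ_invol _).symm
    · rw [← S.τ_invol (f b), ← S.τ_invol (f a)]; exact congrArg τ h
  · simp

end ExchangeSystem

end Exchange

/-! ### Serre relations -/

section Serre

variable {K A P : Type*} [Field K] [Ring A] [Module K A] [CharZero K] [IsScalarTower K A A]
  {τ : P → P} {c : P → P → K} {ħ : K} {σ : P → K →+* K} {q : P → K} {y : P → A}

/-- The double commutator of modes of three operators. -/
def brTerm (q : P → K) (y : P → A) (k l r : ℕ) (p p' p'' : P) : A :=
  ⁅q p ^ k • y p, ⁅q p' ^ l • y p', q p'' ^ r • y p''⁆⁆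

/-- The sum of the double commutators over the permutations of the two exponents and of the
two outer operators. -/
def pairTerm (q : P → K) (y : P → A) (k l r : ℕ) (p p' p'' : P) : A :=
  (brTerm q y k l r p p' p'' + brTerm q y l k r p p' p'')
    + (brTerm q y k l r p' p p'' + brTerm q y l k r p' p p'')

omit [CharZero K] [IsScalarTower K A A] in
theorem pairTerm_comm (k l r : ℕ) (p p' p'' : P) :
    pairTerm q y k l r p p' p'' = pairTerm q y k l r p' p p'' := add_comm _ _

omit [CharZero K] [IsScalarTower K A A] in
/-- Every ordered pair of outer operators occurs twice in the sum of the `pairTerm`s, which accounts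
for the factor `2`. -/
theorem two_smul_sym₂ {α β : Type*} [Fintype α] [Fintype β] (f : α → P) (g : β → P) (k l r : ℕ) :
    (2 : K) • sym₂ (fun k l => ⁅modeSum q y f k, ⁅modeSum q y f l, modeSum q y g r⁆⁆) k l =
      ∑ e, ∑ a, ∑ b, pairTerm q y k l r (f a) (f b) (g e) := by
  have h : ∀ k l : ℕ, ⁅modeSum q y f k, ⁅modeSum q y f l, modeSum q y g r⁆⁆ =
      ∑ e, ∑ a, ∑ b, brTerm q y k l r (f a) (f b) (g e) := by
    intro k l
    have h0 : ∀ a b, ⁅q (f a) ^ k • y (f a), ∑ e, ⁅q (f b) ^ l • y (f b), q (g e) ^ r • y (g e)⁆⁆ =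
        ∑ e, brTerm q y k l r (f a) (f b) (g e) := fun a b => by
      simp only [brTerm, Ring.lie_def (q (f a) ^ k • y (f a)), Finset.mul_sum, Finset.sum_mul,
        Finset.sum_sub_distrib]
    simp only [modeSum, sum_lie_sum', h0]
    rw [Finset.sum_comm (s := (Finset.univ : Finset β))]
    exact Finset.sum_congr rfl fun a _ => Finset.sum_comm
  have h' : ∀ k l : ℕ, ∑ e, ∑ a, ∑ b, brTerm q y k l r (f a) (f b) (g e) =
      ∑ e, ∑ a, ∑ b, brTerm q y k l r (f b) (f a) (g e) := fun k l =>
    Finset.sum_congr rfl fun e _ => Finset.sum_comm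
  simp only [pairTerm, Finset.sum_add_distrib]
  rw [← h', ← h', sym₂, h, h, two_smul]

namespace ExchangeSystem

variable (S : ExchangeSystem τ c ħ σ q y)
include S

theorem swap_two (p p' : P) (h : p' ≠ p) (h' : p' ≠ τ p) (hc : c p p' = 2) :
    y p * y p' = ((q p - q p' + ħ) / (q p - q p' - ħ)) • (y p' * y p) := by
  simpa using S.swap p p' h h' 2 hc (by simp [S.σ_ħ])

theorem swap_neg_one (p p' : P) (h : p' ≠ p) (h' : p' ≠ τ p) (hc : c p p' = -1) :
    y p * y p' = ((q p - q p' + ħ / 2 - ħ) / (q p - q p' + ħ / 2)) • (y p' * y p) := by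
  have := S.swap p p' h h' (-1) hc (by simp [S.σ_ħ, map_ofNat])
  rw [this]
  congr 2 <;> ring

theorem σ_c_ħ (p : P) : σ p (ħ / 2) = ħ / 2 := by simp [S.σ_ħ, map_ofNat]

/-- The Serre relation for two different outer operators, before the powers of the spectral
parameters are inserted. -/
theorem serre_core_ne (a b j : P) (hab : b ≠ a) (hab' : b ≠ τ a) (ha : j ≠ a) (ha' : j ≠ τ a)
    (hb : j ≠ b) (hb' : j ≠ τ b) (cab : c b a = 2) (ca : c a j = -1) (cb : c b j = -1) :
    ⁅y a, ⁅y b, y j⁆⁆ + ⁅y b, ⁅y a, y j⁆⁆ = 0 := by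
  have h1 := S.swap_neg_one a j ha ha' ca
  have h2 := S.swap_neg_one b j hb hb' cb
  have h3 := S.swap_two b a hab.symm (S.ne_symm' hab') cab
  have n1 := S.sub_ne a j ha ha' (ħ / 2) (S.σ_c_ħ a)
  have n2 := S.sub_ne b j hb hb' (ħ / 2) (S.σ_c_ħ b)
  have n3 := S.sub_ne b a hab.symm (S.ne_symm' hab') (-ħ) (by rw [map_neg, S.σ_ħ])
  rw [← sub_eq_add_neg] at n3
  have s1 : ∀ w, y a * (y j * w) =
      ((q a - q j + ħ / 2 - ħ) / (q a - q j + ħ / 2)) • (y j * (y a * w)) := fun w => by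
    rw [← mul_assoc, h1, smul_mul_assoc, mul_assoc]
  have s2 : ∀ w, y b * (y j * w) =
      ((q b - q j + ħ / 2 - ħ) / (q b - q j + ħ / 2)) • (y j * (y b * w)) := fun w => by
    rw [← mul_assoc, h2, smul_mul_assoc, mul_assoc]
  have e1 : σ a ((q b - q j + ħ / 2 - ħ) / (q b - q j + ħ / 2)) =
      (q b - q j + ħ / 2 - ħ) / (q b - q j + ħ / 2) := by
    simp [S.σ_ħ, map_ofNat, S.σ_ne a b hab hab', S.σ_ne a j ha ha']
  have e2 : σ b ((q a - q j + ħ / 2 - ħ) / (q a - q j + ħ / 2)) =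
      (q a - q j + ħ / 2 - ħ) / (q a - q j + ħ / 2) := by
    simp [S.σ_ħ, map_ofNat, S.σ_ne b a hab.symm (S.ne_symm' hab'), S.σ_ne b j hb hb']
  have e3 : σ j ((q b - q a + ħ) / (q b - q a - ħ)) = (q b - q a + ħ) / (q b - q a - ħ) := by
    simp [S.σ_ħ, S.σ_ne j a ha.symm (S.ne_symm' ha'), S.σ_ne j b hb.symm (S.ne_symm' hb')]
  simp only [Ring.lie_def, mul_sub, sub_mul, smul_mul_assoc, mul_assoc, h1, h2, s1, s2, S.twist, e1, e2, h3, e3]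
  have n4 : q b - q a = (q b - q j + ħ / 2) - (q a - q j + ħ / 2) := by ring
  rw [n4] at n3 ⊢
  clear h1 h2 h3 s1 s2 e1 e2 e3 n4
  generalize q a - q j + ħ / 2 = t at *
  generalize q b - q j + ħ / 2 = t' at *
  match_scalars
  field_simp
  ring

/-- The Serre relation for two equal outer operators, without powers of the spectral parameters. -/
theorem serre_core_self (a j : P) (ha : j ≠ a) (ha' : j ≠ τ a) (ca : c a j = -1) :
    ⁅y a, ⁅y a, y j⁆⁆ = 0 := by
  have h1 := S.swap_neg_one a j ha ha' ca
  have n1 := S.sub_ne a j ha ha' (ħ / 2) (S.σ_c_ħ a)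
  have n2 := S.sub_ne a j ha ha' (ħ / 2 - ħ) (by rw [map_sub, S.σ_c_ħ a, S.σ_ħ])
  rw [← add_sub_assoc] at n2
  have s1 : ∀ w, y a * (y j * w) =
      ((q a - q j + ħ / 2 - ħ) / (q a - q j + ħ / 2)) • (y j * (y a * w)) := fun w => by
    rw [← mul_assoc, h1, smul_mul_assoc, mul_assoc]
  have e1 : σ a ((q a - q j + ħ / 2 - ħ) / (q a - q j + ħ / 2)) =
      (q a - q j + ħ / 2 - 2 * ħ) / (q a - q j + ħ / 2 - ħ) := by
    simp only [map_div₀, map_sub, map_add, S.σ_self, S.σ_ne a j ha ha', S.σ_c_ħ, S.σ_ħ]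
    congr 1 <;> ring
  simp only [Ring.lie_def, mul_sub, sub_mul, smul_mul_assoc, mul_assoc, h1, s1, S.twist, e1]
  clear h1 s1 e1
  generalize q a - q j + ħ / 2 = t at *
  match_scalars
  field_simp
  ring

theorem brTerm_of_ne (k l r : ℕ) (a b j : P) (hab : b ≠ a) (hab' : b ≠ τ a) (ha : j ≠ a)
    (ha' : j ≠ τ a) (hb : j ≠ b) (hb' : j ≠ τ b) :
    brTerm q y k l r a b j = (q a ^ k * q b ^ l * q j ^ r) • ⁅y a, ⁅y b, y j⁆⁆ := by
  simp only [brTerm, Ring.lie_def, mul_sub, sub_mul, smul_mul_assoc, S.twist, map_pow,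
    S.σ_ne a b hab hab', S.σ_ne a j ha ha', S.σ_ne b j hb hb',
    S.σ_ne b a hab.symm (S.ne_symm' hab'), S.σ_ne j a ha.symm (S.ne_symm' ha'),
    S.σ_ne j b hb.symm (S.ne_symm' hb'), mul_assoc]
  module

/-- The second summand is antisymmetric in the exponents `k` and `l` and drops out of the
symmetrization. -/
theorem brTerm_self (k l r : ℕ) (a j : P) (ha : j ≠ a) (ha' : j ≠ τ a) :
    brTerm q y k l r a a j = (q a ^ k * (q a - ħ) ^ l * q j ^ r) • ⁅y a, ⁅y a, y j⁆⁆
      + ((q a ^ l * (q a - ħ) ^ k - q a ^ k * (q a - ħ) ^ l) * q j ^ r) •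
        (y j * (y a * y a) - y a * (y j * y a)) := by
  simp only [brTerm, Ring.lie_def, mul_sub, sub_mul, smul_mul_assoc, S.twist, map_pow,
    S.σ_self, S.σ_ne a j ha ha', S.σ_ne j a ha.symm (S.ne_symm' ha'), map_sub, S.σ_ħ,
    mul_assoc]
  module

theorem pairTerm_of_ne (k l r : ℕ) (a b j : P) (hab' : b ≠ τ a) (ha : j ≠ a)
    (ha' : j ≠ τ a) (hb : j ≠ b) (hb' : j ≠ τ b) (cab : c b a = 2) (ca : c a j = -1)
    (cb : c b j = -1) : pairTerm q y k l r a b j = 0 := by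
  rcases eq_or_ne b a with rfl | hab
  · have h := S.serre_core_self b j hb hb' cb
    simp only [pairTerm, S.brTerm_self _ _ _ _ _ ha ha', h]
    module
  · have h := S.serre_core_ne a b j hab hab' ha ha' hb hb' cab ca cb
    simp only [pairTerm, S.brTerm_of_ne _ _ _ a b j hab hab' ha ha' hb hb',
      S.brTerm_of_ne _ _ _ b a j hab.symm (S.ne_symm' hab') hb hb' ha ha']
    rw [add_eq_zero_iff_eq_neg] at h
    rw [h]
    module

/-- The Serre relation of modes at two vertices whose coordinates are unrelated, as a sum of
relations between three operators. -/
theorem usualSerre {α β : Type*} [Fintype α] [Fintype β] (f : α → P) (g : β → P) (k l r : ℕ)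
    (h' : ∀ a b, f b ≠ τ (f a)) (h1 : ∀ a b, g b ≠ f a) (h2 : ∀ a b, g b ≠ τ (f a))
    (cf : ∀ a b, c (f a) (f b) = 2) (cg : ∀ a b, c (f a) (g b) = -1) :
    sym₂ (fun k l => ⁅modeSum q y f k, ⁅modeSum q y f l, modeSum q y g r⁆⁆) k l = 0 := by
  have h := two_smul_sym₂ (q := q) (y := y) f g k l r
  rw [Finset.sum_eq_zero fun e _ => Finset.sum_eq_zero fun a _ => Finset.sum_eq_zero fun b _ =>
    S.pairTerm_of_ne k l r _ _ _ (h' a b) (h1 a e) (h2 a e) (h1 b e) (h2 b e) (cf b a) (cg a e)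
      (cg b e)] at h
  exact (smul_eq_zero_iff_right (two_ne_zero' K)).1 h

end ExchangeSystem

end Serre

/-! ### The Serre relation between a vertex and its mirror image -/

section ISerre

variable {K A P : Type*} [Field K] [Ring A] [Module K A] [CharZero K] [IsScalarTower K A A]
  {τ : P → P} {c : P → P → K} {ħ : K} {σ : P → K →+* K} {q : P → K} {y : P → A}

/-- The contribution of a mirror pair of operators `y p`, `y (τ p)` to `-ħ` times the coefficient of
`u^{-m-2}` in the Cartan series. -/
def cartanTerm (τ : P → P) (ħ : K) (q : P → K) (y : P → A) (m : ℕ) (p : P) : A :=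
  ((q p + ħ / 4) * (-q p) ^ m) • (y p * y (τ p))
    + ((q (τ p) + ħ / 4) * q (τ p) ^ m) • (y (τ p) * y p)

/-- The cubic expression in `y b`, `y p`, `y (τ p)`, for `b` unrelated to `p`, through which these
operators enter the symmetrized double commutators. -/
def zTerm (τ : P → P) (q : P → K) (y : P → A) (m : ℕ) (b p : P) : A :=
  (-q p) ^ m • (y p * (y b * y (τ p)) + y b * (y p * y (τ p)) - (2 : K) • (y p * (y (τ p) * y b)))
    + q (τ p) ^ m • (y (τ p) * (y b * y p) + y (τ p) * (y p * y b)
      - (2 : K) • (y b * (y (τ p) * y p)))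

/-- The analogue of `zTerm` for `b = p`. -/
def zTermSelf (τ : P → P) (ħ : K) (q : P → K) (y : P → A) (m : ℕ) (p : P) : A :=
  (-q p + ħ) ^ m • (y p * (y p * y (τ p))) - (2 : K) • ((-q p) ^ m • (y p * (y (τ p) * y p)))
    + q (τ p) ^ m • (y (τ p) * (y p * y p))

/-- `∑_{r ≥ 0} a^r [z, h_{m-r}]` for a sequence `h` that vanishes below `n₀`. -/
def geomLie (a : K) (z : A) (h : ℤ → A) (n₀ m : ℤ) : A :=
  ∑ r ∈ Finset.range (m - n₀ + 1).toNat, a ^ r • ⁅z, h (m - r)⁆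

omit [CharZero K] [IsScalarTower K A A] in
/-- The recursion of order one, which is the definition of a geometric series. -/
theorem geomLie_succ (a : K) (z : A) (h : ℤ → A) (n₀ m : ℤ) (hh : ∀ n < n₀, h n = 0) :
    geomLie a z h n₀ (m + 1) = ⁅z, h (m + 1)⁆ + a • geomLie a z h n₀ m := by
  unfold geomLie
  rcases lt_or_ge (m + 1) n₀ with hlt | hge
  · rw [hh _ hlt, show (m + 1 - n₀ + 1).toNat = 0 by omega, show (m - n₀ + 1).toNat = 0 by omega]
    simp [Ring.lie_def]
  · rw [show (m + 1 - n₀ + 1).toNat = (m - n₀ + 1).toNat + 1 by omega, Finset.sum_range_succ',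
      add_comm, Finset.smul_sum]
    congr 1
    · simp
    · refine Finset.sum_congr rfl fun r _ => ?_
      rw [smul_smul, pow_succ', show m + 1 - ((r + 1 : ℕ) : ℤ) = m - r by push_cast; ring]

omit [CharZero K] [IsScalarTower K A A] in
theorem geomLie_of_lt (a : K) (z : A) (h : ℤ → A) (n₀ m : ℤ) (hm : m < n₀) :
    geomLie a z h n₀ m = 0 := by
  rw [geomLie, show (m - n₀ + 1).toNat = 0 by omega, Finset.sum_range_zero]

namespace ExchangeSystem

variable (S : ExchangeSystem τ c ħ σ q y)
include S

/-- Normal forms of the products of `y b` with the products of mirror operators, and of `zTerm`. In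
terms of `t = q b + q p + ħ/2` and `D = q b - q p - 2ħ` all denominators are shifts of `t` and `D` by
multiples of `ħ`; they are supplied with the proofs that they do not vanish. -/
theorem zTerm_eq (b p : P) (h : p ≠ b) (h' : p ≠ τ b) (hc : c b p = 2) (hc' : c b (τ p) = -1) :
    ∃ t D : K, t ≠ 0 ∧ t + ħ ≠ 0 ∧ D + ħ ≠ 0 ∧ D ≠ 0 ∧ t = q b + q p + ħ / 2 ∧
      D = q b - q p - 2 * ħ ∧
      y b * (y p * y (τ p)) = ((D + 3 * ħ) * (t - ħ) / ((D + ħ) * t)) • (y p * (y (τ p) * y b)) ∧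
      y b * (y (τ p) * y p) = ((D + 2 * ħ) * t / (D * (t + ħ))) • (y (τ p) * (y p * y b)) ∧
      ∀ m, zTerm τ q y m b p =
        (4 * ħ * (q p + ħ / 4) / ((D + ħ) * t) * (-q p) ^ m) • (y p * (y (τ p) * y b)) +
        (4 * ħ * (q (τ p) + ħ / 4) / (D * (t + ħ)) * q (τ p) ^ m) •
          (y (τ p) * (y p * y b)) := by
  have hτ : τ p ≠ b := fun e => h' (by rw [← e, S.τ_invol])
  have hτ' : τ p ≠ τ b := fun e => h (by rw [← S.τ_invol p, e, S.τ_invol])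
  have h1 := S.swap_two b p h h' hc
  have h2 := S.swap_neg_one b (τ p) hτ hτ' hc'
  have n1 := S.sub_ne b (τ p) hτ hτ' (ħ / 2) (S.σ_c_ħ b)
  have n2 := S.sub_ne b (τ p) hτ hτ' (ħ / 2 - ħ) (by rw [map_sub, S.σ_c_ħ, S.σ_ħ])
  have n3 := S.sub_ne b p h h' (-ħ) (by rw [map_neg, S.σ_ħ])
  have n4 := S.sub_ne b p h h' (-(2 * ħ)) (by rw [map_neg, map_mul, S.σ_ħ, map_ofNat])
  rw [← sub_eq_add_neg] at n3 n4
  have hF : q b - q (τ p) + ħ / 2 = q b + q p + ħ / 2 + ħ := by rw [S.q_τ]; ring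
  rw [← add_sub_assoc, hF, add_sub_cancel_right] at n2
  rw [hF] at n1 h2
  rw [add_sub_cancel_right] at h2
  have e1 : σ p ((q b + q p + ħ / 2) / (q b + q p + ħ / 2 + ħ)) =
      (q b + q p + ħ / 2 - ħ) / (q b + q p + ħ / 2) := by
    simp only [map_div₀, map_add, S.σ_self, S.σ_ne p b h.symm (S.ne_symm' h'), S.σ_c_ħ,
      S.σ_ħ]
    congr 1 <;> ring
  have hσ : σ (τ p) (q p) = q p + ħ := by
    have := S.σ_τ (τ p)
    rw [S.τ_invol] at this
    rw [this, S.q_τ]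
    ring
  have e2 : σ (τ p) ((q b - q p + ħ) / (q b - q p - ħ)) =
      (q b - q p) / (q b - q p - 2 * ħ) := by
    simp only [map_div₀, map_sub, map_add, S.σ_ne (τ p) b hτ.symm (by rwa [S.τ_invol, ne_comm]),
      S.σ_ħ, hσ]
    congr 1 <;> ring
  have g1 : q b - q p + ħ = q b - q p - 2 * ħ + 3 * ħ := by ring
  have g2 : q b - q p - ħ = q b - q p - 2 * ħ + ħ := by ring
  have g3 : q b - q p = q b - q p - 2 * ħ + 2 * ħ := by ring
  rw [g1, g2] at h1 e2
  rw [g2] at n3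
  rw [g3, add_sub_cancel_right] at e2
  have f1 : y b * (y p * y (τ p)) = ((q b - q p - 2 * ħ + 3 * ħ) / (q b - q p - 2 * ħ + ħ)) •
      (((q b + q p + ħ / 2 - ħ) / (q b + q p + ħ / 2)) • (y p * (y (τ p) * y b))) := by
    rw [← mul_assoc, h1, smul_mul_assoc, mul_assoc, h2, S.twist, e1]
  have f2 : y b * (y (τ p) * y p) = ((q b + q p + ħ / 2) / (q b + q p + ħ / 2 + ħ)) •
      (((q b - q p - 2 * ħ + 2 * ħ) / (q b - q p - 2 * ħ)) • (y (τ p) * (y p * y b))) := by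
    rw [← mul_assoc, h2, smul_mul_assoc, mul_assoc, h1, S.twist, e2]
  refine ⟨_, _, n2, n1, n3, n4, rfl, rfl, ?_, ?_, fun m => ?_⟩
  · rw [f1, smul_smul, div_mul_div_comm]
  · rw [f2, smul_smul, div_mul_div_comm, mul_comm (q b - q p - 2 * ħ + 2 * ħ),
      mul_comm (q b - q p - 2 * ħ)]
  · rw [zTerm, f1, f2, h1, h2, S.twist, S.twist, e1, e2, S.q_τ]
    have hs : q p = (q b + q p + ħ / 2 - (q b - q p - 2 * ħ) - 5 / 2 * ħ) / 2 := by ring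
    clear h1 h2 e1 e2 f1 f2 hσ hF g1 g2 g3
    generalize q b + q p + ħ / 2 = t at *
    generalize q b - q p - 2 * ħ = D at *
    rw [hs]
    match_scalars
    · field_simp
      ring
    · field_simp
      ring

/-- The recursion of order one in `m`: the operator `z_{m+1} - (q b / 3) z_m` turns `zTerm` into
a commutator with the summand `cartanTerm` of the Cartan series. -/
theorem zTerm_succ (m : ℕ) (b p : P) (h : p ≠ b) (h' : p ≠ τ b) (hc : c b p = 2)
    (hc' : c b (τ p) = -1) :
    (3 / 4 : K) • (zTerm τ q y (m + 1) b p - (q b / 3) • zTerm τ q y m b p) =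
      -⁅y b, cartanTerm τ ħ q y m p⁆ := by
  have hτ : τ p ≠ b := fun e => h' (by rw [← e, S.τ_invol])
  have hτ' : τ p ≠ τ b := fun e => h (by rw [← S.τ_invol p, e, S.τ_invol])
  obtain ⟨t, D, n1, n2, n3, n4, ht, hD, f1, f2, hz⟩ := S.zTerm_eq b p h h' hc hc'
  rw [hz, hz, cartanTerm, Ring.lie_def]
  simp only [mul_add, add_mul, smul_mul_assoc, S.twist, map_mul, map_pow, map_add, map_neg,
    S.σ_ne b p h h', S.σ_ne b (τ p) hτ hτ', mul_assoc, f1, f2, map_div₀, S.σ_ħ, map_ofNat]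
  have hb : q b = (t + D + 3 / 2 * ħ) / 2 := by rw [ht, hD]; ring
  have hp : q p = (t - D - 5 / 2 * ħ) / 2 := by rw [ht, hD]; ring
  rw [S.q_τ, hb, hp]
  match_scalars
  · field_simp
    ring
  · field_simp
    ring

/-- The recursion of order two in `m`, with characteristic roots `q b + ħ/2` and `ħ - q b`. -/
theorem zTerm_quadratic (m : ℕ) (b p : P) (h : p ≠ b) (h' : p ≠ τ b) (hc : c b p = 2)
    (hc' : c b (τ p) = -1) :
    zTerm τ q y (m + 2) b p - (3 / 2 * ħ) • zTerm τ q y (m + 1) b p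
      + ((q b + ħ / 2) * (ħ - q b)) • zTerm τ q y m b p =
      -((4 * ħ) • (cartanTerm τ ħ q y m p * y b)) := by
  obtain ⟨t, D, n1, n2, n3, n4, ht, hD, f1, f2, hz⟩ := S.zTerm_eq b p h h' hc hc'
  rw [hz, hz, hz, cartanTerm]
  simp only [add_mul, smul_mul_assoc, mul_assoc]
  have hb : q b = (t + D + 3 / 2 * ħ) / 2 := by rw [ht, hD]; ring
  have hp : q p = (t - D - 5 / 2 * ħ) / 2 := by rw [ht, hD]; ring
  rw [S.q_τ, hb, hp]
  match_scalars
  · field_simp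
    ring
  · field_simp
    ring

/-- The recursion of order one for `b = p`. -/
theorem zTermSelf_succ (m : ℕ) (p : P) :
    (3 / 4 : K) • (zTermSelf τ ħ q y (m + 1) p - (q p / 3) • zTermSelf τ ħ q y m p) =
      -⁅y p, cartanTerm τ ħ q y m p⁆ := by
  rw [zTermSelf, zTermSelf, cartanTerm, Ring.lie_def]
  simp only [mul_add, add_mul, smul_mul_assoc, S.twist, map_mul, map_pow, map_add, map_neg,
    S.σ_self, S.σ_τ, mul_assoc, map_div₀, S.σ_ħ, map_ofNat]
  rw [S.q_τ]
  match_scalars <;> ring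

/-- The recursion of order two for `b = p`. -/
theorem zTermSelf_quadratic (m : ℕ) (p : P) :
    zTermSelf τ ħ q y (m + 2) p - (3 / 2 * ħ) • zTermSelf τ ħ q y (m + 1) p
      + ((q p + ħ / 2) * (ħ - q p)) • zTermSelf τ ħ q y m p =
      -((4 * ħ) • (cartanTerm τ ħ q y m p * y p)) := by
  rw [zTermSelf, zTermSelf, zTermSelf, cartanTerm]
  simp only [add_mul, smul_mul_assoc, mul_assoc]
  rw [S.q_τ]
  match_scalars <;> ring

end ExchangeSystem

end ISerre

section ISerre

variable {K A P : Type*} [Field K] [Ring A] [Module K A] [CharZero K] [IsScalarTower K A A]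
  {τ : P → P} {c : P → P → K} {ħ : K} {σ : P → K →+* K} {q : P → K} {y : P → A}

namespace ExchangeSystem

variable (S : ExchangeSystem τ c ħ σ q y)
include S

theorem σ_τ' (p : P) : σ (τ p) (q p) = -q (τ p) := by
  have := S.σ_τ (τ p)
  rwa [S.τ_invol] at this

/-- The double commutators depend on the exponents `k` and `r` essentially through `k + r`, as `q p` and
`q (τ p)` become opposite after a translation. -/
theorem pairTerm_τ_of_ne (k l r : ℕ) (p b : P) (h : p ≠ b) (h' : p ≠ τ b) :
    pairTerm q y k l r p b (τ p) = ((-1) ^ k * q b ^ l) • zTerm τ q y (k + r) b p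
      + ((-1) ^ l * q b ^ k) • zTerm τ q y (l + r) b p := by
  have hτ : τ p ≠ b := fun e => h' (by rw [← e, S.τ_invol])
  have hτ' : τ p ≠ τ b := fun e => h (by rw [← S.τ_invol p, e, S.τ_invol])
  simp only [pairTerm, brTerm, zTerm, Ring.lie_def, mul_sub, sub_mul, smul_mul_assoc, S.twist,
    map_pow, map_neg, S.σ_ne b p h h', S.σ_ne b (τ p) hτ hτ', S.σ_ne p b h.symm (S.ne_symm' h'),
    S.σ_ne (τ p) b hτ.symm (by rw [S.τ_invol]; exact h.symm), S.σ_τ, S.σ_τ', mul_assoc]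
  have hs : ∀ (x : K) (k : ℕ), x ^ k = (-1) ^ k * (-x) ^ k := fun x k => by
    rw [← mul_pow, neg_one_mul, neg_neg]
  rw [hs (q p) k, hs (q p) l, neg_pow (q (τ p)) k, neg_pow (q (τ p)) l]
  module

/-- The case of equal outer operators. Both orders of the outer operators agree here, hence the
factor `2`. -/
theorem pairTerm_τ_self (k l r : ℕ) (p : P) :
    pairTerm q y k l r p p (τ p) = (2 : K) • (((-1) ^ k * q p ^ l) • zTermSelf τ ħ q y (k + r) p
      + ((-1) ^ l * q p ^ k) • zTermSelf τ ħ q y (l + r) p) := by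
  have hσ : σ (τ p) (q p) = -(-q p - ħ) := by rw [S.σ_τ', S.q_τ]
  simp only [pairTerm, brTerm, zTermSelf, Ring.lie_def, mul_sub, sub_mul, smul_mul_assoc, S.twist,
    map_pow, map_neg, map_sub, S.σ_self, hσ, S.σ_ħ, mul_assoc, S.q_τ]
  obtain ⟨w, hw⟩ : ∃ w, q p = -w := ⟨-q p, (neg_neg _).symm⟩
  have hE : ∀ v : K, -v - ħ = -(v + ħ) := fun v => by ring
  simp only [hw, hE, neg_neg, add_sub_cancel_right, sub_add_cancel]
  simp only [neg_pow w, neg_pow (w + ħ), neg_pow (w - ħ)]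
  match_scalars <;> ring

/-- The value of the generating function of `[y p, h]` with kernel `∑ (q p / 3u)^r`. The Cartan series
enters only through its exchange relation with `y p` and through its principal part away
from `u = 0`; the part of the series that is polynomial in `u` does not contribute. -/
theorem geomLie_eq {α : Type*} [Fintype α] [DecidableEq α] (f : α → P)
    (hf : Function.Injective f) (h' : ∀ a b, f b ≠ τ (f a))
    (cf : ∀ a b, c (f a) (f b) = 2) (cg : ∀ a b, c (f a) (τ (f b)) = -1)
    (h : ℤ → A) (n₀ : ℤ) (hlow : ∀ n < n₀, h n = 0)
    (hhb : ∀ a m, y (f a) * h (m + 2) - (3 / 2 * ħ) • (y (f a) * h (m + 1))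
      + ((q (f a) + ħ / 2) * (ħ - q (f a))) • (y (f a) * h m) =
      h (m + 2) * y (f a) + (3 / 2 * ħ) • (h (m + 1) * y (f a))
      + ((q (f a) - ħ / 2) * (-q (f a) - ħ)) • (h m * y (f a)))
    (hres : ∀ m : ℕ, ħ • h (m + 1) = -∑ a, cartanTerm τ ħ q y m (f a)) (a : α) (m : ℕ) :
    ħ • geomLie (q (f a) / 3) (y (f a)) h n₀ m = (3 / 4 : K) • ∑ e,
      if e = a then zTermSelf τ ħ q y m (f a) else zTerm τ q y m (f a) (f e) := by
  set g : ℤ → A := geomLie (q (f a) / 3) (y (f a)) h n₀ with hg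
  have grec : ∀ m, g (m + 1) = ⁅y (f a), h (m + 1)⁆ + (q (f a) / 3) • g m :=
    fun m => geomLie_succ _ _ _ _ _ hlow
  have gquad : ∀ m, g (m + 2) - (3 / 2 * ħ) • g (m + 1)
      + ((q (f a) + ħ / 2) * (ħ - q (f a))) • g m = (3 * ħ) • (h (m + 1) * y (f a)) := by
    have hbase : ∀ m < n₀ - 2, g (m + 2) - (3 / 2 * ħ) • g (m + 1)
        + ((q (f a) + ħ / 2) * (ħ - q (f a))) • g m = (3 * ħ) • (h (m + 1) * y (f a)) := by
      intro m hm
      rw [hg, geomLie_of_lt _ _ _ _ _ (by omega), geomLie_of_lt _ _ _ _ _ (by omega),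
        geomLie_of_lt _ _ _ _ _ (by omega), hlow _ (by omega)]
      simp
    intro m
    rcases lt_or_ge m (n₀ - 3) with hm | hm
    · exact hbase m (by omega)
    · induction m, hm using Int.leInduction with
      | base => exact hbase _ (by omega)
      | succ m _ ih =>
        have e3 := grec (m + 2)
        have e2 := grec (m + 1)
        have e1 := grec m
        have hh := hhb a (m + 1)
        rw [show m + 2 + 1 = m + 1 + 2 by ring] at e3
        rw [show m + 1 + 1 = m + 2 by ring] at e2 hh ⊢
        rw [Ring.lie_def] at e1 e2 e3
        linear_combination (norm := module) e3 - (3 / 2 * ħ) • e2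
          + ((q (f a) + ħ / 2) * (ħ - q (f a))) • e1 + (q (f a) / 3) • ih + hh
  set Z : ℕ → A := fun m => ∑ e,
    if e = a then zTermSelf τ ħ q y m (f a) else zTerm τ q y m (f a) (f e) with hZ
  have Zrec : ∀ m, (3 / 4 : K) • (Z (m + 1) - (q (f a) / 3) • Z m) =
      ħ • ⁅y (f a), h (m + 1)⁆ := by
    intro m
    have : ħ • ⁅y (f a), h (m + 1)⁆ = ⁅y (f a), ħ • h (m + 1)⁆ := by
      rw [Ring.lie_def, Ring.lie_def, S.twist, S.σ_ħ, smul_mul_assoc, smul_sub]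
    rw [this, hres, Ring.lie_def, mul_neg, neg_mul, Finset.mul_sum, Finset.sum_mul, sub_neg_eq_add,
      ← sub_eq_neg_add, ← Finset.sum_sub_distrib, hZ]
    simp only [Finset.smul_sum, ← Finset.sum_sub_distrib]
    refine Finset.sum_congr rfl fun e _ => ?_
    refine Eq.trans ?_ (neg_sub _ _)
    rw [← Ring.lie_def]
    split_ifs with hea
    · rw [hea]
      exact S.zTermSelf_succ m (f a)
    · exact S.zTerm_succ m _ _ (hf.ne hea) (h' _ _) (cf _ _) (cg _ _)
  have Zquad : ∀ m, (3 / 4 : K) • (Z (m + 2) - (3 / 2 * ħ) • Z (m + 1)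
      + ((q (f a) + ħ / 2) * (ħ - q (f a))) • Z m) = (3 * ħ) • ((ħ • h (m + 1)) * y (f a)) := by
    intro m
    rw [hres, neg_mul, Finset.sum_mul, hZ]
    simp only [Finset.smul_sum, ← Finset.sum_sub_distrib, ← Finset.sum_add_distrib,
      ← Finset.sum_neg_distrib]
    refine Finset.sum_congr rfl fun e _ => ?_
    split_ifs with hea
    · rw [hea, S.zTermSelf_quadratic m (f a)]
      module
    · rw [S.zTerm_quadratic m _ _ (hf.ne hea) (h' _ _) (cf _ _) (cg _ _)]
      module
  -- The difference of both sides satisfies a linear and a quadratic recursion without common root.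
  have d1 : ħ • g (m + 1) - (3 / 4 : K) • Z (m + 1) =
      (q (f a) / 3) • (ħ • g m - (3 / 4 : K) • Z m) := by
    linear_combination (norm := module) ħ • grec m - Zrec m
  have d2 : ħ • g (m + 2) - (3 / 4 : K) • Z (m + 2) =
      (q (f a) / 3) • (ħ • g (m + 1) - (3 / 4 : K) • Z (m + 1)) := by
    have h1 := grec (m + 1)
    have h2 := Zrec (m + 1)
    rw [show (m : ℤ) + 1 + 1 = m + 2 by ring] at h1
    rw [show ((m + 1 : ℕ) : ℤ) + 1 = m + 2 by push_cast; ring] at h2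
    linear_combination (norm := module) ħ • h1 - h2
  have gq := gquad m
  have Zq := Zquad m
  rw [smul_mul_assoc] at Zq
  have d3 : ((q (f a) / 3 - q (f a) - ħ / 2) * (q (f a) / 3 + q (f a) - ħ)) •
      (ħ • g m - (3 / 4 : K) • Z m) = 0 := by
    linear_combination (norm := module) ħ • gq - Zq - d2
      - (q (f a) / 3 - 3 / 2 * ħ) • d1
  have n1 : q (f a) / 3 - q (f a) - ħ / 2 ≠ 0 := fun e =>
    S.two_mul_ne (f a) (3 / 2 * ħ) (by simp [S.σ_ħ, map_ofNat]) (by linear_combination -3 * e)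
  have n2 : q (f a) / 3 + q (f a) - ħ ≠ 0 := fun e =>
    S.two_mul_ne (f a) (-(3 / 2 * ħ)) (by simp [S.σ_ħ, map_ofNat])
      (by linear_combination 3 / 2 * e)
  exact sub_eq_zero.1 ((smul_eq_zero_iff_right (mul_ne_zero n1 n2)).1 d3)

/-- The Serre relation of modes at a vertex and its mirror image, for a sequence `h` that commutes
with `K`, satisfies the exchange relation with the operators `y (f a)`, and has the coefficients
prescribed by products of mirror operators in positive degrees. -/
theorem iSerre {α : Type*} [Fintype α] (f : α → P)
    (hf : Function.Injective f) (h' : ∀ a b, f b ≠ τ (f a))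
    (cf : ∀ a b, c (f a) (f b) = 2) (cg : ∀ a b, c (f a) (τ (f b)) = -1)
    (h : ℤ → A) (n₀ : ℤ) (hlow : ∀ n < n₀, h n = 0)
    (hK : ∀ n (x : K) (z : A), h n * x • z = x • (h n * z))
    (hhb : ∀ a m, y (f a) * h (m + 2) - (3 / 2 * ħ) • (y (f a) * h (m + 1))
      + ((q (f a) + ħ / 2) * (ħ - q (f a))) • (y (f a) * h m) =
      h (m + 2) * y (f a) + (3 / 2 * ħ) • (h (m + 1) * y (f a))
      + ((q (f a) - ħ / 2) * (-q (f a) - ħ)) • (h m * y (f a)))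
    (hres : ∀ m : ℕ, ħ • h (m + 1) = -∑ a, cartanTerm τ ħ q y m (f a)) (k l r : ℕ) :
    sym₂ (fun k l => ⁅modeSum q y f k, ⁅modeSum q y f l, modeSum q y (τ ∘ f) r⁆⁆) k l =
      (4 / 3 * ħ) • sym₂ (fun k l => (-1 : K) ^ k •
        ∑ s ∈ Finset.range ((k : ℤ) + r - n₀ + 1).toNat,
          ((3 : K) ^ s)⁻¹ • ⁅modeSum q y f (l + s), h ((k : ℤ) + r - s)⁆) k l := by
  classical
  -- The sum over `s` of the modes is a sum of geometric series, one for each operator.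
  have hX : ∀ k l : ℕ, ∑ s ∈ Finset.range ((k : ℤ) + r - n₀ + 1).toNat,
      ((3 : K) ^ s)⁻¹ • ⁅modeSum q y f (l + s), h ((k : ℤ) + r - s)⁆ =
      ∑ a, q (f a) ^ l • geomLie (q (f a) / 3) (y (f a)) h n₀ (k + r : ℕ) := by
    intro k l
    simp only [geomLie, Finset.smul_sum]
    rw [Finset.sum_comm]
    push_cast
    refine Finset.sum_congr rfl fun s _ => ?_
    simp only [modeSum, Ring.lie_def, Finset.sum_mul, Finset.mul_sum, ← Finset.sum_sub_distrib,
      Finset.smul_sum, smul_mul_assoc, hK]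
    refine Finset.sum_congr rfl fun a _ => ?_
    rw [div_pow, pow_add]
    module
  have hXZ : ∀ k l : ℕ, (4 / 3 * ħ) • ((-1 : K) ^ k •
      ∑ s ∈ Finset.range ((k : ℤ) + r - n₀ + 1).toNat,
        ((3 : K) ^ s)⁻¹ • ⁅modeSum q y f (l + s), h ((k : ℤ) + r - s)⁆) =
      ∑ a, ∑ e, ((-1) ^ k * q (f a) ^ l) • if e = a then zTermSelf τ ħ q y (k + r) (f a)
        else zTerm τ q y (k + r) (f a) (f e) := by
    intro k l
    rw [hX]
    simp only [Finset.smul_sum]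
    refine Finset.sum_congr rfl fun a _ => ?_
    have := S.geomLie_eq f hf h' cf cg h n₀ hlow hhb hres a (k + r)
    rw [← Finset.smul_sum]
    linear_combination (norm := module) (4 / 3 * (-1) ^ k * q (f a) ^ l) • this
  have h2 := two_smul_sym₂ (q := q) (y := y) f (τ ∘ f) k l r
  -- For the inner operator `y (τ (f e))`, only the pairs of outer operators containing `y (f e)`
  -- contribute.
  have hpair : ∀ e, ∑ a, ∑ b, pairTerm q y k l r (f a) (f b) ((τ ∘ f) e) =
      ∑ a, (2 : K) • (((-1) ^ k * q (f a) ^ l) • (if e = a then zTermSelf τ ħ q y (k + r) (f a)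
        else zTerm τ q y (k + r) (f a) (f e)) + ((-1) ^ l * q (f a) ^ k) •
        (if e = a then zTermSelf τ ħ q y (l + r) (f a) else zTerm τ q y (l + r) (f a) (f e))) := by
    intro e
    have hv : ∀ a b, a ≠ e → b ≠ e → pairTerm q y k l r (f a) (f b) ((τ ∘ f) e) = 0 := by
      intro a b ha hb
      have hne : ∀ a, a ≠ e → τ (f e) ≠ τ (f a) := fun a ha he => ha (hf (by
        rw [← S.τ_invol (f a), ← he, S.τ_invol]))
      exact S.pairTerm_of_ne k l r _ _ _ (h' a b) (fun he => h' e a he.symm) (hne a ha)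
        (fun he => h' e b he.symm) (hne b hb) (cf _ _) (cg _ _) (cg _ _)
    have hne : ∀ b, b ≠ e → pairTerm q y k l r (f e) (f b) ((τ ∘ f) e) =
        ((-1) ^ k * q (f b) ^ l) • zTerm τ q y (k + r) (f b) (f e)
          + ((-1) ^ l * q (f b) ^ k) • zTerm τ q y (l + r) (f b) (f e) := fun b hb =>
      S.pairTerm_τ_of_ne k l r _ _ (hf.ne hb.symm) (h' _ _)
    rw [← Finset.add_sum_erase _ _ (Finset.mem_univ e), ← Finset.add_sum_erase _ _
      (Finset.mem_univ e)]
    have h3 : ∑ a ∈ Finset.univ.erase e, ∑ b, pairTerm q y k l r (f a) (f b) ((τ ∘ f) e) =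
        ∑ a ∈ Finset.univ.erase e, pairTerm q y k l r (f e) (f a) ((τ ∘ f) e) := by
      refine Finset.sum_congr rfl fun a ha => ?_
      rw [Finset.sum_eq_single e, pairTerm_comm]
      · exact fun b _ hb => hv a b (Finset.ne_of_mem_erase ha) hb
      · simp
    rw [h3, add_assoc, ← Finset.sum_add_distrib, ← Finset.add_sum_erase _ (fun a => (2 : K) • _)
      (Finset.mem_univ e)]
    congr 1
    · rw [if_pos rfl, if_pos rfl]
      exact S.pairTerm_τ_self k l r (f e)
    · refine Finset.sum_congr rfl fun b hb => ?_
      have hb' := Finset.ne_of_mem_erase hb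
      rw [hne b hb', if_neg hb'.symm, if_neg hb'.symm, two_smul]
  have h2ne : (2 : K) ≠ 0 := two_ne_zero
  refine (smul_right_injective A h2ne) ?_
  change (2 : K) • _ = (2 : K) • _
  rw [h2, Finset.sum_congr rfl fun e _ => hpair e]
  rw [sym₂, smul_add (4 / 3 * ħ), hXZ, hXZ]
  simp only [smul_add, Finset.sum_add_distrib, Finset.smul_sum]
  congr 1 <;> rw [Finset.sum_comm]

end ExchangeSystem

end ISerre

/-! ### Laurent series in `u⁻¹` -/

section Laurent

open HahnSeries

/-- Application of a ring homomorphism to the coefficients of Laurent series, as a ring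
homomorphism. -/
def mapHom {R S : Type*} [Ring R] [Ring S] (f : R →+* S) : LaurentSeries R →+* LaurentSeries S where
  toFun x := x.map f
  map_zero' := by ext; simp
  map_one' := by
    ext n
    rw [map_coeff, coeff_one, coeff_one]
    split_ifs <;> simp
  map_add' x y := by ext; simp
  map_mul' x y := HahnSeries.map_mul (f : R →ₙ+* S)

theorem mapHom_coeff {R S : Type*} [Ring R] [Ring S] (f : R →+* S) (x : LaurentSeries R) (n : ℤ) :
    (mapHom f x).coeff n = f (x.coeff n) := rfl

theorem mapHom_C {R S : Type*} [Ring R] [Ring S] (f : R →+* S) (a : R) :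
    mapHom f (C a) = C (f a) := HahnSeries.map_C a f

theorem mapHom_u {R S : Type*} [Ring R] [Ring S] (f : R →+* S) :
    mapHom f (GaugeDatum.u R) = GaugeDatum.u S := by
  ext n
  rw [mapHom_coeff, GaugeDatum.u, GaugeDatum.u, coeff_single, coeff_single]
  split_ifs <;> simp

theorem coeff_u_mul {R : Type*} [Ring R] (x : LaurentSeries R) (n : ℤ) :
    (GaugeDatum.u R * x).coeff n = x.coeff (n + 1) := by
  rw [GaugeDatum.u, coeff_single_mul, one_mul, sub_neg_eq_add]

theorem coeff_C_mul {R : Type*} [Ring R] (a : R) (x : LaurentSeries R) (n : ℤ) :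
    (C a * x).coeff n = a * x.coeff n := by
  rw [C_apply, coeff_single_zero_mul]

theorem u_pow {R : Type*} [Ring R] (n : ℕ) : GaugeDatum.u R ^ n = single (-(n : ℤ)) 1 := by
  rw [GaugeDatum.u, single_pow, one_pow, smul_neg, nsmul_one]

theorem eval₂_u_coeff {R : Type*} [Ring R] (P : Polynomial R) (n : ℤ) (hn : 0 < n) :
    (P.eval₂ C (GaugeDatum.u R)).coeff n = 0 := by
  rw [Polynomial.eval₂_eq_sum, Polynomial.sum, coeff_sum]
  refine Finset.sum_eq_zero fun e _ => ?_
  rw [coeff_C_mul, u_pow, coeff_single, if_neg (by omega), mul_zero]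

variable {F : Type*} [Field F]

/-- The substitution `u ↦ -u`. -/
def evalNeg : LaurentSeries F →+* LaurentSeries F where
  toFun x := ⟨fun n => (-1) ^ n * x.coeff n, x.isPWO_support.mono fun n hn h => hn (by simp [h])⟩
  map_zero' := by ext; simp
  map_one' := by
    ext n
    rw [coeff_one]
    split_ifs with h <;> simp [h, coeff_one]
  map_add' x y := by ext; simp [mul_add]
  map_mul' x y := by
    ext n
    simp only [coeff_mul, Finset.mul_sum]
    have hs : ∀ z : LaurentSeries F, Function.support (fun n : ℤ => (-1) ^ n * z.coeff n) =
        z.support := fun z => by ext; simp [zpow_ne_zero]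
    refine Finset.sum_congr (by ext; simp [zpow_ne_zero]) fun ij hij => ?_
    rw [Finset.mem_antidiagonal] at hij
    rw [← hij.2.2, zpow_add₀ (by simp)]
    ring

theorem evalNeg_coeff (x : LaurentSeries F) (n : ℤ) : (evalNeg x).coeff n = (-1) ^ n * x.coeff n :=
  rfl

theorem evalNeg_C (a : F) : evalNeg (C a) = C a := by
  ext n
  rw [evalNeg_coeff, C_apply, coeff_single]
  split_ifs with h <;> simp [h]

theorem evalNeg_u : evalNeg (GaugeDatum.u F) = -GaugeDatum.u F := by
  ext n
  rw [evalNeg_coeff, coeff_neg, GaugeDatum.u, coeff_single]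
  split_ifs with h <;> simp [h]

/-- The expansion of `1 / (u - a)`. -/
def geom (a : F) : LaurentSeries F :=
  ofSuppBddBelow (fun n : ℤ => if 1 ≤ n then a ^ (n - 1).toNat else 0)
    ⟨1, fun n hn => by
      by_contra hlt
      exact hn (by simp [hlt])⟩

theorem geom_coeff_def (a : F) (n : ℤ) :
    (geom a).coeff n = if 1 ≤ n then a ^ (n - 1).toNat else 0 := rfl

theorem sub_mul_geom (a : F) : (GaugeDatum.u F - C a) * geom a = 1 := by
  ext n
  rw [sub_mul, coeff_sub, coeff_u_mul, coeff_C_mul, coeff_one, geom_coeff_def, geom_coeff_def]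
  rcases lt_trichotomy n 0 with h | h | h
  · rw [if_neg (by omega), if_neg (by omega), if_neg (by omega)]
    simp
  · subst h
    simp
  · rw [if_pos (by omega), if_pos (by omega), if_neg (by omega),
      show (n + 1 - 1).toNat = (n - 1).toNat + 1 by omega, pow_succ']
    ring

theorem u_sub_C_ne (a : F) : GaugeDatum.u F - C a ≠ 0 := left_ne_zero_of_mul_eq_one (sub_mul_geom a)

theorem inv_u_sub_C (a : F) : (GaugeDatum.u F - C a)⁻¹ = geom a :=
  inv_eq_of_mul_eq_one_right (sub_mul_geom a)

theorem geom_coeff (a : F) (n : ℕ) : (geom a).coeff (n + 1) = a ^ n := by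
  rw [geom_coeff_def, if_pos (by omega)]
  congr 1
  omega

theorem geom_coeff_of_le (a : F) (n : ℤ) (hn : n ≤ 0) : (geom a).coeff n = 0 := by
  rw [geom_coeff_def, if_neg (by omega)]

/-- Lagrange interpolation: the principal part of a rational function of `u` with simple
poles `a k` gives its coefficients at negative powers of `u`. -/
theorem coeff_partialFractions {α : Type*} [Fintype α] [DecidableEq α] (a : α → F)
    (ha : Function.Injective a) (P : Polynomial F) (Φ : LaurentSeries F)
    (h : Φ * ∏ k, (GaugeDatum.u F - C (a k)) = P.eval₂ C (GaugeDatum.u F)) (n : ℕ) :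
    Φ.coeff (n + 1) =
      ∑ k, a k ^ n * (P.eval (a k) * ∏ l ∈ Finset.univ.erase k, (a k - a l)⁻¹) := by
  set U := GaugeDatum.u F
  set N := ∏ k, (U - C (a k)) with hN
  have hN0 : N ≠ 0 := Finset.prod_ne_zero_iff.2 fun k _ => u_sub_C_ne _
  set Q := P /ₘ Lagrange.nodal Finset.univ a
  have hmod : P %ₘ Lagrange.nodal Finset.univ a =
      Lagrange.interpolate Finset.univ a fun k => P.eval (a k) := by
    refine Lagrange.eq_interpolate_of_eval_eq _ ha.injOn ?_ fun k _ => ?_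
    · rw [← Lagrange.degree_nodal (v := a)]
      exact Polynomial.degree_modByMonic_lt _ (Lagrange.nodal_monic)
    · conv_rhs => rw [← Polynomial.modByMonic_add_div P (Lagrange.nodal Finset.univ a)]
      rw [Polynomial.eval_add, Polynomial.eval_mul, Lagrange.eval_nodal_at_node (Finset.mem_univ k),
        zero_mul, add_zero]
  have hb : ∀ k, (Lagrange.basis Finset.univ a k).eval₂ C U =
      N * (C (∏ l ∈ Finset.univ.erase k, (a k - a l)⁻¹) * geom (a k)) := by
    intro k
    rw [Lagrange.basis, Polynomial.eval₂_finsetProd, hN,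
      ← Finset.mul_prod_erase _ _ (Finset.mem_univ k)]
    simp only [Lagrange.basisDivisor, Polynomial.eval₂_mul, Polynomial.eval₂_C,
      Polynomial.eval₂_sub, Polynomial.eval₂_X, Finset.prod_mul_distrib, map_prod]
    linear_combination (-(∏ l ∈ Finset.univ.erase k, C (a k - a l)⁻¹) *
      ∏ l ∈ Finset.univ.erase k, (U - C (a l))) * sub_mul_geom (a k)
  have hΦ : Φ = Q.eval₂ C U + ∑ k, C (P.eval (a k)) *
      (C (∏ l ∈ Finset.univ.erase k, (a k - a l)⁻¹) * geom (a k)) := by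
    refine mul_right_cancel₀ hN0 ?_
    rw [h]
    conv_lhs => rw [← Polynomial.modByMonic_add_div P (Lagrange.nodal Finset.univ a), hmod]
    rw [Polynomial.eval₂_add, Polynomial.eval₂_mul, Lagrange.interpolate_apply,
      Polynomial.eval₂_finsetSum, Lagrange.nodal_eq, Polynomial.eval₂_finsetProd]
    simp only [Polynomial.eval₂_mul, Polynomial.eval₂_C, hb, Polynomial.eval₂_sub,
      Polynomial.eval₂_X]
    rw [← hN, add_mul, Finset.sum_mul, add_comm, mul_comm]
    congr 1
    exact Finset.sum_congr rfl fun k _ => by ring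
  rw [hΦ, coeff_add, eval₂_u_coeff _ _ (by omega), zero_add, coeff_sum]
  refine Finset.sum_congr rfl fun k _ => ?_
  rw [coeff_C_mul, coeff_C_mul, geom_coeff]
  ring

/-- The Laurent series `x` has leading term `a u^{-n}`. -/
def HasLead (x : LaurentSeries F) (n : ℤ) (a : F) : Prop :=
  x ≠ 0 ∧ x.order = n ∧ x.leadingCoeff = a

theorem HasLead.of_coeff {x : LaurentSeries F} {n : ℤ} {a : F} (ha : a ≠ 0) (h : x.coeff n = a)
    (h' : ∀ m < n, x.coeff m = 0) : HasLead x n a := by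
  have hx : x ≠ 0 := by
    rintro rfl
    exact ha (by simpa using h.symm)
  have ho : x.order = n := le_antisymm (order_le_of_coeff_ne_zero (by rwa [h]))
    ((le_order_iff_forall hx).2 h')
  exact ⟨hx, ho, by rw [leadingCoeff_eq, ho, h]⟩

theorem HasLead.coeff_eq {x : LaurentSeries F} {n : ℤ} {a : F} (h : HasLead x n a) :
    x.coeff n = a := by
  rw [← h.2.2, leadingCoeff_eq, h.2.1]

theorem HasLead.coeff_of_lt {x : LaurentSeries F} {n m : ℤ} {a : F} (h : HasLead x n a)
    (hm : m < n) : x.coeff m = 0 := coeff_eq_zero_of_lt_order (by rwa [h.2.1])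

theorem HasLead.mul {x y : LaurentSeries F} {n m : ℤ} {a b : F} (h : HasLead x n a)
    (h' : HasLead y m b) : HasLead (x * y) (n + m) (a * b) :=
  ⟨mul_ne_zero h.1 h'.1, by rw [order_mul h.1 h'.1, h.2.1, h'.2.1],
    by rw [leadingCoeff_mul, h.2.2, h'.2.2]⟩

theorem HasLead.one : HasLead (1 : LaurentSeries F) 0 1 :=
  ⟨one_ne_zero, order_one, leadingCoeff_one⟩

theorem HasLead.inv {x : LaurentSeries F} {n : ℤ} {a : F} (h : HasLead x n a) :
    HasLead x⁻¹ (-n) a⁻¹ := by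
  have h0 := inv_ne_zero h.1
  have h1 := order_mul h.1 h0
  have h2 := leadingCoeff_mul x x⁻¹
  rw [mul_inv_cancel₀ h.1] at h1 h2
  rw [order_one, h.2.1] at h1
  rw [leadingCoeff_one, h.2.2] at h2
  exact ⟨h0, by omega, eq_inv_of_mul_eq_one_right h2.symm⟩

theorem HasLead.pow {x : LaurentSeries F} {n : ℤ} {a : F} (h : HasLead x n a) (k : ℕ) :
    HasLead (x ^ k) (k * n) (a ^ k) := by
  induction k with
  | zero => simpa using HasLead.one
  | succ k ih =>
    rw [pow_succ, pow_succ]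
    have := ih.mul h
    rwa [show (k : ℤ) * n + n = ((k + 1 : ℕ) : ℤ) * n by push_cast; ring] at this

theorem HasLead.zpow {x : LaurentSeries F} {n : ℤ} {a : F} (h : HasLead x n a) (k : ℤ) :
    HasLead (x ^ k) (k * n) (a ^ k) := by
  obtain ⟨k, rfl | rfl⟩ := k.eq_nat_or_neg
  · simpa using h.pow k
  · rw [zpow_neg, zpow_neg, zpow_natCast, zpow_natCast, neg_mul]
    exact (h.pow k).inv

theorem HasLead.prod {α : Type*} (s : Finset α) {x : α → LaurentSeries F} {n : α → ℤ} {a : α → F}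
    (h : ∀ i ∈ s, HasLead (x i) (n i) (a i)) :
    HasLead (∏ i ∈ s, x i) (∑ i ∈ s, n i) (∏ i ∈ s, a i) := by
  classical
  induction s using Finset.induction_on with
  | empty => simpa using HasLead.one
  | insert i s hi ih =>
    rw [Finset.prod_insert hi, Finset.prod_insert hi, Finset.sum_insert hi]
    exact (h i (Finset.mem_insert_self _ _)).mul (ih fun j hj => h j (Finset.mem_insert_of_mem hj))

theorem HasLead.C {a : F} (ha : a ≠ 0) : HasLead (C a : LaurentSeries F) 0 a := by
  refine .of_coeff ha (by rw [C_apply, coeff_single, if_pos rfl]) fun m hm => ?_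
  rw [C_apply, coeff_single, if_neg hm.ne]

theorem HasLead.u_mul_add {e : F} (he : e ≠ 0) (b : F) :
    HasLead (HahnSeries.C e * GaugeDatum.u F + HahnSeries.C b) (-1) e := by
  refine .of_coeff he ?_ fun m hm => ?_
  · rw [coeff_add, coeff_C_mul, GaugeDatum.u, C_apply, coeff_single, coeff_single, if_pos rfl,
      if_neg (by decide)]
    simp
  · rw [coeff_add, coeff_C_mul, GaugeDatum.u, C_apply, coeff_single, coeff_single,
      if_neg (by omega), if_neg (by omega)]
    simp

end Laurent

namespace GaugeDatum

variable {Q₀ Q₁ : Type*} [Fintype Q₀] [DecidableEq Q₀] [Fintype Q₁] [DecidableEq Q₁]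
  (G : GaugeDatum Q₀ Q₁)

/-! ### Counting arrows -/

/-- The number of arrows from `i` to `j`. -/
def arrowCount (i j : Q₀) : ℕ := ((G.arrowsFrom i).filter fun h => G.t h = j).card

theorem eq_τ_iff {i j : Q₀} : i = G.τ j ↔ G.τ i = j :=
  ⟨fun h => by rw [h, G.τ_invol], fun h => by rw [← h, G.τ_invol]⟩

theorem arrowCount_eq_sum (i j : Q₀) :
    (G.arrowCount i j : ℤ) = ∑ h, if G.s h = i ∧ G.t h = j then 1 else 0 := by
  rw [arrowCount, arrowsFrom, Finset.filter_filter, Finset.card_filter]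
  push_cast
  rfl

theorem c_eq_arrowCount {i j : Q₀} (h : i ≠ j) :
    G.c i j = -((G.arrowCount i j : ℤ) + G.arrowCount j i) := by
  rw [c_eq, if_neg h, arrowCount_eq_sum, arrowCount_eq_sum, ← Finset.sum_add_distrib, zero_sub]
  congr 1
  refine Finset.sum_congr rfl fun e _ => ?_
  rw [add_comm]
  simp only [and_comm]

theorem arrowCount_add_le {i j : Q₀} (h : i ≠ j) : G.arrowCount i j + G.arrowCount j i ≤ 1 := by
  have h1 := G.c_eq_arrowCount h
  have h2 : G.c i j = 0 ∨ G.c i j = -1 := G.cartan.c_off i j h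
  omega

theorem arrowCount_self (i : Q₀) : G.arrowCount i i = 0 := by
  rw [arrowCount, Finset.card_eq_zero, Finset.filter_eq_empty_iff]
  intro h hh he
  simp only [arrowsFrom, Finset.mem_filter, Finset.mem_univ, true_and] at hh
  exact G.no_loop h (hh.trans he.symm)

theorem arrowCount_τ (i j : Q₀) : G.arrowCount (G.τ j) (G.τ i) = G.arrowCount i j := by
  refine Finset.card_bij' (fun h _ => G.τ₁ h) (fun h _ => G.τ₁ h) ?_ ?_
    (fun h _ => G.τ₁_invol h) (fun h _ => G.τ₁_invol h)
  · intro h hh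
    simp only [arrowsFrom, Finset.mem_filter, Finset.mem_univ, true_and] at hh ⊢
    rw [G.s_τ₁, G.t_τ₁, hh.1, hh.2, G.τ_invol, G.τ_invol]
    exact ⟨rfl, rfl⟩
  · intro h hh
    simp only [arrowsFrom, Finset.mem_filter, Finset.mem_univ, true_and] at hh ⊢
    rw [G.s_τ₁, G.t_τ₁, hh.1, hh.2]
    exact ⟨rfl, rfl⟩

theorem arrowsFrom_inter_fixed (i : Q₀) :
    (G.arrowsFrom i ∩ G.fixedArrows).card = G.arrowCount i (G.τ i) := by
  rw [arrowCount]
  congr 1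
  ext h
  simp only [arrowsFrom, fixedArrows, Finset.mem_inter, Finset.mem_filter, Finset.mem_univ,
    true_and, ← G.τ_s_iff]
  constructor
  · rintro ⟨rfl, h2⟩
    exact ⟨rfl, h2.symm⟩
  · rintro ⟨rfl, h2⟩
    exact ⟨rfl, h2.symm⟩

theorem δ_eq_arrowCount (i : Q₀) : G.δ i = G.arrowCount i (G.τ i) := by
  have h := G.sum_fixed_s i
  rw [← arrowsFrom_inter_fixed, ← Nat.cast_inj (R := ℤ), ← h, arrowsFrom, Finset.sum_ite,
    Finset.sum_const_zero, add_zero, Finset.sum_const, nsmul_one, Finset.filter_inter]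
  simp

/-! ### Translations of the coordinates -/

instance {ι : Type*} : CharZero (RatField ι) :=
  charZero_of_injective_algebraMap (algebraMap Ch (RatField ι)).injective

/-- The translation of rational functions by `ε_{i,a}`. -/
def σ (i : Q₀) (a : Fin (G.v i)) : G.K →+* G.K :=
  (shiftField (Multiplicative.ofAdd (G.ε i a)) : G.K ≃ₐ[Ch] G.K).toAlgHom.toRingHom

theorem σ_algebraMap (i : Q₀) (a : Fin (G.v i)) (z : Ch) :
    G.σ i a (algebraMap Ch G.K z) = algebraMap Ch G.K z :=
  (shiftField (Multiplicative.ofAdd (G.ε i a)) : G.K ≃ₐ[Ch] G.K).commutes z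

theorem σ_ħ (i : Q₀) (a : Fin (G.v i)) : G.σ i a G.ħ = G.ħ := G.σ_algebraMap i a hbar

theorem ħ_ne : G.ħ ≠ 0 := by
  rw [ħ, Ne, map_eq_zero]
  exact hbar_ne_zero

theorem coord_eq_iff {i j : Q₀} {hi : i ∈ G.plus} {hj : j ∈ G.plus} {a : Fin (G.v i)}
    {b : Fin (G.v j)} :
    ((⟨⟨i, hi⟩, a⟩ : G.Coord) = ⟨⟨j, hj⟩, b⟩) ↔ i = j ∧ (a : ℕ) = b := by
  constructor
  · intro h
    obtain ⟨h1, h2⟩ := Sigma.mk.inj_iff.1 h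
    obtain rfl : i = j := congrArg Subtype.val h1
    exact ⟨rfl, congrArg Fin.val (eq_of_heq h2)⟩
  · rintro ⟨rfl, h⟩
    rw [Fin.ext h]

theorem σ_X (j : Q₀) (b : Fin (G.v j)) (k : G.Coord) :
    G.σ j b (algebraMap (MvPolynomial G.Coord Ch) G.K (MvPolynomial.X k)) =
      algebraMap (MvPolynomial G.Coord Ch) G.K (MvPolynomial.X k) + (G.ε j b k : ℤ) * G.ħ := by
  refine (shiftField_X (G.ε j b) k).trans ?_
  rw [map_mul, map_intCast]
  rfl

/-- The translation by `ε_{j,b}` moves `x_{j,b}` by `ħ` and `x_{τ j,b}` by `-ħ`. -/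
theorem σ_x (j : Q₀) (b : Fin (G.v j)) (i : Q₀) (a : Fin (G.v i)) :
    G.σ j b (G.x i a) = G.x i a + (if i = j ∧ (a : ℕ) = b then G.ħ else 0)
      - (if i = G.τ j ∧ (a : ℕ) = b then G.ħ else 0) := by
  have hτ : ∀ {i j}, G.τ i = G.τ j ↔ i = j := G.τ_inj.eq_iff
  by_cases hi : i ∈ G.plus <;> by_cases hj : j ∈ G.plus
  · have h1 : i ≠ G.τ j := fun h => (G.mem_plus_iff j).1 hj (h ▸ hi)
    rw [x, dif_pos hi, σ_X, ε, dif_pos hj, Pi.single_apply]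
    simp only [coord_eq_iff, h1, false_and, if_false, sub_zero]
    split_ifs <;> simp
  · have h1 : i ≠ j := fun h => hj (h ▸ hi)
    rw [x, dif_pos hi, σ_X, ε, dif_neg hj, Pi.neg_apply, Pi.single_apply, negCoord]
    simp only [coord_eq_iff, h1, false_and, if_false, add_zero, Fin.val_cast]
    split_ifs <;> simp [sub_eq_add_neg]
  · have h1 : i ≠ j := fun h => hi (h ▸ hj)
    rw [x, dif_neg hi, map_neg, σ_X, ε, dif_pos hj, Pi.single_apply, negCoord]
    simp only [coord_eq_iff, h1, false_and, if_false, add_zero, Fin.val_cast, G.eq_τ_iff]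
    split_ifs <;> simp; ring
  · have h1 : i ≠ G.τ j := fun h => hi (by rw [h, G.mem_plus_iff, G.τ_invol]; exact hj)
    rw [x, dif_neg hi, map_neg, σ_X, ε, dif_neg hj, Pi.neg_apply, Pi.single_apply, negCoord,
      negCoord]
    simp only [coord_eq_iff, h1, false_and, if_false, sub_zero, Fin.val_cast, hτ]
    split_ifs <;> simp; ring

theorem x_τ {i j : Q₀} {a : Fin (G.v i)} {b : Fin (G.v j)} (h : i = G.τ j) (hab : (a : ℕ) = b) :
    G.x i a = -G.x j b := by
  subst h
  by_cases hj : j ∈ G.plus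
  · have hi : G.τ j ∉ G.plus := (G.mem_plus_iff j).1 hj
    rw [x, dif_neg hi, x, dif_pos hj]
    congr 3
    rw [negCoord, coord_eq_iff]
    exact ⟨G.τ_invol j, hab⟩
  · have hi : G.τ j ∈ G.plus := by rw [G.mem_plus_iff, G.τ_invol]; exact hj
    rw [x, dif_pos hi, x, dif_neg hj, neg_neg]
    congr 2
    rw [negCoord, coord_eq_iff]
    exact ⟨rfl, hab⟩

theorem ε_τ {i j : Q₀} {a : Fin (G.v i)} {b : Fin (G.v j)} (h : i = G.τ j) (hab : (a : ℕ) = b) :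
    G.ε i a = -G.ε j b := by
  subst h
  by_cases hj : j ∈ G.plus
  · have hi : G.τ j ∉ G.plus := (G.mem_plus_iff j).1 hj
    rw [ε, dif_neg hi, ε, dif_pos hj]
    congr 2
    rw [negCoord, coord_eq_iff]
    exact ⟨G.τ_invol j, hab⟩
  · have hi : G.τ j ∈ G.plus := by rw [G.mem_plus_iff, G.τ_invol]; exact hj
    rw [ε, dif_pos hi, ε, dif_neg hj, neg_neg]
    congr 1
    rw [negCoord, coord_eq_iff]
    exact ⟨rfl, hab⟩

theorem σ_x_self (i : Q₀) (a : Fin (G.v i)) : G.σ i a (G.x i a) = G.x i a + G.ħ := by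
  rw [σ_x, if_pos ⟨rfl, rfl⟩, if_neg fun h => G.τ_ne i h.1.symm, sub_zero]

theorem σ_x_of_ne {i j : Q₀} {a : Fin (G.v i)} {b : Fin (G.v j)} (h : ¬(i = j ∧ (a : ℕ) = b))
    (h' : ¬(i = G.τ j ∧ (a : ℕ) = b)) : G.σ j b (G.x i a) = G.x i a := by
  rw [σ_x, if_neg h, if_neg h', add_zero, sub_zero]

/-- Nonvanishing is seen by applying a translation and subtracting. -/
theorem sub_x_ne {i j : Q₀} {a : Fin (G.v i)} {b : Fin (G.v j)} (h : ¬(i = j ∧ (a : ℕ) = b))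
    (h' : ¬(i = G.τ j ∧ (a : ℕ) = b)) (κ : ℚ) : G.x i a - G.x j b + κ * G.ħ ≠ 0 := by
  intro h0
  have h1 := congrArg (G.σ j b) h0
  rw [map_add, map_sub, G.σ_x_of_ne h h', σ_x_self, map_mul, σ_ħ, map_ratCast, map_zero] at h1
  exact G.ħ_ne (by linear_combination h0 - h1)

theorem add_x_ne {i j : Q₀} {a : Fin (G.v i)} {b : Fin (G.v j)} (h : ¬(i = j ∧ (a : ℕ) = b))
    (h' : ¬(i = G.τ j ∧ (a : ℕ) = b)) (κ : ℚ) : G.x i a + G.x j b + κ * G.ħ ≠ 0 := by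
  intro h0
  have h1 := congrArg (G.σ j b) h0
  rw [map_add, map_add, G.σ_x_of_ne h h', σ_x_self, map_mul, σ_ħ, map_ratCast, map_zero] at h1
  exact G.ħ_ne (by linear_combination h1 - h0)

theorem two_x_ne (i : Q₀) (a : Fin (G.v i)) (κ : ℚ) : 2 * G.x i a + κ * G.ħ ≠ 0 := by
  intro h0
  have h1 := congrArg (G.σ i a) h0
  rw [map_add, map_mul, σ_x_self, map_mul, σ_ħ, map_ratCast, map_zero, map_ofNat] at h1
  exact G.ħ_ne (by linear_combination (h1 - h0) / 2)

end GaugeDatum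

/-! ### The rational functions in the operators `y_{i,a}` -/

/-- The change of a product when one factor is replaced, without division. -/
theorem prod_mul_eq_of_eq_off {ι R : Type*} [CommRing R] {s : Finset ι} {b : ι} (hb : b ∈ s)
    (f g : ι → R) (h : ∀ l ∈ s, l ≠ b → g l = f l) :
    (∏ l ∈ s, g l) * f b = (∏ l ∈ s, f l) * g b := by
  classical
  rw [← Finset.mul_prod_erase s f hb, ← Finset.mul_prod_erase s g hb,
    Finset.prod_congr rfl fun l hl =>
      h l (Finset.mem_of_mem_erase hl) (Finset.ne_of_mem_erase hl)]
  ring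

namespace GaugeDatum

variable {Q₀ Q₁ : Type*} [Fintype Q₀] [DecidableEq Q₀] [Fintype Q₁] [DecidableEq Q₁]
  (G : GaugeDatum Q₀ Q₁)

open Polynomial in
/-- The effect of a translation on `V_k`. -/
theorem map_σ_V (j : Q₀) (b : Fin (G.v j)) (k : Q₀) :
    (G.V k).map (G.σ j b) *
      ((if k = j then X - C (G.x j b) else 1) * (if k = G.τ j then X + C (G.x j b) else 1)) =
    G.V k * ((if k = j then X - C (G.x j b + G.ħ) else 1) *
      (if k = G.τ j then X + C (G.x j b + G.ħ) else 1)) := by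
  rw [V, Polynomial.map_prod]
  simp only [Polynomial.map_sub, map_X, map_C]
  by_cases h : k = j
  · subst h
    have h' : k ≠ G.τ k := (G.τ_ne k).symm
    rw [if_pos rfl, if_neg h', if_pos rfl, if_neg h', mul_one, mul_one]
    have := prod_mul_eq_of_eq_off (Finset.mem_univ b) (fun l => X - C (G.x k l))
      (fun l => X - C (G.σ k b (G.x k l))) fun l _ hl => by
        rw [G.σ_x_of_ne (fun e => hl (Fin.ext e.2)) (fun e => h' e.1)]
    rwa [σ_x_self] at this
  · rw [if_neg h, if_neg h, one_mul, one_mul]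
    by_cases h' : k = G.τ j
    · rw [if_pos h', if_pos h']
      have hv : G.v j = G.v k := by rw [h', G.v_τ]
      have := prod_mul_eq_of_eq_off (Finset.mem_univ (Fin.cast hv b)) (fun l => X - C (G.x k l))
        (fun l => X - C (G.σ j b (G.x k l))) fun l _ hl => by
          rw [G.σ_x_of_ne (fun e => h e.1) (fun e => hl (Fin.ext e.2))]
      rwa [G.x_τ (a := Fin.cast hv b) h' rfl, map_neg, map_neg, σ_x_self, map_neg,
        sub_neg_eq_add, sub_neg_eq_add] at this
    · rw [if_neg h', if_neg h', mul_one, mul_one]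
      refine Finset.prod_congr rfl fun l _ => ?_
      rw [G.σ_x_of_ne (fun e => h e.1) (fun e => h' e.1)]

/-- The polynomial `∏_{s(h) = i} V_{t(h)}(z)`. -/
def arrowPoly (i : Q₀) : Polynomial G.K := ∏ h ∈ G.arrowsFrom i, G.V (G.t h)

open Polynomial in
/-- The effect of a translation on the contribution of the arrows: every arrow from `i` to `j` shifts
a root `x_{j,b}`, and every arrow from `i` to `τ j` a root `-x_{j,b}`. -/
theorem map_σ_arrowPoly (j : Q₀) (b : Fin (G.v j)) (i : Q₀) :
    (G.arrowPoly i).map (G.σ j b) *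
      ((X - C (G.x j b)) ^ G.arrowCount i j * (X + C (G.x j b)) ^ G.arrowCount i (G.τ j)) =
    G.arrowPoly i * ((X - C (G.x j b + G.ħ)) ^ G.arrowCount i j *
      (X + C (G.x j b + G.ħ)) ^ G.arrowCount i (G.τ j)) := by
  have hc : ∀ (p : G.K[X]) (j : Q₀),
      ∏ h ∈ G.arrowsFrom i, (if G.t h = j then p else 1) = p ^ G.arrowCount i j := by
    intro p j
    rw [Finset.prod_ite, Finset.prod_const, Finset.prod_const_one, mul_one, arrowCount]
  rw [arrowPoly, Polynomial.map_prod]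
  simp only [← hc, ← Finset.prod_mul_distrib]
  exact Finset.prod_congr rfl fun h _ => G.map_σ_V j b (G.t h)

/-- The rational function in `y_{i,a}`. -/
def φ (i : Q₀) (a : Fin (G.v i)) : G.K :=
  (2 * G.x i a + 3 * G.ħ / 2) ^ G.arrowCount i (G.τ i)
    * (G.arrowPoly i).eval (G.x i a + G.ħ / 2) * ((G.Vr i a).eval (G.x i a))⁻¹

theorem σ_eval (j : Q₀) (b : Fin (G.v j)) (p : Polynomial G.K) (z : G.K) :
    G.σ j b (p.eval z) = (p.map (G.σ j b)).eval (G.σ j b z) := by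
  rw [Polynomial.eval_map, Polynomial.eval₂_hom]

theorem sub_x_ne' (i : Q₀) {a b : Fin (G.v i)} (h : a ≠ b) (κ : ℚ) :
    G.x i a - G.x i b + κ * G.ħ ≠ 0 :=
  G.sub_x_ne (fun e => h (Fin.ext e.2)) (fun e => G.τ_ne i e.1.symm) κ

theorem Vr_eval (i : Q₀) (a : Fin (G.v i)) (z : G.K) :
    (G.Vr i a).eval z = ∏ k ∈ Finset.univ.erase a, (z - G.x i k) := by
  simp [Vr, Polynomial.eval_prod]

theorem Vr_eval_ne (i : Q₀) (a : Fin (G.v i)) : (G.Vr i a).eval (G.x i a) ≠ 0 := by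
  rw [Vr_eval, Finset.prod_ne_zero_iff]
  intro k hk
  have := G.sub_x_ne' i (Finset.ne_of_mem_erase hk).symm 0
  rwa [Rat.cast_zero, zero_mul, add_zero] at this

/-- The effect of a translation on the denominator of `y_{i,a}`. -/
theorem σ_Vr {i j : Q₀} {a : Fin (G.v i)} {b : Fin (G.v j)} (h : ¬(i = j ∧ (a : ℕ) = b))
    (h' : ¬(i = G.τ j ∧ (a : ℕ) = b)) :
    G.σ j b ((G.Vr i a).eval (G.x i a)) * ((if i = j then G.x i a - G.x j b else 1)
      * (if i = G.τ j then G.x i a + G.x j b else 1)) =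
    (G.Vr i a).eval (G.x i a) * ((if i = j then G.x i a - G.x j b - G.ħ else 1)
      * (if i = G.τ j then G.x i a + G.x j b + G.ħ else 1)) := by
  rw [Vr_eval, map_prod]
  simp only [map_sub, G.σ_x_of_ne h h']
  by_cases e : i = j
  · subst e
    have e' : i ≠ G.τ i := (G.τ_ne i).symm
    rw [if_pos rfl, if_neg e', if_pos rfl, if_neg e', mul_one, mul_one]
    have := prod_mul_eq_of_eq_off (s := Finset.univ.erase a) (b := b)
      (Finset.mem_erase.2 ⟨fun e => h ⟨rfl, by rw [e]⟩, Finset.mem_univ b⟩)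
      (fun l => G.x i a - G.x i l) (fun l => G.x i a - G.σ i b (G.x i l)) fun l _ hl => by
        rw [G.σ_x_of_ne (fun e => hl (Fin.ext e.2)) (fun e => e' e.1)]
    rwa [σ_x_self, ← sub_sub] at this
  · rw [if_neg e, if_neg e, one_mul, one_mul]
    by_cases e' : i = G.τ j
    · rw [if_pos e', if_pos e']
      have hv : G.v j = G.v i := by rw [e', G.v_τ]
      have := prod_mul_eq_of_eq_off (s := Finset.univ.erase a) (b := Fin.cast hv b)
        (Finset.mem_erase.2 ⟨fun ee => h' ⟨e', by rw [← ee]; rfl⟩, Finset.mem_univ _⟩)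
        (fun l => G.x i a - G.x i l)
        (fun l => G.x i a - G.σ j b (G.x i l)) fun l _ hl => by
          rw [G.σ_x_of_ne (fun ee => e ee.1) (fun ee => hl (Fin.ext ee.2))]
      rwa [G.x_τ (a := Fin.cast hv b) e' rfl, map_neg, σ_x_self, sub_neg_eq_add, sub_neg_eq_add,
        ← add_assoc] at this
    · rw [if_neg e', if_neg e', mul_one, mul_one]
      refine Finset.prod_congr rfl fun l _ => ?_
      rw [G.σ_x_of_ne (fun ee => e ee.1) (fun ee => e' ee.1)]

/-- The effect of the translation by `ε_{j,b}` on the rational function in `y_{i,a}`. -/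
theorem σ_φ {i j : Q₀} {a : Fin (G.v i)} {b : Fin (G.v j)} (h : ¬(i = j ∧ (a : ℕ) = b))
    (h' : ¬(i = G.τ j ∧ (a : ℕ) = b)) :
    G.σ j b (G.φ i a) * ((G.x i a - G.x j b + G.ħ / 2) ^ G.arrowCount i j *
      (G.x i a + G.x j b + G.ħ / 2) ^ G.arrowCount i (G.τ j)) *
      ((if i = j then G.x i a - G.x j b - G.ħ else 1)
        * (if i = G.τ j then G.x i a + G.x j b + G.ħ else 1)) =
    G.φ i a * ((G.x i a - G.x j b - G.ħ / 2) ^ G.arrowCount i j *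
      (G.x i a + G.x j b + 3 / 2 * G.ħ) ^ G.arrowCount i (G.τ j)) *
      ((if i = j then G.x i a - G.x j b else 1)
        * (if i = G.τ j then G.x i a + G.x j b else 1)) := by
  have hx := G.σ_x_of_ne h h'
  have hz : G.σ j b (G.x i a + G.ħ / 2) = G.x i a + G.ħ / 2 := by
    rw [map_add, hx, map_div₀, σ_ħ, map_ofNat]
  have h1 := congrArg (Polynomial.eval (G.x i a + G.ħ / 2)) (G.map_σ_arrowPoly j b i)
  simp only [Polynomial.eval_mul, Polynomial.eval_pow, Polynomial.eval_sub, Polynomial.eval_add,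
    Polynomial.eval_X, Polynomial.eval_C] at h1
  have h2 := G.σ_Vr h h'
  have hV := G.Vr_eval_ne i a
  have hV' : G.σ j b ((G.Vr i a).eval (G.x i a)) ≠ 0 := by rwa [Ne, map_eq_zero]
  have hφ : G.σ j b (G.φ i a) = (2 * G.x i a + 3 * G.ħ / 2) ^ G.arrowCount i (G.τ i)
      * ((G.arrowPoly i).map (G.σ j b)).eval (G.x i a + G.ħ / 2)
      * (G.σ j b ((G.Vr i a).eval (G.x i a)))⁻¹ := by
    rw [φ, map_mul, map_mul, map_pow, map_inv₀, G.σ_eval j b (G.arrowPoly i), hz, map_add, map_mul,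
      map_div₀, map_mul, hx, σ_ħ, map_ofNat, map_ofNat]
  rw [hφ, φ]
  rw [show G.x i a + G.ħ / 2 - G.x j b = G.x i a - G.x j b + G.ħ / 2 by ring,
    show G.x i a + G.ħ / 2 + G.x j b = G.x i a + G.x j b + G.ħ / 2 by ring,
    show G.x i a + G.ħ / 2 - (G.x j b + G.ħ) = G.x i a - G.x j b - G.ħ / 2 by ring,
    show G.x i a + G.ħ / 2 + (G.x j b + G.ħ) = G.x i a + G.x j b + 3 / 2 * G.ħ by ring] at h1
  generalize ((G.arrowPoly i).map (G.σ j b)).eval (G.x i a + G.ħ / 2) = e1 at *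
  generalize (G.arrowPoly i).eval (G.x i a + G.ħ / 2) = e2 at *
  generalize G.σ j b ((G.Vr i a).eval (G.x i a)) = v1 at *
  generalize (G.Vr i a).eval (G.x i a) = v2 at *
  generalize (G.x i a - G.x j b + G.ħ / 2) ^ G.arrowCount i j *
      (G.x i a + G.x j b + G.ħ / 2) ^ G.arrowCount i (G.τ j) = n1 at *
  generalize (G.x i a - G.x j b - G.ħ / 2) ^ G.arrowCount i j *
      (G.x i a + G.x j b + 3 / 2 * G.ħ) ^ G.arrowCount i (G.τ j) = n2 at *
  generalize ((if i = j then G.x i a - G.x j b - G.ħ else 1)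
        * (if i = G.τ j then G.x i a + G.x j b + G.ħ else 1)) = m1 at *
  generalize ((if i = j then G.x i a - G.x j b else 1)
        * (if i = G.τ j then G.x i a + G.x j b else 1)) = m2 at *
  generalize (2 * G.x i a + 3 * G.ħ / 2) ^ G.arrowCount i (G.τ i) = f at *
  have hm : v1⁻¹ * m1 = v2⁻¹ * m2 := by
    field_simp
    linear_combination -h2
  linear_combination f * (v1⁻¹ * m1) * h1 + f * e2 * n2 * hm

/-- The exchange relation of the rational functions in two operators on different coordinates. The
factors coming from mirror images are symmetric in the two operators and cancel. -/
theorem exchange_φ {i j : Q₀} {a : Fin (G.v i)} {b : Fin (G.v j)} (h : ¬(i = j ∧ (a : ℕ) = b))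
    (h' : ¬(i = G.τ j ∧ (a : ℕ) = b)) :
    (G.x j b - G.x i a - (G.c i j : G.K) / 2 * G.ħ) * (G.φ i a * G.σ i a (G.φ j b)) =
      (G.x j b - G.x i a + (G.c i j : G.K) / 2 * G.ħ) * (G.φ j b * G.σ j b (G.φ i a)) := by
  have hs : ¬(j = i ∧ (b : ℕ) = a) := fun e => h ⟨e.1.symm, e.2.symm⟩
  have hs' : ¬(j = G.τ i ∧ (b : ℕ) = a) := fun e =>
    h' ⟨by rw [e.1, G.τ_invol], e.2.symm⟩
  have h1 := G.σ_φ h h'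
  have h2 := G.σ_φ hs hs'
  have hm : G.arrowCount j (G.τ i) = G.arrowCount i (G.τ j) := by
    rw [← G.arrowCount_τ, G.τ_invol]
  have hτ : (j = G.τ i) = (i = G.τ j) := by
    rw [G.eq_τ_iff, eq_comm (a := i)]
  have n1 := G.sub_x_ne h h' (1 / 2)
  have n2 := G.sub_x_ne h h' (-1 / 2)
  have n3 := G.add_x_ne h h' (1 / 2)
  have n4 := G.add_x_ne h h' 1
  have n5 := G.sub_x_ne h h' 1
  have n6 := G.sub_x_ne h h' (-1)
  push_cast at n1 n2 n3 n4 n5 n6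
  rw [hm, add_comm (G.x j b) (G.x i a)] at h2
  simp only [hτ] at h2
  have hD : (G.x i a + G.x j b + G.ħ / 2) ^ G.arrowCount i (G.τ j) *
      (if i = G.τ j then G.x i a + G.x j b + G.ħ else 1) ≠ 0 := by
    refine mul_ne_zero (pow_ne_zero _ ?_) ?_
    · rwa [show G.ħ / 2 = 1 / 2 * G.ħ by ring]
    · split_ifs
      · rwa [one_mul] at n4
      · exact one_ne_zero
  set D := (G.x i a + G.x j b + G.ħ / 2) ^ G.arrowCount i (G.τ j) *
      (if i = G.τ j then G.x i a + G.x j b + G.ħ else 1) with hDdef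
  set N := (G.x i a + G.x j b + 3 / 2 * G.ħ) ^ G.arrowCount i (G.τ j) *
      (if i = G.τ j then G.x i a + G.x j b else 1) with hNdef
  generalize G.σ j b (G.φ i a) = ψ1 at *
  generalize G.σ i a (G.φ j b) = ψ2 at *
  -- For `i = j` the factors come from the denominators, otherwise from at most one arrow.
  by_cases e : i = j
  · have hc : G.c i j = 2 := by rw [e]; exact G.cartan.c_diag j
    have hn : G.arrowCount i j = 0 := by rw [e]; exact G.arrowCount_self j
    have hn' : G.arrowCount j i = 0 := by rw [e]; exact G.arrowCount_self j
    rw [if_pos e, if_pos e, hn] at h1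
    rw [if_pos e.symm, if_pos e.symm, hn'] at h2
    rw [hc]
    push_cast
    refine mul_right_cancel₀ (mul_ne_zero hD (mul_ne_zero n5 n6)) ?_
    rw [hDdef]
    rw [hDdef, hNdef] at *
    linear_combination (-(G.x j b - G.x i a - G.ħ) * G.φ i a * (G.x i a - G.x j b - G.ħ)) * h2
      - (G.x j b - G.x i a + G.ħ) * G.φ j b * (G.x i a - G.x j b + G.ħ) * h1
  · have hc := G.c_eq_arrowCount e
    have hle := G.arrowCount_add_le e
    rw [if_neg e, if_neg e] at h1
    rw [if_neg (Ne.symm e), if_neg (Ne.symm e)] at h2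
    refine mul_right_cancel₀ (mul_ne_zero hD (mul_ne_zero n1 n2)) ?_
    rw [hDdef]
    obtain ⟨h3, h4⟩ | ⟨h3, h4⟩ | ⟨h3, h4⟩ : (G.arrowCount i j = 0 ∧ G.arrowCount j i = 0) ∨
        (G.arrowCount i j = 1 ∧ G.arrowCount j i = 0) ∨
        (G.arrowCount i j = 0 ∧ G.arrowCount j i = 1) := by omega
    · rw [h3] at h1
      rw [h4] at h2
      rw [hc, h3, h4]
      push_cast
      linear_combination (G.x j b - G.x i a) * (G.x i a - G.x j b + 1 / 2 * G.ħ) *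
        (G.x i a - G.x j b + -1 / 2 * G.ħ) * (G.φ i a * h2 - G.φ j b * h1)
    · rw [h3] at h1
      rw [h4] at h2
      rw [hc, h3, h4]
      push_cast
      linear_combination (G.x i a - G.x j b + -1 / 2 * G.ħ) *
        (-(G.x i a - G.x j b + -1 / 2 * G.ħ) * (G.x i a - G.x j b + 1 / 2 * G.ħ) * G.φ i a * h2
        + (G.x i a - G.x j b + 1 / 2 * G.ħ) * G.φ j b * h1)
    · rw [h3] at h1
      rw [h4] at h2
      rw [hc, h3, h4]
      push_cast
      linear_combination (G.x i a - G.x j b + 1 / 2 * G.ħ) * (G.x i a - G.x j b + -1 / 2 * G.ħ) *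
        (G.φ i a * h2 + (G.x i a - G.x j b + 1 / 2 * G.ħ) * G.φ j b * h1)

/-! ### The operators `y_{i,a}` form an exchange system -/

/-- Left multiplication by rational functions. -/
instance : Module G.K G.DiffW := Module.compHom G.DiffW G.ofK

theorem smul_def (α : G.K) (z : G.DiffW) : α • z = G.ofK α * z := rfl

instance : IsScalarTower G.K G.DiffW G.DiffW := ⟨fun α z w => mul_assoc (G.ofK α) z w⟩

theorem ofK_algebraMap (c : Ch) : G.ofK (algebraMap Ch G.K c) = algebraMap Ch G.DiffW c := by
  rfl

theorem ofHW_comm (f : G.HW) (z : G.DiffW) : Commute (G.ofHW f) z := by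
  change ((1 : G.Diff) ⊗ₜ[ℚ] f) * z = z * ((1 : G.Diff) ⊗ₜ[ℚ] f)
  induction z using TensorProduct.induction_on with
  | zero => simp
  | tmul a g => simp [Algebra.TensorProduct.tmul_mul_tmul, mul_comm]
  | add z w hz hw => rw [mul_add, add_mul, hz, hw]

theorem ofK_comm (α β : G.K) : Commute (G.ofK α) (G.ofK β) := by
  rw [Commute, SemiconjBy, ← map_mul, ← map_mul, mul_comm]

/-- The value of a polynomial over `H_{G_W}^*(pt)` at a rational function. -/
def opEval (p : Polynomial G.HW) (α : G.K) : G.DiffW := p.eval₂ G.ofHW (G.ofK α)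

theorem opEval_mul (p p' : Polynomial G.HW) (α : G.K) :
    G.opEval (p * p') α = G.opEval p α * G.opEval p' α :=
  Polynomial.eval₂_mul_noncomm _ _ fun k => G.ofHW_comm _ _

theorem commute_opEval (p : Polynomial G.HW) (α : G.K) (z : G.DiffW) (h : Commute (G.ofK α) z) :
    Commute (G.opEval p α) z := by
  rw [opEval, Polynomial.eval₂_eq_sum, Polynomial.sum]
  exact Commute.sum_left _ _ _ fun k _ => (G.ofHW_comm _ _).mul_left (h.pow_left k)

/-- The invertible difference operator `d_{i,a}`. -/
def dW (i : Q₀) (a : Fin (G.v i)) : G.DiffW := G.d i a ⊗ₜ[ℚ] 1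

theorem dW_mul_ofK (i : Q₀) (a : Fin (G.v i)) (α : G.K) :
    G.dW i a * G.ofK α = G.ofK (G.σ i a α) * G.dW i a := by
  change (G.d i a ⊗ₜ[ℚ] (1 : G.HW)) * (DiffAlg.ofRat G.Coord α ⊗ₜ[ℚ] 1) =
    (DiffAlg.ofRat G.Coord (G.σ i a α) ⊗ₜ[ℚ] 1) * (G.d i a ⊗ₜ[ℚ] (1 : G.HW))
  rw [Algebra.TensorProduct.tmul_mul_tmul, Algebra.TensorProduct.tmul_mul_tmul, ofRat_eq_single,
    ofRat_eq_single, d, diff_mul, diff_mul, zero_add, add_zero, one_mul]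
  congr 2
  rw [map_one, mul_one]
  rfl

theorem dW_mul_dW (i j : Q₀) (a : Fin (G.v i)) (b : Fin (G.v j)) :
    G.dW i a * G.dW j b = DiffAlg.single (G.ε i a + G.ε j b) 1 ⊗ₜ[ℚ] 1 := by
  rw [dW, dW, Algebra.TensorProduct.tmul_mul_tmul, d, d, diff_mul, map_one, one_mul, one_mul]

theorem dW_comm (i j : Q₀) (a : Fin (G.v i)) (b : Fin (G.v j)) :
    G.dW i a * G.dW j b = G.dW j b * G.dW i a := by
  rw [dW_mul_dW, dW_mul_dW, add_comm]

/-- The translations act on the argument of `W`, and fix its coefficients. -/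
theorem dW_mul_opEval (i : Q₀) (a : Fin (G.v i)) (p : Polynomial G.HW) (α : G.K) :
    G.dW i a * G.opEval p α = G.opEval p (G.σ i a α) * G.dW i a := by
  rw [opEval, opEval, Polynomial.eval₂_eq_sum, Polynomial.eval₂_eq_sum, Polynomial.sum,
    Polynomial.sum, Finset.mul_sum, Finset.sum_mul]
  refine Finset.sum_congr rfl fun k _ => ?_
  rw [← map_pow, ← map_pow, ← mul_assoc, ← (G.ofHW_comm _ _).eq, mul_assoc, dW_mul_ofK, map_pow,
    mul_assoc]

/-- The spectral parameter of `y_{i,a}`. -/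
def q (i : Q₀) (a : Fin (G.v i)) : G.K := -G.x i a - G.ħ / 2

theorem y_eq (i : Q₀) (a : Fin (G.v i)) :
    G.y i a = G.φ i a • (G.opEval (G.W (G.τ i)) (G.q i a) * G.dW i a) := by
  have hE : ∏ h ∈ G.arrowsFrom i, (G.V (G.t h)).eval (G.x i a + G.ħ / 2) =
      (G.arrowPoly i).eval (G.x i a + G.ħ / 2) := by
    rw [arrowPoly, Polynomial.eval_prod]
  have hc := G.commute_opEval (G.W (G.τ i)) (G.q i a) (G.ofK ((G.Vr i a).eval (G.x i a))⁻¹)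
    (G.ofK_comm _ _)
  rw [y, hE, Finset.prod_const, arrowsFrom_inter_fixed, smul_def, φ, map_mul]
  change _ * G.opEval (G.W (G.τ i)) (G.q i a) * _ * G.dW i a = _
  simp only [mul_assoc]
  rw [← mul_assoc (G.opEval _ _), hc.eq, mul_assoc, map_mul, map_mul]
  simp only [mul_assoc]

theorem y_mul_smul (i : Q₀) (a : Fin (G.v i)) (α : G.K) (z : G.DiffW) :
    G.y i a * α • z = G.σ i a α • (G.y i a * z) := by
  have hc := G.commute_opEval (G.W (G.τ i)) (G.q i a) (G.ofK (G.σ i a α)) (G.ofK_comm _ _)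
  have hc' := G.ofK_comm (G.σ i a α) (G.φ i a)
  rw [y_eq, smul_def, smul_def, smul_def]
  simp only [mul_assoc]
  rw [← mul_assoc (G.dW i a), dW_mul_ofK, mul_assoc, ← mul_assoc (G.opEval _ _), hc.eq,
    ← mul_assoc (G.ofK (G.σ i a α)), hc'.eq]
  simp only [mul_assoc]

theorem y_mul_y (i j : Q₀) (a : Fin (G.v i)) (b : Fin (G.v j)) :
    G.y i a * G.y j b = (G.φ i a * G.σ i a (G.φ j b)) •
      (G.opEval (G.W (G.τ i)) (G.q i a) * G.opEval (G.W (G.τ j)) (G.σ i a (G.q j b)) *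
        (G.dW i a * G.dW j b)) := by
  rw [G.y_eq j b, y_mul_smul, y_eq, smul_mul_assoc, smul_smul, mul_comm (G.φ i a)]
  congr 1
  simp only [mul_assoc]
  rw [← mul_assoc (G.dW i a), dW_mul_opEval]
  simp only [mul_assoc]

/-- The exchange relation of operators on different coordinates. -/
theorem exchange_y {i j : Q₀} {a : Fin (G.v i)} {b : Fin (G.v j)} (h : ¬(i = j ∧ (a : ℕ) = b))
    (h' : ¬(i = G.τ j ∧ (a : ℕ) = b)) :
    (G.q i a - G.q j b - (G.c i j : G.K) / 2 * G.ħ) • (G.y i a * G.y j b) =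
      (G.q i a - G.q j b + (G.c i j : G.K) / 2 * G.ħ) • (G.y j b * G.y i a) := by
  have hs : ¬(j = i ∧ (b : ℕ) = a) := fun e => h ⟨e.1.symm, e.2.symm⟩
  have hs' : ¬(j = G.τ i ∧ (b : ℕ) = a) := fun e => h' ⟨by rw [e.1, G.τ_invol], e.2.symm⟩
  have h1 : G.σ i a (G.q j b) = G.q j b := by
    rw [q, map_sub, map_neg, G.σ_x_of_ne hs hs', map_div₀, σ_ħ, map_ofNat]
  have h2 : G.σ j b (G.q i a) = G.q i a := by
    rw [q, map_sub, map_neg, G.σ_x_of_ne h h', map_div₀, σ_ħ, map_ofNat]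
  have hc := G.commute_opEval (G.W (G.τ j)) (G.q j b) (G.opEval (G.W (G.τ i)) (G.q i a))
    (G.commute_opEval _ _ _ (G.ofK_comm _ _)).symm
  rw [y_mul_y, y_mul_y, h1, h2, hc.eq, G.dW_comm j i, smul_smul, smul_smul,
    show G.q i a - G.q j b = G.x j b - G.x i a by rw [q, q]; ring, G.exchange_φ h h']

/-- The index set of the operators `y_{i,a}`, `i ∈ Q₀`. -/
abbrev Idx : Type _ := Σ i : Q₀, Fin (G.v i)

/-- The mirror image of an index. -/
def τIdx (p : G.Idx) : G.Idx := ⟨G.τ p.1, Fin.cast (G.v_τ p.1).symm p.2⟩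

theorem idx_eq_iff {p p' : G.Idx} : p = p' ↔ p.1 = p'.1 ∧ (p.2 : ℕ) = p'.2 := by
  obtain ⟨i, a⟩ := p
  obtain ⟨j, b⟩ := p'
  constructor
  · rintro h
    obtain ⟨h1, h2⟩ := Sigma.mk.inj_iff.1 h
    obtain rfl : i = j := h1
    exact ⟨rfl, congrArg Fin.val (eq_of_heq h2)⟩
  · rintro ⟨h1, h2⟩
    obtain rfl : i = j := h1
    exact congrArg _ (Fin.ext h2)

theorem eq_τIdx_iff {p p' : G.Idx} : p = G.τIdx p' ↔ p.1 = G.τ p'.1 ∧ (p.2 : ℕ) = p'.2 :=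
  G.idx_eq_iff

theorem exchangeSystem : ExchangeSystem G.τIdx (fun p p' => (G.c p.1 p'.1 : G.K)) G.ħ
    (fun p => G.σ p.1 p.2) (fun p => G.q p.1 p.2) (fun p => G.y p.1 p.2) where
  twist p α z := G.y_mul_smul p.1 p.2 α z
  ħ_ne := G.ħ_ne
  σ_ħ p := G.σ_ħ p.1 p.2
  σ_self p := by
    rw [q, map_sub, map_neg, σ_x_self, map_div₀, σ_ħ, map_ofNat]
    ring
  σ_ne p p' h h' := by
    rw [Ne, idx_eq_iff] at h
    rw [Ne, eq_τIdx_iff] at h'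
    rw [q, map_sub, map_neg, G.σ_x_of_ne h h', map_div₀, σ_ħ, map_ofNat]
  q_τ p := by
    rw [q, q, G.x_τ (i := (G.τIdx p).1) (a := (G.τIdx p).2) (b := p.2) rfl rfl]
    ring
  τ_invol p := G.idx_eq_iff.2 ⟨G.τ_invol p.1, rfl⟩
  exch p p' h h' := by
    rw [Ne, idx_eq_iff] at h
    rw [Ne, eq_τIdx_iff] at h'
    exact G.exchange_y (fun e => h ⟨e.1.symm, e.2.symm⟩)
      (fun e => h' ⟨by rw [e.1, G.τ_invol], e.2.symm⟩)

/-- The product of mirror operators is a function. -/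
theorem y_mul_y_τ (i j : Q₀) (hj : j = G.τ i) (a : Fin (G.v i)) (b : Fin (G.v j))
    (hb : (b : ℕ) = a) :
    G.y i a * G.y j b = (G.φ i a * G.σ i a (G.φ j b)) •
      (G.opEval (G.W j) (G.q i a) * G.opEval (G.W i) (-G.q i a)) := by
  have h1 : G.σ i a (G.q j b) = -G.q i a := by
    rw [q, G.x_τ hj hb, map_sub, map_neg, map_neg, σ_x_self, map_div₀, σ_ħ, map_ofNat, q]
    ring
  have h2 : G.dW i a * G.dW j b = 1 := by
    rw [dW_mul_dW, G.ε_τ hj hb, add_neg_cancel]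
    rfl
  have h3 : G.τ j = i := by rw [hj, G.τ_invol]
  rw [y_mul_y, h1, h2, mul_one, h3, ← hj]

/-! ### The scalar factor of the Cartan series -/

open HahnSeries in
/-- The factor of `H_i(u)` that depends only on `u`. -/
def preHV (i : Q₀) : LaurentSeries G.K :=
  (-1) ^ ((G.v i : ℤ) - 1)
    * (2 * u G.K / ((2 * u G.K - C (G.ħ / 2)) * (2 * u G.K + C (G.ħ / 2)))) ^ G.c i (G.τ i)
    * (-1) ^ G.δ i

open HahnSeries in
/-- The denominator `V_i(-u + ħ/2) V_i(-u - ħ/2)` of `H_i(u)`. -/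
def denHV (i : Q₀) : LaurentSeries G.K :=
  (G.V i).eval₂ C (-u G.K + C (G.ħ / 2)) * (G.V i).eval₂ C (-u G.K - C (G.ħ / 2))

open HahnSeries in
/-- The contribution of the arrows to the numerator of `H_i(u)`. -/
def numHV (i : Q₀) : LaurentSeries G.K :=
  (G.arrowPoly i).eval₂ C (-u G.K) * (G.arrowPoly (G.τ i)).eval₂ C (u G.K)

theorem HV_eq (i : Q₀) : G.HV i = G.preHV i * (G.denHV i)⁻¹ * G.numHV i := by
  rw [HV, preHV, denHV, numHV, arrowPoly, arrowPoly, Polynomial.eval₂_finsetProd,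
    Polynomial.eval₂_finsetProd, mul_assoc (_ * _⁻¹)]

theorem mapHom_eval₂ (f : G.K →+* G.K) (p : Polynomial G.K) (z : LaurentSeries G.K)
    (hz : mapHom f z = z) :
    mapHom f (p.eval₂ HahnSeries.C z) = (p.map f).eval₂ HahnSeries.C z := by
  rw [Polynomial.hom_eval₂, hz, Polynomial.eval₂_map]
  congr 1
  ext1 a
  exact mapHom_C f a

theorem mapHom_ħ (j : Q₀) (b : Fin (G.v j)) :
    mapHom (G.σ j b) (HahnSeries.C (G.ħ / 2)) = HahnSeries.C (G.ħ / 2) := by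
  rw [mapHom_C, map_div₀, σ_ħ, map_ofNat]

theorem mapHom_preHV (i j : Q₀) (b : Fin (G.v j)) :
    mapHom (G.σ j b) (G.preHV i) = G.preHV i := by
  have h := G.mapHom_ħ j b
  simp only [preHV]
  generalize (HahnSeries.C (G.ħ / 2) : LaurentSeries G.K) = z at *
  simp only [map_mul, map_zpow₀, map_div₀, map_sub, map_add, mapHom_u, h, map_pow,
    map_neg, map_one, map_ofNat]

theorem u_add_C_ne {F : Type*} [Field F] (a : F) : u F + HahnSeries.C a ≠ 0 := by
  have := u_sub_C_ne (-a)
  rwa [map_neg, sub_neg_eq_add] at this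

theorem denHV_ne (i : Q₀) : G.denHV i ≠ 0 := by
  have h : ∀ s : G.K, (G.V i).eval₂ HahnSeries.C (-u G.K + HahnSeries.C s) ≠ 0 := by
    intro s
    rw [V, Polynomial.eval₂_finsetProd, Finset.prod_ne_zero_iff]
    intro k _
    rw [Polynomial.eval₂_sub, Polynomial.eval₂_X, Polynomial.eval₂_C]
    have := neg_ne_zero.2 (u_sub_C_ne (s - G.x i k))
    rw [map_sub] at this
    convert this using 1
    ring
  rw [denHV, sub_eq_add_neg, ← map_neg]
  exact mul_ne_zero (h _) (h _)

open HahnSeries in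
/-- The effect of a translation on the numerator of the Cartan series. -/
theorem mapHom_numHV (i j : Q₀) (b : Fin (G.v j)) :
    mapHom (G.σ j b) (G.numHV i) *
      ((u G.K + C (G.x j b)) ^ (G.arrowCount i j + G.arrowCount j i) *
        (u G.K - C (G.x j b)) ^ (G.arrowCount i (G.τ j) + G.arrowCount (G.τ j) i)) =
    G.numHV i * ((u G.K + C (G.x j b) + C G.ħ) ^ (G.arrowCount i j + G.arrowCount j i) *
        (u G.K - C (G.x j b) - C G.ħ) ^ (G.arrowCount i (G.τ j) + G.arrowCount (G.τ j) i)) := by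
  have h1 := congrArg (Polynomial.eval₂ C (-u G.K)) (G.map_σ_arrowPoly j b i)
  have h2 := congrArg (Polynomial.eval₂ C (u G.K)) (G.map_σ_arrowPoly j b (G.τ i))
  have n1 : G.arrowCount (G.τ i) j = G.arrowCount (G.τ j) i := by
    rw [← G.arrowCount_τ, G.τ_invol]
  rw [n1, G.arrowCount_τ] at h2
  simp only [Polynomial.eval₂_mul, Polynomial.eval₂_pow, Polynomial.eval₂_sub,
    Polynomial.eval₂_add, Polynomial.eval₂_X, Polynomial.eval₂_C, map_add] at h1 h2
  rw [numHV, map_mul, G.mapHom_eval₂ _ _ _ (by rw [map_neg, mapHom_u]),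
    G.mapHom_eval₂ _ _ _ (mapHom_u _)]
  have s : ∀ (a : LaurentSeries G.K) (n : ℕ), a ^ n = (-1) ^ n * (-a) ^ n := fun a n => by
    rw [← mul_pow, neg_one_mul, neg_neg]
  rw [s (-u G.K - C (G.x j b)), s (-u G.K + C (G.x j b)), s (-u G.K - _), s (-u G.K + (_ + _)),
    show -(-u G.K - C (G.x j b)) = u G.K + C (G.x j b) by ring,
    show -(-u G.K + C (G.x j b)) = u G.K - C (G.x j b) by ring,
    show -(-u G.K - (C (G.x j b) + C G.ħ)) = u G.K + C (G.x j b) + C G.ħ by ring,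
    show -(-u G.K + (C (G.x j b) + C G.ħ)) = u G.K - C (G.x j b) - C G.ħ by ring] at h1
  rw [show u G.K - (C (G.x j b) + C G.ħ) = u G.K - C (G.x j b) - C G.ħ by ring,
    ← add_assoc] at h2
  have hs : ∀ n : ℕ, ((-1 : LaurentSeries G.K) ^ n) * (-1) ^ n = 1 := fun n => by
    rw [← mul_pow]; simp
  have h1' := congrArg (fun z => z * ((-1) ^ G.arrowCount i j * (-1) ^ G.arrowCount i (G.τ j))) h1
  have e1 := hs (G.arrowCount i j)
  have e2 := hs (G.arrowCount i (G.τ j))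
  simp only [_root_.pow_add]
  generalize ((G.arrowPoly i).map (G.σ j b)).eval₂ C (-u G.K) = a1 at *
  generalize ((G.arrowPoly (G.τ i)).map (G.σ j b)).eval₂ C (u G.K) = a2 at *
  generalize (G.arrowPoly i).eval₂ C (-u G.K) = a3 at *
  generalize (G.arrowPoly (G.τ i)).eval₂ C (u G.K) = a4 at *
  generalize (-1 : LaurentSeries G.K) ^ G.arrowCount i j = t1 at *
  generalize (-1 : LaurentSeries G.K) ^ G.arrowCount i (G.τ j) = t2 at *
  generalize (u G.K + C (G.x j b)) ^ G.arrowCount i j = b1 at *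
  generalize (u G.K + C (G.x j b)) ^ G.arrowCount j i = b2 at *
  generalize (u G.K - C (G.x j b)) ^ G.arrowCount i (G.τ j) = b3 at *
  generalize (u G.K - C (G.x j b)) ^ G.arrowCount (G.τ j) i = b4 at *
  generalize (u G.K + C (G.x j b) + C G.ħ) ^ G.arrowCount i j = d1 at *
  generalize (u G.K + C (G.x j b) + C G.ħ) ^ G.arrowCount j i = d2 at *
  generalize (u G.K - C (G.x j b) - C G.ħ) ^ G.arrowCount i (G.τ j) = d3 at *
  generalize (u G.K - C (G.x j b) - C G.ħ) ^ G.arrowCount (G.τ j) i = d4 at *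
  have k1 : a1 * (b1 * b3) = a3 * (d1 * d3) := by
    linear_combination h1' - (a1 * b1 * b3 - a3 * d1 * d3) * (t2 * t2) * e1
      - (a1 * b1 * b3 - a3 * d1 * d3) * e2
  linear_combination a2 * (b2 * b4) * k1 + a3 * (d1 * d3) * h2

open HahnSeries in
/-- The effect of a translation on the denominator of the Cartan series. -/
theorem mapHom_denHV (i j : Q₀) (b : Fin (G.v j)) :
    mapHom (G.σ j b) (G.denHV i) *
      ((if i = j then (u G.K + C (G.x j b) - C (G.ħ / 2)) * (u G.K + C (G.x j b) + C (G.ħ / 2))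
        else 1) * (if i = G.τ j then
          (u G.K - C (G.x j b) - C (G.ħ / 2)) * (u G.K - C (G.x j b) + C (G.ħ / 2)) else 1)) =
    G.denHV i *
      ((if i = j then (u G.K + C (G.x j b) + C G.ħ - C (G.ħ / 2)) *
          (u G.K + C (G.x j b) + C G.ħ + C (G.ħ / 2)) else 1) *
        (if i = G.τ j then (u G.K - C (G.x j b) - C G.ħ - C (G.ħ / 2)) *
          (u G.K - C (G.x j b) - C G.ħ + C (G.ħ / 2)) else 1)) := by
  have h1 := congrArg (Polynomial.eval₂ C (-u G.K + C (G.ħ / 2))) (G.map_σ_V j b i)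
  have h2 := congrArg (Polynomial.eval₂ C (-u G.K - C (G.ħ / 2))) (G.map_σ_V j b i)
  rw [denHV, map_mul, G.mapHom_eval₂ _ _ _ (by rw [map_add, map_neg, mapHom_u, mapHom_ħ]),
    G.mapHom_eval₂ _ _ _ (by rw [map_sub, map_neg, mapHom_u, mapHom_ħ])]
  by_cases e : i = j
  · have e' : i ≠ G.τ j := fun h => G.τ_ne j (by rw [← h, e])
    simp only [if_pos e, if_neg e', Polynomial.eval₂_mul, Polynomial.eval₂_sub,
      Polynomial.eval₂_add, Polynomial.eval₂_X, Polynomial.eval₂_C, map_add, mul_one] at h1 h2 ⊢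
    linear_combination ((G.V i).map (G.σ j b)).eval₂ C (-u G.K - C (G.ħ / 2)) *
      (-u G.K - C (G.ħ / 2) - C (G.x j b)) * h1 + (G.V i).eval₂ C (-u G.K + C (G.ħ / 2)) *
      (-u G.K + C (G.ħ / 2) - (C (G.x j b) + C G.ħ)) * h2
  · by_cases e' : i = G.τ j
    · simp only [if_neg e, if_pos e', Polynomial.eval₂_mul, Polynomial.eval₂_add,
        Polynomial.eval₂_X, Polynomial.eval₂_C, map_add, one_mul] at h1 h2 ⊢
      linear_combination ((G.V i).map (G.σ j b)).eval₂ C (-u G.K - C (G.ħ / 2)) *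
        (-u G.K - C (G.ħ / 2) + C (G.x j b)) * h1 + (G.V i).eval₂ C (-u G.K + C (G.ħ / 2)) *
        (-u G.K + C (G.ħ / 2) + (C (G.x j b) + C G.ħ)) * h2
    · simp only [if_neg e, if_neg e', mul_one] at h1 h2 ⊢
      rw [h1, h2]

open HahnSeries in
/-- The exchange relation between the Cartan series and a translation. -/
theorem mapHom_HV (i j : Q₀) (b : Fin (G.v j)) :
    (u G.K + C (-G.q j b - (G.c i j : G.K) / 2 * G.ħ)) *
      (u G.K + C (G.q j b + (G.c i (G.τ j) : G.K) / 2 * G.ħ)) * G.HV i =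
    (u G.K + C (-G.q j b + (G.c i j : G.K) / 2 * G.ħ)) *
      (u G.K + C (G.q j b - (G.c i (G.τ j) : G.K) / 2 * G.ħ)) * mapHom (G.σ j b) (G.HV i) := by
  have hn := G.mapHom_numHV i j b
  have hd := G.mapHom_denHV i j b
  have hd0 := G.denHV_ne i
  have hd1 : mapHom (G.σ j b) (G.denHV i) ≠ 0 := by rwa [Ne, map_eq_zero]
  rw [HV_eq, map_mul, map_mul, map_inv₀, mapHom_preHV]
  have hC : (C G.ħ : LaurentSeries G.K) = 2 * C (G.ħ / 2) := by
    rw [← map_ofNat (C : G.K →+* LaurentSeries G.K) 2, ← map_mul]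
    congr 1
    ring
  have hcC : ∀ m : ℤ, (C ((m : G.K) / 2 * G.ħ) : LaurentSeries G.K) = (m : LaurentSeries G.K) * C (G.ħ / 2) := by
    intro m
    rw [← map_intCast (C : G.K →+* LaurentSeries G.K) m, ← map_mul]
    congr 1
    ring
  have hq : (C (G.q j b) : LaurentSeries G.K) = -C (G.x j b) - C (G.ħ / 2) := by rw [q, map_sub, map_neg]
  simp only [map_add, map_sub, map_neg, hcC, hq, hC] at hn hd ⊢
  have e0 : (u G.K + C (G.x j b)) ^ (G.arrowCount i j + G.arrowCount j i) *
        (u G.K - C (G.x j b)) ^ (G.arrowCount i (G.τ j) + G.arrowCount (G.τ j) i) ≠ 0 :=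
    mul_ne_zero (pow_ne_zero _ (u_add_C_ne _)) (pow_ne_zero _ (u_sub_C_ne _))
  have v0 : ((if i = j then (u G.K + C (G.x j b) + 2 * C (G.ħ / 2) - C (G.ħ / 2)) *
          (u G.K + C (G.x j b) + 2 * C (G.ħ / 2) + C (G.ħ / 2)) else 1) *
        (if i = G.τ j then (u G.K - C (G.x j b) - 2 * C (G.ħ / 2) - C (G.ħ / 2)) *
          (u G.K - C (G.x j b) - 2 * C (G.ħ / 2) + C (G.ħ / 2)) else 1)) ≠ 0 := by
    have k1 := u_add_C_ne (G.x j b + G.ħ - G.ħ / 2)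
    have k2 := u_add_C_ne (G.x j b + G.ħ + G.ħ / 2)
    have k3 := u_add_C_ne (-G.x j b - G.ħ - G.ħ / 2)
    have k4 := u_add_C_ne (-G.x j b - G.ħ + G.ħ / 2)
    simp only [map_add, map_sub, map_neg, hC, ← add_assoc, ← add_sub_assoc,
      ← sub_eq_add_neg] at k1 k2 k3 k4
    refine mul_ne_zero ?_ ?_ <;> split_ifs
    exacts [mul_ne_zero k1 k2, one_ne_zero, mul_ne_zero k3 k4, one_ne_zero]
  -- The two linear factors are treated separately: each comes from the arrows or from `V_i`.
  have key1 : (u G.K + (- (-C (G.x j b) - C (G.ħ / 2)) - (G.c i j : LaurentSeries G.K) * C (G.ħ / 2)))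
      * (u G.K + C (G.x j b)) ^ (G.arrowCount i j + G.arrowCount j i) *
      (if i = j then (u G.K + C (G.x j b) + 2 * C (G.ħ / 2) - C (G.ħ / 2)) *
          (u G.K + C (G.x j b) + 2 * C (G.ħ / 2) + C (G.ħ / 2)) else 1) =
      (u G.K + (- (-C (G.x j b) - C (G.ħ / 2)) + (G.c i j : LaurentSeries G.K) * C (G.ħ / 2)))
      * (u G.K + C (G.x j b) + 2 * C (G.ħ / 2)) ^ (G.arrowCount i j + G.arrowCount j i) *
      (if i = j then (u G.K + C (G.x j b) - C (G.ħ / 2)) * (u G.K + C (G.x j b) + C (G.ħ / 2))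
        else 1) := by
    by_cases e : i = j
    · have hc : G.c i j = 2 := by rw [e]; exact G.cartan.c_diag j
      rw [if_pos e, if_pos e, hc, e, arrowCount_self]
      push_cast
      ring
    · have hle := G.arrowCount_add_le e
      rw [if_neg e, if_neg e, G.c_eq_arrowCount e, ← Nat.cast_add]
      interval_cases G.arrowCount i j + G.arrowCount j i
      · simp
      · push_cast
        ring
  have key2 : (u G.K + (-C (G.x j b) - C (G.ħ / 2) +
        (G.c i (G.τ j) : LaurentSeries G.K) * C (G.ħ / 2)))
      * (u G.K - C (G.x j b)) ^ (G.arrowCount i (G.τ j) + G.arrowCount (G.τ j) i) *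
      (if i = G.τ j then (u G.K - C (G.x j b) - 2 * C (G.ħ / 2) - C (G.ħ / 2)) *
          (u G.K - C (G.x j b) - 2 * C (G.ħ / 2) + C (G.ħ / 2)) else 1) =
      (u G.K + (-C (G.x j b) - C (G.ħ / 2) - (G.c i (G.τ j) : LaurentSeries G.K) * C (G.ħ / 2)))
      * (u G.K - C (G.x j b) - 2 * C (G.ħ / 2)) ^
        (G.arrowCount i (G.τ j) + G.arrowCount (G.τ j) i) *
      (if i = G.τ j then (u G.K - C (G.x j b) - C (G.ħ / 2)) * (u G.K - C (G.x j b) + C (G.ħ / 2))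
        else 1) := by
    by_cases e : i = G.τ j
    · have hc : G.c i (G.τ j) = 2 := by rw [e]; exact G.cartan.c_diag (G.τ j)
      rw [if_pos e, if_pos e, hc, e, arrowCount_self]
      push_cast
      ring
    · have hle := G.arrowCount_add_le e
      rw [if_neg e, if_neg e, G.c_eq_arrowCount e, ← Nat.cast_add]
      interval_cases G.arrowCount i (G.τ j) + G.arrowCount (G.τ j) i
      · simp
      · push_cast
        ring
  refine mul_right_cancel₀ (mul_ne_zero (mul_ne_zero hd0 hd1) (mul_ne_zero e0 v0)) ?_
  generalize mapHom (G.σ j b) (G.denHV i) = D' at *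
  generalize mapHom (G.σ j b) (G.numHV i) = N' at *
  generalize G.denHV i = D at *
  generalize G.numHV i = N at *
  have i1 : D⁻¹ * D = 1 := inv_mul_cancel₀ hd0
  have i2 : D'⁻¹ * D' = 1 := inv_mul_cancel₀ hd1
  generalize D⁻¹ = I at *
  generalize D'⁻¹ = I' at *
  clear hd0 hd1 e0 v0 hC hcC hq
  generalize G.preHV i = p at *
  generalize (u G.K + C (G.x j b)) ^ (G.arrowCount i j + G.arrowCount j i) = b1 at *
  generalize (u G.K - C (G.x j b)) ^ (G.arrowCount i (G.τ j) + G.arrowCount (G.τ j) i) = b2 at *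
  generalize (u G.K + C (G.x j b) + 2 * C (G.ħ / 2)) ^ (G.arrowCount i j + G.arrowCount j i) = d1
    at *
  generalize (u G.K - C (G.x j b) - 2 * C (G.ħ / 2)) ^
    (G.arrowCount i (G.τ j) + G.arrowCount (G.τ j) i) = d2 at *
  generalize (if i = j then (u G.K + C (G.x j b) + 2 * C (G.ħ / 2) - C (G.ħ / 2)) *
          (u G.K + C (G.x j b) + 2 * C (G.ħ / 2) + C (G.ħ / 2)) else 1) = v1' at *
  generalize (if i = j then (u G.K + C (G.x j b) - C (G.ħ / 2)) *
    (u G.K + C (G.x j b) + C (G.ħ / 2)) else 1) = v1 at *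
  generalize (if i = G.τ j then (u G.K - C (G.x j b) - 2 * C (G.ħ / 2) - C (G.ħ / 2)) *
          (u G.K - C (G.x j b) - 2 * C (G.ħ / 2) + C (G.ħ / 2)) else 1) = v2' at *
  generalize (if i = G.τ j then (u G.K - C (G.x j b) - C (G.ħ / 2)) *
    (u G.K - C (G.x j b) + C (G.ħ / 2)) else 1) = v2 at *
  generalize (u G.K + (- (-C (G.x j b) - C (G.ħ / 2)) -
    (G.c i j : LaurentSeries G.K) * C (G.ħ / 2))) = a1 at *
  generalize (u G.K + (- (-C (G.x j b) - C (G.ħ / 2)) +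
    (G.c i j : LaurentSeries G.K) * C (G.ħ / 2))) = a1' at *
  generalize (u G.K + (-C (G.x j b) - C (G.ħ / 2) +
    (G.c i (G.τ j) : LaurentSeries G.K) * C (G.ħ / 2))) = a2 at *
  generalize (u G.K + (-C (G.x j b) - C (G.ħ / 2) -
    (G.c i (G.τ j) : LaurentSeries G.K) * C (G.ħ / 2))) = a2' at *
  linear_combination a1 * a2 * p * N * D' * b1 * b2 * v1' * v2' * i1
    - a1' * a2' * p * N' * D * b1 * b2 * v1' * v2' * i2
    + p * N * D' * a2 * b2 * v2' * key1 + p * N * D' * a1' * d1 * v1 * key2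
    + p * N * a1' * a2' * d1 * d2 * hd - p * D * a1' * a2' * v1' * v2' * hn

end GaugeDatum

/-! ### The coefficients of the Cartan series -/

section

variable {R A : Type*} [CommRing R] [Ring A]

theorem commute_u (x : LaurentSeries A) : Commute x (GaugeDatum.u A) := by
  ext m
  rw [GaugeDatum.u, HahnSeries.coeff_mul_single, HahnSeries.coeff_single_mul, one_mul, mul_one]

theorem eval₂_neg_eq_eval₂_comp (f : R →+* A) (P : Polynomial R) (x : A) :
    P.eval₂ f (-x) = (P.comp (-Polynomial.X)).eval₂ f x := by
  induction P using Polynomial.induction_on' with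
  | add p q hp hq => rw [Polynomial.eval₂_add, hp, hq, Polynomial.add_comp, Polynomial.eval₂_add]
  | monomial n a =>
    have h : Polynomial.C a * (-Polynomial.X) ^ n =
        Polynomial.C (a * (-1) ^ n) * Polynomial.X ^ n := by
      rw [neg_pow, Polynomial.C_mul, Polynomial.C_pow, Polynomial.C_neg, Polynomial.C_1, mul_assoc]
    rw [Polynomial.eval₂_monomial, Polynomial.monomial_comp, h,
      Polynomial.C_mul_X_pow_eq_monomial, Polynomial.eval₂_monomial,
      neg_pow, ← mul_assoc, map_mul, map_pow, map_neg, map_one]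

theorem coeff_mul_eval₂_u (f : R →+* A) (x : LaurentSeries A) (P : Polynomial R) (n : ℤ) :
    (x * P.eval₂ (HahnSeries.C.comp f) (GaugeDatum.u A)).coeff n =
      P.sum fun e a => x.coeff (n + e) * f a := by
  rw [Polynomial.eval₂_eq_sum, Polynomial.sum, Finset.mul_sum, HahnSeries.coeff_sum,
    Polynomial.sum]
  refine Finset.sum_congr rfl fun e _ => ?_
  rw [u_pow, RingHom.comp_apply, HahnSeries.C_apply, HahnSeries.single_mul_single, zero_add,
    mul_one, HahnSeries.coeff_mul_single, sub_neg_eq_add]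

end

namespace GaugeDatum

variable {Q₀ Q₁ : Type*} [Fintype Q₀] [DecidableEq Q₀] [Fintype Q₁] [DecidableEq Q₁]
  (G : GaugeDatum Q₀ Q₁)

/-- The coefficient at `u^{-n}` of the product of a series over `K` and a polynomial in `u`
over `H_{G_W}^*(pt)`. -/
def twistCoeff (P : Polynomial G.HW) (F : LaurentSeries G.K) (n : ℤ) : G.DiffW :=
  P.sum fun e a => F.coeff (n + e) • G.ofHW a

/-- The polynomial `W_i(-u) W_{τ i}(u)`. -/
def WW (i : Q₀) : Polynomial G.HW := (G.W i).comp (-Polynomial.X) * G.W (G.τ i)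

theorem twistCoeff_add (P : Polynomial G.HW) (F F' : LaurentSeries G.K) (n : ℤ) :
    G.twistCoeff P (F + F') n = G.twistCoeff P F n + G.twistCoeff P F' n := by
  simp only [twistCoeff, Polynomial.sum, HahnSeries.coeff_add, add_smul, Finset.sum_add_distrib]

theorem twistCoeff_C_mul (P : Polynomial G.HW) (α : G.K) (F : LaurentSeries G.K) (n : ℤ) :
    G.twistCoeff P (HahnSeries.C α * F) n = α • G.twistCoeff P F n := by
  simp only [twistCoeff, Polynomial.sum, coeff_C_mul, mul_smul, Finset.smul_sum]

theorem twistCoeff_u_mul (P : Polynomial G.HW) (F : LaurentSeries G.K) (n : ℤ) :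
    G.twistCoeff P (u G.K * F) n = G.twistCoeff P F (n + 1) := by
  simp only [twistCoeff, Polynomial.sum, coeff_u_mul]
  exact Finset.sum_congr rfl fun e _ => by rw [add_right_comm]

theorem twistCoeff_mul_smul (P : Polynomial G.HW) (F : LaurentSeries G.K) (n : ℤ) (α : G.K)
    (z : G.DiffW) : G.twistCoeff P F n * α • z = α • (G.twistCoeff P F n * z) := by
  rw [smul_def, smul_def, ← mul_assoc, ← mul_assoc]
  congr 1
  rw [twistCoeff, Polynomial.sum]
  exact Commute.sum_left _ _ _ fun e _ =>
    (G.ofK_comm _ _).mul_left (G.ofHW_comm _ _)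

theorem twistCoeff_comm (P P' : Polynomial G.HW) (F F' : LaurentSeries G.K) (n n' : ℤ) :
    Commute (G.twistCoeff P F n) (G.twistCoeff P' F' n') :=
  Commute.sum_left _ _ _ fun _ _ => Commute.sum_right _ _ _ fun _ _ =>
    ((G.ofK_comm _ _).mul_right (G.ofHW_comm _ _).symm).mul_left (G.ofHW_comm _ _)

theorem y_mul_twistCoeff (j : Q₀) (b : Fin (G.v j)) (P : Polynomial G.HW) (F : LaurentSeries G.K)
    (n : ℤ) : G.y j b * G.twistCoeff P F n = G.twistCoeff P (mapHom (G.σ j b) F) n * G.y j b := by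
  simp only [twistCoeff, Polynomial.sum, Finset.mul_sum, Finset.sum_mul, mapHom_coeff]
  refine Finset.sum_congr rfl fun e _ => ?_
  rw [y_mul_smul, smul_mul_assoc, (G.ofHW_comm _ _).eq]

/-- The factors of `H_i(u)` that involve `W` are central polynomials in `u`, so the coefficients of
`H_i(u)` are combinations of those of `HV`. -/
theorem H_coeff (i : Q₀) (n : ℤ) : (G.H i).coeff n = G.twistCoeff (G.WW i) (G.HV i) n := by
  change (mapHom G.ofK (G.HV i) * (G.W i).eval₂ (HahnSeries.C.comp G.ofHW) (-u G.DiffW)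
    * (G.W (G.τ i)).eval₂ (HahnSeries.C.comp G.ofHW) (u G.DiffW)).coeff n = _
  rw [mul_assoc, eval₂_neg_eq_eval₂_comp, ← Polynomial.eval₂_mul_noncomm _ _ fun k => commute_u _,
    coeff_mul_eval₂_u]
  rfl

/-- The commutation relation between the Cartan series and a difference operator. -/
theorem H_coeff_mul_y (i j : Q₀) (b : Fin (G.v j)) (n : ℤ) :
    (G.H i).coeff (n + 2) * G.y j b
      + (((G.c i (G.τ j) : G.K) - G.c i j) / 2 * G.ħ) • ((G.H i).coeff (n + 1) * G.y j b)
      - ((G.q j b + (G.c i j : G.K) / 2 * G.ħ) * (G.q j b + (G.c i (G.τ j) : G.K) / 2 * G.ħ)) •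
        ((G.H i).coeff n * G.y j b) =
    G.y j b * (G.H i).coeff (n + 2)
      - (((G.c i (G.τ j) : G.K) - G.c i j) / 2 * G.ħ) • (G.y j b * (G.H i).coeff (n + 1))
      - ((G.q j b - (G.c i j : G.K) / 2 * G.ħ) * (G.q j b - (G.c i (G.τ j) : G.K) / 2 * G.ħ)) •
        (G.y j b * (G.H i).coeff n) := by
  have h := congrArg (fun F => G.twistCoeff (G.WW i) F n * G.y j b) (G.mapHom_HV i j b)
  have e : ∀ (s t : G.K) (F : LaurentSeries G.K),
      (u G.K + HahnSeries.C s) * (u G.K + HahnSeries.C t) * F =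
        u G.K * (u G.K * F) + HahnSeries.C (s + t) * (u G.K * F) + HahnSeries.C (s * t) * F := by
    intro s t F
    rw [map_add, map_mul]
    ring
  rw [e, e] at h
  simp only [twistCoeff_add, twistCoeff_C_mul, twistCoeff_u_mul, add_mul, smul_mul_assoc,
    ← y_mul_twistCoeff, add_assoc n, one_add_one_eq_two] at h
  simp only [H_coeff]
  linear_combination (norm := module) h

end GaugeDatum

/-! ### Leading terms and symmetry of the Cartan series -/

theorem coeff_comp_neg_X {R : Type*} [CommRing R] (P : Polynomial R) (e : ℕ) :
    (P.comp (-Polynomial.X)).coeff e = (-1) ^ e * P.coeff e := by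
  have : (-Polynomial.X : Polynomial R) = Polynomial.C (-1) * Polynomial.X := by
    rw [Polynomial.C_neg, Polynomial.C_1, neg_one_mul]
  rw [this, Polynomial.comp_C_mul_X_coeff, mul_comm]

namespace GaugeDatum

variable {Q₀ Q₁ : Type*} [Fintype Q₀] [DecidableEq Q₀] [Fintype Q₁] [DecidableEq Q₁]
  (G : GaugeDatum Q₀ Q₁)

theorem monic_W (i : Q₀) : (G.W i).Monic := by
  refine Polynomial.monic_of_injective (f := G.HW.val.toRingHom) Subtype.val_injective ?_
  rw [map_W, Wfull]
  exact Polynomial.monic_prod_of_monic _ _ fun k _ => Polynomial.monic_X_sub_C _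

theorem natDegree_W (i : Q₀) : (G.W i).natDegree = G.w i := by
  rw [← Polynomial.natDegree_map_eq_of_injective (f := G.HW.val.toRingHom) Subtype.val_injective,
    map_W, Wfull, Polynomial.natDegree_prod_of_monic _ _ fun k _ => Polynomial.monic_X_sub_C _]
  simp

theorem natDegree_WW_le (i : Q₀) : (G.WW i).natDegree ≤ G.w i + G.w (G.τ i) := by
  refine Polynomial.natDegree_mul_le_of_le ?_ (G.natDegree_W _).le
  rw [Polynomial.natDegree_comp, natDegree_W, Polynomial.natDegree_neg, Polynomial.natDegree_X,
    mul_one]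

theorem coeff_WW (i : Q₀) : (G.WW i).coeff (G.w i + G.w (G.τ i)) = (-1) ^ G.w i := by
  have h1 : ((G.W i).comp (-Polynomial.X)).natDegree = G.w i := by
    rw [Polynomial.natDegree_comp, natDegree_W, Polynomial.natDegree_neg, Polynomial.natDegree_X,
      mul_one]
  have h2 : ((G.W i).comp (-Polynomial.X)).coeff (G.w i) = (-1) ^ G.w i := by
    have := Polynomial.comp_neg_X_leadingCoeff_eq (G.W i)
    rwa [Polynomial.leadingCoeff, h1, natDegree_W, (G.monic_W i).leadingCoeff, mul_one] at this
  have h3 : (G.W (G.τ i)).coeff (G.w (G.τ i)) = 1 := by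
    rw [← G.natDegree_W (G.τ i)]
    exact G.monic_W _
  rw [WW, Polynomial.coeff_mul_add_eq_of_natDegree_le h1.le (G.natDegree_W _).le, h2, h3, mul_one]

theorem WW_τ (i : Q₀) : G.WW (G.τ i) = (G.WW i).comp (-Polynomial.X) := by
  rw [WW, WW, Polynomial.mul_comp, Polynomial.comp_neg_X_comp_neg_X, G.τ_invol, mul_comm]

theorem twistCoeff_eq_sum_range (P : Polynomial G.HW) (F : LaurentSeries G.K) (n : ℤ) (N : ℕ)
    (hN : P.natDegree ≤ N) :
    G.twistCoeff P F n = ∑ e ∈ Finset.range (N + 1), F.coeff (n + e) • G.ofHW (P.coeff e) :=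
  Polynomial.sum_over_range' _ (fun e => by rw [map_zero, smul_zero]) _ (by omega)

theorem twistCoeff_of_lt {P : Polynomial G.HW} {F : LaurentSeries G.K} {n m : ℤ} {a : G.K} {N : ℕ}
    (hN : P.natDegree ≤ N) (hF : HasLead F m a) (hn : n < m - N) : G.twistCoeff P F n = 0 := by
  rw [G.twistCoeff_eq_sum_range P F n N hN]
  refine Finset.sum_eq_zero fun e he => ?_
  rw [Finset.mem_range] at he
  rw [hF.coeff_of_lt (by omega), zero_smul]

/-- The leading coefficient of a product; the factor `P` lowers the leading degree by at most `N`. -/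
theorem twistCoeff_lead {P : Polynomial G.HW} {F : LaurentSeries G.K} {m : ℤ} {a : G.K} {N : ℕ}
    (hN : P.natDegree ≤ N) (hF : HasLead F m a) :
    G.twistCoeff P F (m - N) = a • G.ofHW (P.coeff N) := by
  rw [G.twistCoeff_eq_sum_range P F _ N hN, Finset.sum_range_succ, sub_add_cancel, hF.coeff_eq,
    Finset.sum_eq_zero, zero_add]
  intro e he
  rw [Finset.mem_range] at he
  rw [hF.coeff_of_lt (by omega), zero_smul]

theorem hasLead_V {e : G.K} (he : e ≠ 0) (i : Q₀) (s : G.K) :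
    HasLead ((G.V i).eval₂ HahnSeries.C (HahnSeries.C e * u G.K + HahnSeries.C s)) (-G.v i)
      (e ^ G.v i) := by
  rw [V, Polynomial.eval₂_finsetProd]
  have h := HasLead.prod (Finset.univ : Finset (Fin (G.v i))) (fun k _ =>
    HasLead.u_mul_add he (s - G.x i k))
  rw [Finset.sum_const, Finset.prod_const, Finset.card_univ, Fintype.card_fin, smul_neg,
    nsmul_one] at h
  convert h using 3
  rw [Polynomial.eval₂_sub, Polynomial.eval₂_X, Polynomial.eval₂_C, map_sub]
  ring

theorem hasLead_arrowPoly {e : G.K} (he : e ≠ 0) (i : Q₀) :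
    HasLead ((G.arrowPoly i).eval₂ HahnSeries.C (HahnSeries.C e * u G.K))
      (-∑ h ∈ G.arrowsFrom i, (G.v (G.t h) : ℤ)) (∏ h ∈ G.arrowsFrom i, e ^ G.v (G.t h)) := by
  rw [arrowPoly, Polynomial.eval₂_finsetProd, ← Finset.sum_neg_distrib]
  refine HasLead.prod _ fun h _ => ?_
  have := G.hasLead_V he (G.t h) 0
  rwa [map_zero, add_zero] at this

/-- The arrows between `i` and `τ i` are fixed by the involution. -/
theorem c_τ_eq (i : Q₀) : G.c i (G.τ i) = -((G.δ i : ℤ) + G.δ (G.τ i)) := by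
  rw [G.c_eq_arrowCount (G.τ_ne i).symm, δ_eq_arrowCount, δ_eq_arrowCount, G.τ_invol]

/-- The degree of `HV` in `u⁻¹` is that of `H_i` plus the degree of `W_i(-u) W_{τ i}(u)`. -/
theorem hasLead_HV (i : Q₀) :
    HasLead (G.HV i) (-G.cartan.pairing i G.μ + (G.w i + G.w (G.τ i) : ℕ))
      ((-1) ^ ((G.v i : ℤ) - 1) * 2 ^ (-G.c i (G.τ i)) * (-1) ^ G.δ i *
        (-1) ^ ∑ h ∈ G.arrowsFrom i, (G.v (G.t h))) := by
  have h1 : HasLead (-1 : LaurentSeries G.K) 0 (-1) := by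
    have := HasLead.C (F := G.K) (a := -1) (by simp)
    rwa [map_neg, map_one] at this
  have h2 : ∀ b : G.K, HasLead (2 * u G.K + HahnSeries.C b) (-1) 2 := by
    intro b
    have := HasLead.u_mul_add (F := G.K) two_ne_zero b
    rwa [map_ofNat] at this
  have h3 := h2 0
  rw [map_zero, add_zero] at h3
  have h4 := h2 (-(G.ħ / 2))
  rw [map_neg, ← sub_eq_add_neg] at h4
  have hn : (-1 : G.K) ≠ 0 := by simp
  have h5 := G.hasLead_V hn i (G.ħ / 2)
  have h6 := G.hasLead_V hn i (-(G.ħ / 2))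
  have h7 := G.hasLead_arrowPoly hn i
  have h8 := G.hasLead_arrowPoly one_ne_zero (G.τ i)
  have hm : (HahnSeries.C (-1 : G.K) : LaurentSeries G.K) * u G.K = -u G.K := by
    rw [map_neg, map_one, neg_one_mul]
  rw [hm] at h5 h6 h7
  rw [map_one, one_mul] at h8
  rw [map_neg, ← sub_eq_add_neg] at h6
  have h := ((((h1.zpow ((G.v i : ℤ) - 1)).mul ((h3.mul (h4.mul (h2 (G.ħ / 2))).inv).zpow
    (G.c i (G.τ i)))).mul (h1.pow (G.δ i))).mul (h5.mul h6).inv).mul (h7.mul h8)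
  rw [HV_eq, preHV, denHV, numHV, div_eq_mul_inv]
  convert h using 1
  · rw [pairing_μ, c_τ_eq]
    push_cast
    ring
  · rw [← mul_pow, ← Finset.prod_pow_eq_pow_sum]
    have e1 : (2 * (2 * 2)⁻¹ : G.K) = 2⁻¹ := by norm_num
    rw [e1, inv_zpow, zpow_neg]
    simp

theorem H_coeff_of_lt (i : Q₀) (n : ℤ) (hn : n < -G.cartan.pairing i G.μ) :
    (G.H i).coeff n = 0 := by
  rw [H_coeff]
  exact G.twistCoeff_of_lt (G.natDegree_WW_le i) (G.hasLead_HV i) (by omega)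

theorem H_coeff_lead (i : Q₀) :
    (G.H i).coeff (-G.cartan.pairing i G.μ) = algebraMap Ch G.DiffW (hbar * G.ζ i) := by
  have h := G.twistCoeff_lead (G.natDegree_WW_le i) (G.hasLead_HV i)
  rw [add_sub_cancel_right, ← H_coeff, coeff_WW, map_pow, map_neg, map_one] at h
  have hp : ((-1 : G.DiffW)) ^ G.w i = G.ofK ((-1) ^ G.w i) := by
    rw [map_pow, map_neg, map_one]
  rw [h, hp, smul_def, ← map_mul, ← ofK_algebraMap]
  congr 1
  have hn : (-1 : Ch) ≠ 0 := by simp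
  rw [ζ, zpow_add₀ hn, zpow_add₀ hn, zpow_add₀ hn, zpow_natCast, zpow_natCast, ← Nat.cast_sum,
    zpow_natCast, ← mul_assoc, ← mul_assoc, ← mul_assoc, mul_inv_cancel_left₀ hbar_ne_zero]
  simp only [map_mul, map_zpow₀, map_pow, map_neg, map_one, map_ofNat]
  ring

theorem twistCoeff_evalNeg (P : Polynomial G.HW) (F : LaurentSeries G.K) (n : ℤ) :
    G.twistCoeff (P.comp (-Polynomial.X)) (evalNeg F) n =
      ((-1 : G.K) ^ n) • G.twistCoeff P F n := by
  have hN : (P.comp (-Polynomial.X)).natDegree ≤ P.natDegree := by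
    rw [Polynomial.natDegree_comp, Polynomial.natDegree_neg, Polynomial.natDegree_X, mul_one]
  rw [G.twistCoeff_eq_sum_range _ _ n _ hN, G.twistCoeff_eq_sum_range _ _ n _ le_rfl,
    Finset.smul_sum]
  refine Finset.sum_congr rfl fun e _ => ?_
  have hp : ((-1 : G.DiffW)) ^ e = G.ofK ((-1) ^ e) := by
    rw [map_pow, map_neg, map_one]
  have hs : ((-1 : G.K) ^ n) * (-1) ^ (e : ℤ) * (-1) ^ e = (-1) ^ n := by
    rw [zpow_natCast, mul_assoc, ← mul_pow]
    simp
  rw [evalNeg_coeff, coeff_comp_neg_X, map_mul, map_pow, map_neg, map_one, hp, ← smul_def, smul_smul, smul_smul,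
    zpow_add₀ (by simp)]
  congr 1
  linear_combination F.coeff (n + e) * hs

/-- The roots of `V_{τ i}` are the negatives of the roots of `V_i`. -/
theorem V_eval₂_τ {i j : Q₀} (h : j = G.τ i) (z : LaurentSeries G.K) :
    (G.V j).eval₂ HahnSeries.C (-z) = (-1) ^ G.v i * (G.V i).eval₂ HahnSeries.C z := by
  have hv : G.v i = G.v j := by rw [h, G.v_τ]
  rw [V, V, Polynomial.eval₂_finsetProd, Polynomial.eval₂_finsetProd]
  have : ((-1 : LaurentSeries G.K)) ^ G.v i = ∏ k : Fin (G.v i), -1 := by simp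
  rw [this, ← Finset.prod_mul_distrib]
  refine (Fintype.prod_equiv (finCongr hv) _ _ fun k => ?_).symm
  rw [G.x_τ (a := finCongr hv k) (b := k) h rfl]
  rw [Polynomial.eval₂_sub, Polynomial.eval₂_sub, Polynomial.eval₂_X, Polynomial.eval₂_X,
    Polynomial.eval₂_C, Polynomial.eval₂_C, map_neg]
  ring

theorem evalNeg_eval₂ (P : Polynomial G.K) (z : LaurentSeries G.K) :
    evalNeg (P.eval₂ HahnSeries.C z) = P.eval₂ HahnSeries.C (evalNeg z) := by
  rw [Polynomial.hom_eval₂]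
  congr 1
  ext1 a
  exact evalNeg_C a

/-- The sign `(-1)^{c_{i,τ i}}` from the scalar factor is absorbed by the change of `(-1)^{δ_{i → τ i}}`. -/
theorem evalNeg_HV (i : Q₀) : evalNeg (G.HV i) = G.HV (G.τ i) := by
  have hne : (-1 : LaurentSeries G.K) ≠ 0 := by simp
  have hc : G.c (G.τ i) (G.τ (G.τ i)) = G.c i (G.τ i) := G.cartan.c_τ i (G.τ i)
  have hpre : evalNeg (G.preHV i) = G.preHV (G.τ i) := by
    rw [preHV, preHV, hc, G.v_τ]
    have hs : ((-1 : LaurentSeries G.K)) ^ G.c i (G.τ i) * (-1) ^ G.δ i = (-1) ^ G.δ (G.τ i) := by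
      rw [c_τ_eq, neg_add, zpow_add₀ hne, zpow_neg, zpow_neg, zpow_natCast, zpow_natCast,
        ← inv_pow, ← inv_pow, inv_neg_one, mul_right_comm, ← mul_pow]
      simp
    have hCħ : evalNeg (HahnSeries.C (G.ħ / 2)) = HahnSeries.C (G.ħ / 2) := evalNeg_C _
    rw [← hs]
    generalize (HahnSeries.C (G.ħ / 2) : LaurentSeries G.K) = z at *
    simp only [map_mul, map_zpow₀, map_div₀, map_pow, map_neg, map_one, map_sub, map_add,
      map_ofNat, evalNeg_u, hCħ]
    rw [show 2 * -u G.K / ((2 * -u G.K - z) * (2 * -u G.K + z)) =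
      (-1) * (2 * u G.K / ((2 * u G.K - z) * (2 * u G.K + z))) by
        rw [show (2 * -u G.K - z) * (2 * -u G.K + z) = (2 * u G.K - z) * (2 * u G.K + z) by ring]
        ring, mul_zpow]
    ring
  have hden : evalNeg (G.denHV i) = G.denHV (G.τ i) := by
    have hs : ((-1 : LaurentSeries G.K) ^ G.v i) * (-1) ^ G.v i = 1 := by
      rw [← mul_pow]; simp
    have hCħ : evalNeg (HahnSeries.C (G.ħ / 2)) = HahnSeries.C (G.ħ / 2) := evalNeg_C _
    have h1 := G.V_eval₂_τ (i := i) rfl (u G.K + HahnSeries.C (G.ħ / 2))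
    have h2 := G.V_eval₂_τ (i := i) rfl (u G.K - HahnSeries.C (G.ħ / 2))
    rw [neg_add] at h1
    rw [neg_sub', sub_neg_eq_add] at h2
    rw [← sub_eq_add_neg] at h1
    rw [denHV, denHV, map_mul, evalNeg_eval₂, evalNeg_eval₂, map_sub, map_add, map_neg,
      evalNeg_u, neg_neg, hCħ, h1, h2]
    linear_combination -((G.V i).eval₂ HahnSeries.C (u G.K + HahnSeries.C (G.ħ / 2)) *
      (G.V i).eval₂ HahnSeries.C (u G.K - HahnSeries.C (G.ħ / 2))) * hs
  have hnum : evalNeg (G.numHV i) = G.numHV (G.τ i) := by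
    rw [numHV, numHV, G.τ_invol, map_mul, evalNeg_eval₂, evalNeg_eval₂, map_neg, evalNeg_u,
      neg_neg, mul_comm]
  rw [HV_eq, HV_eq, map_mul, map_mul, map_inv₀, hpre, hden, hnum]

theorem H_coeff_τ (i : Q₀) (n : ℤ) :
    (G.H i).coeff n = ((-1 : G.K) ^ n) • (G.H (G.τ i)).coeff n := by
  rw [H_coeff, H_coeff, WW_τ, ← evalNeg_HV, twistCoeff_evalNeg, smul_smul, ← mul_zpow]
  simp

end GaugeDatum

/-! ### Residues of the Cartan series -/

theorem prod_erase_inl {α β M : Type*} [Fintype α] [Fintype β] [DecidableEq α] [DecidableEq β]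
    [CommMonoid M] (f : α ⊕ β → M) (k : α) :
    ∏ l ∈ Finset.univ.erase (Sum.inl k), f l =
      (∏ l ∈ Finset.univ.erase k, f (Sum.inl l)) * ∏ l, f (Sum.inr l) := by
  rw [← Finset.prod_disjSum]
  congr 1
  ext (l | l) <;> simp

theorem prod_erase_inr {α β M : Type*} [Fintype α] [Fintype β] [DecidableEq α] [DecidableEq β]
    [CommMonoid M] (f : α ⊕ β → M) (k : β) :
    ∏ l ∈ Finset.univ.erase (Sum.inr k), f l =
      (∏ l, f (Sum.inl l)) * ∏ l ∈ Finset.univ.erase k, f (Sum.inr l) := by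
  rw [← Finset.prod_disjSum]
  congr 1
  ext (l | l) <;> simp

theorem prod_neg_erase {F : Type*} [Field F] {n : ℕ} (k : Fin n) (f : Fin n → F) :
    ∏ l ∈ Finset.univ.erase k, -f l = (-1) ^ ((n : ℤ) - 1) * ∏ l ∈ Finset.univ.erase k, f l := by
  have hn : 0 < n := k.pos
  rw [Finset.prod_neg, Finset.card_erase_of_mem (Finset.mem_univ k), Finset.card_univ,
    Fintype.card_fin]
  congr 1
  rw [← zpow_natCast]
  congr 1
  omega

namespace GaugeDatum

variable {Q₀ Q₁ : Type*} [Fintype Q₀] [DecidableEq Q₀] [Fintype Q₁] [DecidableEq Q₁]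
  (G : GaugeDatum Q₀ Q₁)

/-- Reindexing of a product over the coordinates of a mirror vertex. -/
theorem prod_erase_x_τ {i j : Q₀} (h : j = G.τ i) {a : Fin (G.v i)} {b : Fin (G.v j)}
    (hb : (b : ℕ) = a) (f : G.K → G.K) :
    ∏ l ∈ Finset.univ.erase b, f (G.x j l) = ∏ l ∈ Finset.univ.erase a, f (-G.x i l) := by
  have hv : G.v i = G.v j := by rw [h, G.v_τ]
  refine (Finset.prod_bij (fun l _ => Fin.cast hv l) (fun l hl => ?_) (fun l _ l' _ e => ?_)
    (fun l hl => ⟨Fin.cast hv.symm l, ?_, rfl⟩) fun l hl => ?_).symm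
  · refine Finset.mem_erase.2 ⟨fun e => Finset.ne_of_mem_erase hl (Fin.ext ?_), Finset.mem_univ _⟩
    rw [← hb, ← e]
    rfl
  · exact Fin.ext (congrArg Fin.val e : (Fin.cast hv l : ℕ) = Fin.cast hv l')
  · refine Finset.mem_erase.2 ⟨fun e => Finset.ne_of_mem_erase hl (Fin.ext ?_), Finset.mem_univ _⟩
    rw [hb, ← e]
    rfl
  · rw [G.x_τ (a := Fin.cast hv l) (b := l) h rfl]

/-- The translation by `ε_{i,a}` of the rational function in the mirror operator of `y_{i,a}`. -/
theorem σ_φ_τ {i j : Q₀} (h : j = G.τ i) {a : Fin (G.v i)} {b : Fin (G.v j)}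
    (hb : (b : ℕ) = a) :
    G.σ i a (G.φ j b) = (-(2 * G.x i a + 3 * G.ħ / 2)) ^ G.δ j *
      (G.arrowPoly j).eval (-G.x i a - G.ħ / 2) *
      (∏ l ∈ Finset.univ.erase a, (G.x i l - G.x i a - G.ħ))⁻¹ := by
  have hi : G.τ j = i := by rw [h, G.τ_invol]
  have hx : G.σ i a (G.x j b) = -G.x i a - G.ħ := by
    rw [G.x_τ h hb, map_neg, σ_x_self]
    ring
  have hV : G.σ i a ((G.Vr j b).eval (G.x j b)) =
      ∏ l ∈ Finset.univ.erase a, (G.x i l - G.x i a - G.ħ) := by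
    rw [Vr_eval, G.prod_erase_x_τ h hb fun z => G.x j b - z, map_prod]
    refine Finset.prod_congr rfl fun l hl => ?_
    rw [sub_neg_eq_add, map_add, hx, G.σ_x_of_ne
      (fun e => Finset.ne_of_mem_erase hl (Fin.ext e.2)) (fun e => G.τ_ne i e.1.symm)]
    ring
  have hE := congrArg (Polynomial.eval (-G.x i a - G.ħ / 2)) (G.map_σ_arrowPoly i a j)
  have hδ : G.arrowCount j i = G.δ j := by rw [δ_eq_arrowCount, hi]
  rw [← h, arrowCount_self, hδ] at hE
  simp only [Polynomial.eval_mul, Polynomial.eval_pow, Polynomial.eval_sub, Polynomial.eval_X,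
    Polynomial.eval_C, pow_zero, mul_one] at hE
  have hz : -G.x i a - G.ħ + G.ħ / 2 = -G.x i a - G.ħ / 2 := by ring
  have h0 : (-G.x i a - G.ħ / 2 - G.x i a) ^ G.δ j ≠ 0 := by
    refine pow_ne_zero _ ?_
    have := neg_ne_zero.2 (G.two_x_ne i a (1 / 2))
    push_cast at this
    convert this using 1
    ring
  rw [φ, map_mul, map_mul, map_inv₀, hV, map_pow, map_add, map_mul, hx, G.σ_eval i a, map_add, hx,
    map_div₀, map_div₀, map_mul, σ_ħ, map_ofNat, map_ofNat, hz, ← δ_eq_arrowCount]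
  congr 1
  rw [show 2 * (-G.x i a - G.ħ) + 3 * G.ħ / 2 = -G.x i a - G.ħ / 2 - G.x i a by ring, mul_comm, hE,
    mul_comm]
  congr 2
  ring

/-- The simple poles `x_{i,k} ± ħ/2` of `H_{τ i}(u)`. -/
def node (i : Q₀) : Fin (G.v i) ⊕ Fin (G.v i) → G.K :=
  Sum.elim (fun k => G.x i k + G.ħ / 2) fun k => G.x i k - G.ħ / 2

theorem node_injective (i : Q₀) : Function.Injective (G.node i) := by
  have h : ∀ k l, G.x i k + G.ħ / 2 ≠ G.x i l - G.ħ / 2 := by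
    intro k l e
    by_cases hkl : k = l
    · subst hkl
      exact G.ħ_ne (by linear_combination e)
    · have := G.sub_x_ne' i hkl 1
      rw [Rat.cast_one, one_mul] at this
      exact this (by linear_combination e)
  have h' : ∀ k l, G.x i k = G.x i l → k = l := by
    intro k l e
    by_contra hkl
    have := G.sub_x_ne' i hkl 0
    rw [Rat.cast_zero, zero_mul, add_zero] at this
    exact this (by linear_combination e)
  rintro (k | k) (l | l) e
  · exact congrArg _ (h' k l (add_right_cancel e))
  · exact absurd e (h k l)
  · exact absurd e.symm (h l k)
  · exact congrArg _ (h' k l (sub_left_injective e))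

/-- The numerator of `u^{-c_{i,τ i}} H_{τ i}(u)`, without its factor `W`. -/
def numPoly (i : Q₀) : Polynomial G.K :=
  Polynomial.C ((-1) ^ ((G.v i : ℤ) - 1) * (-1) ^ G.δ (G.τ i)) *
    ((Polynomial.X - Polynomial.C (G.ħ / 4)) *
      (2 * Polynomial.X + Polynomial.C (G.ħ / 2))) ^ (G.δ i + G.δ (G.τ i)) *
    ((G.arrowPoly (G.τ i)).comp (-Polynomial.X) * G.arrowPoly i)

theorem denHV_τ (i : Q₀) :
    G.denHV (G.τ i) = ∏ k, (u G.K - HahnSeries.C (G.node i k)) := by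
  have hs : ((-1 : LaurentSeries G.K) ^ G.v i) * (-1) ^ G.v i = 1 := by
    rw [← mul_pow]; simp
  have h1 := G.V_eval₂_τ (i := i) rfl (u G.K + HahnSeries.C (G.ħ / 2))
  have h2 := G.V_eval₂_τ (i := i) rfl (u G.K - HahnSeries.C (G.ħ / 2))
  rw [neg_add, ← sub_eq_add_neg] at h1
  rw [neg_sub', sub_neg_eq_add] at h2
  have e1 : ∀ s : G.K, (G.V i).eval₂ HahnSeries.C (u G.K - HahnSeries.C s) =
      ∏ k, (u G.K - HahnSeries.C (G.x i k + s)) := by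
    intro s
    rw [V, Polynomial.eval₂_finsetProd]
    refine Finset.prod_congr rfl fun k _ => ?_
    rw [Polynomial.eval₂_sub, Polynomial.eval₂_X, Polynomial.eval₂_C, map_add]
    ring
  have e2 := e1 (-(G.ħ / 2))
  rw [map_neg, sub_neg_eq_add] at e2
  rw [denHV, h1, h2, e1, e2, Fintype.prod_sum_type]
  simp only [node, Sum.elim_inl, Sum.elim_inr, sub_eq_add_neg (G.x i _)]
  linear_combination (∏ k, (u G.K - HahnSeries.C (G.x i k + G.ħ / 2))) *
    (∏ k, (u G.K - HahnSeries.C (G.x i k + -(G.ħ / 2)))) * hs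

theorem u_ne {F : Type*} [Field F] : u F ≠ 0 := by
  have := u_sub_C_ne (0 : F)
  rwa [map_zero, sub_zero] at this

/-- After multiplication with `u^{-c_{i,τ i}}`, the only poles of the scalar factor of `H_{τ i}(u)` are
the simple ones at the nodes. -/
theorem u_pow_mul_HV_τ (i : Q₀) :
    u G.K ^ (G.δ i + G.δ (G.τ i)) * G.HV (G.τ i) * ∏ k, (u G.K - HahnSeries.C (G.node i k)) =
      (G.numPoly i).eval₂ HahnSeries.C (u G.K) := by
  have hden := G.denHV_ne (G.τ i)
  have hu : (2 : LaurentSeries G.K) * u G.K ≠ 0 := by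
    have := (HasLead.u_mul_add (F := G.K) two_ne_zero 0).1
    rwa [map_zero, add_zero, map_ofNat] at this
  have hc : G.c (G.τ i) (G.τ (G.τ i)) = -((G.δ i + G.δ (G.τ i) : ℕ) : ℤ) := by
    rw [c_τ_eq, G.τ_invol]
    push_cast
    ring
  have h2 : (HahnSeries.C (G.ħ / 2) : LaurentSeries G.K) = 2 * HahnSeries.C (G.ħ / 4) := by
    rw [← map_ofNat (HahnSeries.C : G.K →+* LaurentSeries G.K) 2, ← map_mul]
    congr 1
    ring
  have hpre : u G.K ^ (G.δ i + G.δ (G.τ i)) * G.preHV (G.τ i) =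
      HahnSeries.C ((-1) ^ ((G.v i : ℤ) - 1) * (-1) ^ G.δ (G.τ i)) *
      ((u G.K - HahnSeries.C (G.ħ / 4)) * (2 * u G.K + HahnSeries.C (G.ħ / 2))) ^
        (G.δ i + G.δ (G.τ i)) := by
    have e : u G.K * (2 * u G.K / ((2 * u G.K - HahnSeries.C (G.ħ / 2)) *
        (2 * u G.K + HahnSeries.C (G.ħ / 2))))⁻¹ =
        (u G.K - HahnSeries.C (G.ħ / 4)) * (2 * u G.K + HahnSeries.C (G.ħ / 2)) := by
      rw [inv_div, h2]
      generalize (HahnSeries.C (G.ħ / 4) : LaurentSeries G.K) = z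
      have := u_ne (F := G.K)
      generalize u G.K = t at *
      field_simp
    rw [preHV, hc, zpow_neg, zpow_natCast, ← inv_pow, G.v_τ, ← e, mul_pow, map_mul, map_zpow₀,
      map_pow, map_neg, map_one]
    ring
  have hnum : G.numHV (G.τ i) =
      ((G.arrowPoly (G.τ i)).comp (-Polynomial.X) * G.arrowPoly i).eval₂ HahnSeries.C (u G.K) := by
    rw [numHV, G.τ_invol, Polynomial.eval₂_mul, Polynomial.eval₂_comp, Polynomial.eval₂_neg,
      Polynomial.eval₂_X]
  rw [← denHV_τ, HV_eq, numPoly, Polynomial.eval₂_mul, ← hnum, Polynomial.eval₂_mul,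
    Polynomial.eval₂_C, Polynomial.eval₂_pow, Polynomial.eval₂_mul, Polynomial.eval₂_sub,
    Polynomial.eval₂_add, Polynomial.eval₂_mul, Polynomial.eval₂_X, Polynomial.eval₂_C,
    Polynomial.eval₂_C, Polynomial.eval₂_ofNat, ← hpre]
  field_simp

theorem numPoly_eval (i : Q₀) (z : G.K) :
    (G.numPoly i).eval z = (-1) ^ ((G.v i : ℤ) - 1) * (-1) ^ G.δ (G.τ i) *
      ((z - G.ħ / 4) * (2 * z + G.ħ / 2)) ^ (G.δ i + G.δ (G.τ i)) *
      ((G.arrowPoly (G.τ i)).eval (-z) * (G.arrowPoly i).eval z) := by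
  simp [numPoly, Polynomial.eval_mul]

/-- The residue of `u^{-c_{i,τ i}} HV_{τ i}(u)` at `x_{i,k} + ħ/2`. The factor `2u + ħ/2` of the
numerator becomes `2 x_{i,k} + 3ħ/2`, the factor attached to a fixed arrow. -/
theorem residue_inl (i : Q₀) (k : Fin (G.v i)) {b : Fin (G.v (G.τ i))} (hb : (b : ℕ) = k) :
    G.ħ * ((G.numPoly i).eval (G.node i (Sum.inl k)) *
      ∏ l ∈ Finset.univ.erase (Sum.inl k), (G.node i (Sum.inl k) - G.node i l)⁻¹) =
    (-G.q i k - G.ħ / 4) ^ (G.δ i + G.δ (G.τ i)) * (G.φ i k * G.σ i k (G.φ (G.τ i) b)) := by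
  have h1 : ∏ l, (G.node i (Sum.inl k) - G.node i (Sum.inr l))⁻¹ =
      G.ħ⁻¹ * ∏ l ∈ Finset.univ.erase k, (G.x i k - G.x i l + G.ħ)⁻¹ := by
    rw [← Finset.mul_prod_erase _ _ (Finset.mem_univ k)]
    simp only [node, Sum.elim_inl, Sum.elim_inr]
    congr 2
    · ring
    · ext l
      congr 1
      ring
  have h2 : ∏ l ∈ Finset.univ.erase k, (G.node i (Sum.inl k) - G.node i (Sum.inl l))⁻¹ =
      ((G.Vr i k).eval (G.x i k))⁻¹ := by
    rw [Vr_eval, ← Finset.prod_inv_distrib]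
    refine Finset.prod_congr rfl fun l _ => ?_
    simp only [node, Sum.elim_inl]
    congr 1
    ring
  have h3 : (∏ l ∈ Finset.univ.erase k, (G.x i l - G.x i k - G.ħ))⁻¹ =
      (-1) ^ ((G.v i : ℤ) - 1) * ∏ l ∈ Finset.univ.erase k, (G.x i k - G.x i l + G.ħ)⁻¹ := by
    rw [← prod_neg_erase, ← Finset.prod_inv_distrib]
    refine Finset.prod_congr rfl fun l _ => ?_
    rw [← inv_neg]
    congr 1
    ring
  rw [prod_erase_inl, h1, h2, numPoly_eval, G.σ_φ_τ rfl hb, h3, φ, ← δ_eq_arrowCount]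
  simp only [node, Sum.elim_inl, q]
  rw [show -(G.x i k + G.ħ / 2) = -G.x i k - G.ħ / 2 by ring,
    show -(-G.x i k - G.ħ / 2) = G.x i k + G.ħ / 2 by ring,
    show 2 * (G.x i k + G.ħ / 2) + G.ħ / 2 = 2 * G.x i k + 3 * G.ħ / 2 by ring,
    neg_pow (2 * G.x i k + 3 * G.ħ / 2), mul_pow, pow_add (2 * G.x i k + 3 * G.ħ / 2)]
  have := mul_inv_cancel₀ G.ħ_ne
  linear_combination (-1) ^ ((G.v i : ℤ) - 1) * (-1) ^ G.δ (G.τ i) *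
      ((G.x i k + G.ħ / 2 - G.ħ / 4) ^ (G.δ i + G.δ (G.τ i)) *
      ((2 * G.x i k + 3 * G.ħ / 2) ^ G.δ i * (2 * G.x i k + 3 * G.ħ / 2) ^ G.δ (G.τ i))) *
      ((G.arrowPoly (G.τ i)).eval (-G.x i k - G.ħ / 2) * (G.arrowPoly i).eval (G.x i k + G.ħ / 2)) *
      (((G.Vr i k).eval (G.x i k))⁻¹ * ∏ l ∈ Finset.univ.erase k, (G.x i k - G.x i l + G.ħ)⁻¹) * this

/-- The residue of `u^{-c_{i,τ i}} HV_{τ i}(u)` at `x_{i,k} - ħ/2`. Here the factor attached to a fixed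
arrow comes from `u - ħ/4`. -/
theorem residue_inr (i : Q₀) (k : Fin (G.v i)) {b : Fin (G.v (G.τ i))} (hb : (b : ℕ) = k) :
    G.ħ * ((G.numPoly i).eval (G.node i (Sum.inr k)) *
      ∏ l ∈ Finset.univ.erase (Sum.inr k), (G.node i (Sum.inr k) - G.node i l)⁻¹) =
    -((G.q (G.τ i) b + G.ħ / 4) ^ (G.δ i + G.δ (G.τ i)) *
      (G.φ (G.τ i) b * G.σ (G.τ i) b (G.φ i k))) := by
  have hx : G.x (G.τ i) b = -G.x i k := G.x_τ rfl hb
  have h1 : ∏ l, (G.node i (Sum.inr k) - G.node i (Sum.inl l))⁻¹ =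
      -G.ħ⁻¹ * ∏ l ∈ Finset.univ.erase k, (G.x i k - G.x i l - G.ħ)⁻¹ := by
    rw [← Finset.mul_prod_erase _ _ (Finset.mem_univ k), ← inv_neg]
    simp only [node, Sum.elim_inl, Sum.elim_inr]
    congr 2
    · ring
    · ext l
      congr 1
      ring
  have h2 : ∏ l ∈ Finset.univ.erase k, (G.node i (Sum.inr k) - G.node i (Sum.inr l))⁻¹ =
      (-1) ^ ((G.v i : ℤ) - 1) * ((G.Vr (G.τ i) b).eval (G.x (G.τ i) b))⁻¹ := by
    rw [Vr_eval, G.prod_erase_x_τ rfl hb fun z => G.x (G.τ i) b - z, ← Finset.prod_inv_distrib,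
      ← prod_neg_erase]
    refine Finset.prod_congr rfl fun l _ => ?_
    simp only [node, Sum.elim_inr]
    rw [hx, ← inv_neg]
    congr 1
    ring
  have h3 : (∏ l ∈ Finset.univ.erase b, (G.x (G.τ i) l - G.x (G.τ i) b - G.ħ))⁻¹ =
      ∏ l ∈ Finset.univ.erase k, (G.x i k - G.x i l - G.ħ)⁻¹ := by
    rw [G.prod_erase_x_τ rfl hb fun z => z - G.x (G.τ i) b - G.ħ, ← Finset.prod_inv_distrib]
    refine Finset.prod_congr rfl fun l _ => ?_
    rw [hx]
    congr 1
    ring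
  have hs : ((-1 : G.K) ^ ((G.v i : ℤ) - 1)) * (-1) ^ ((G.v i : ℤ) - 1) = 1 := by
    rw [← mul_zpow]
    simp
  have hs' : ((-1 : G.K) ^ G.δ i) * (-1) ^ G.δ i = 1 := by
    rw [← mul_pow]
    simp
  rw [prod_erase_inr, h1, h2, numPoly_eval, G.σ_φ_τ (G.τ_invol i).symm hb.symm, h3, φ,
    ← δ_eq_arrowCount]
  simp only [node, Sum.elim_inr, q, hx]
  generalize hr : (2 * G.x i k - 3 * G.ħ / 2) = r
  rw [show -(G.x i k - G.ħ / 2) = -G.x i k + G.ħ / 2 by ring,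
    show -(-G.x i k) - G.ħ / 2 = G.x i k - G.ħ / 2 by ring,
    show (G.x i k - G.ħ / 2 - G.ħ / 4) * (2 * (G.x i k - G.ħ / 2) + G.ħ / 2) =
      (G.x i k - G.ħ / 2 + G.ħ / 4) * r by rw [← hr]; ring,
    show 2 * -G.x i k + 3 * G.ħ / 2 = -r by rw [← hr]; ring, neg_neg, neg_pow r, mul_pow, pow_add r]
  have := mul_inv_cancel₀ G.ħ_ne
  generalize ((-1 : G.K) ^ ((G.v i : ℤ) - 1)) = s at *
  generalize ((-1 : G.K) ^ G.δ i) = t at *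
  generalize ((-1 : G.K) ^ G.δ (G.τ i)) = t' at *
  generalize r ^ G.δ (G.τ i) = r1
  generalize r ^ G.δ i = r2
  generalize (G.arrowPoly (G.τ i)).eval (-G.x i k + G.ħ / 2) = E1
  generalize (G.arrowPoly i).eval (G.x i k - G.ħ / 2) = E2
  generalize ∏ l ∈ Finset.univ.erase k, (G.x i k - G.x i l - G.ħ)⁻¹ = D1
  generalize ((G.Vr (G.τ i) b).eval (-G.x i k))⁻¹ = D2
  generalize (G.x i k - G.ħ / 2 + G.ħ / 4) ^ (G.δ i + G.δ (G.τ i)) = z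
  generalize G.ħ⁻¹ = h' at *
  linear_combination -(t' * z * r1 * r2 * E1 * E2 * D1 * D2) * hs
    - t' * z * r1 * r2 * E1 * E2 * D1 * D2 * s * s * this

theorem opEval_WW_τ (i : Q₀) (z : G.K) :
    G.opEval (G.WW (G.τ i)) z = G.opEval (G.W (G.τ i)) (-z) * G.opEval (G.W i) z := by
  rw [WW, opEval_mul, G.τ_invol]
  congr 1
  rw [opEval, opEval, map_neg, eval₂_neg_eq_eval₂_comp]

theorem twistCoeff_u_pow_mul (P : Polynomial G.HW) (F : LaurentSeries G.K) (n : ℤ) (k : ℕ) :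
    G.twistCoeff P (u G.K ^ k * F) n = G.twistCoeff P F (n + k) := by
  induction k generalizing n with
  | zero => simp
  | succ k ih => rw [pow_succ', mul_assoc, twistCoeff_u_mul, ih, Nat.cast_succ, add_right_comm,
      add_assoc]

/-- A series with simple poles `a k` and residues `r k`, times a polynomial `P` in `u`, has residues
`P(a k) r k`. -/
theorem twistCoeff_eq_sum_opEval {α : Type*} [Fintype α] (P : Polynomial G.HW)
    {F : LaurentSeries G.K} {a r : α → G.K} (hF : ∀ n : ℕ, F.coeff (n + 1) = ∑ k, a k ^ n * r k)
    (m : ℕ) : G.twistCoeff P F (m + 1) = ∑ k, (a k ^ m * r k) • G.opEval P (a k) := by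
  simp only [opEval, Polynomial.eval₂_eq_sum, Polynomial.sum, twistCoeff, Finset.smul_sum]
  rw [Finset.sum_comm]
  refine Finset.sum_congr rfl fun e _ => ?_
  rw [show (m : ℤ) + 1 + e = (m + e : ℕ) + 1 by push_cast; ring, hF, Finset.sum_smul]
  refine Finset.sum_congr rfl fun k _ => ?_
  rw [smul_def, smul_def, (G.ofHW_comm _ _).eq, ← mul_assoc, ← map_pow, ← map_mul, pow_add]
  congr 2
  ring

/-- The coefficients of `H_{τ i}(u)` at sufficiently negative powers of `u`, in terms of products
of mirror operators. -/
theorem H_coeff_τ_eq_sum (i : Q₀) (m : ℕ) :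
    G.ħ • (G.H (G.τ i)).coeff (m + 1 + (G.δ i + G.δ (G.τ i) : ℕ)) =
      ∑ k, (((-G.q i k) ^ m * (-G.q i k - G.ħ / 4) ^ (G.δ i + G.δ (G.τ i))) •
          (G.y i k * G.y (G.τ i) (Fin.cast (G.v_τ i).symm k))
        - (G.q (G.τ i) (Fin.cast (G.v_τ i).symm k) ^ m *
            (G.q (G.τ i) (Fin.cast (G.v_τ i).symm k) + G.ħ / 4) ^ (G.δ i + G.δ (G.τ i))) •
          (G.y (G.τ i) (Fin.cast (G.v_τ i).symm k) * G.y i k)) := by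
  have h := coeff_partialFractions (G.node i) (G.node_injective i) _ _ (G.u_pow_mul_HV_τ i)
  rw [H_coeff, ← twistCoeff_u_pow_mul, G.twistCoeff_eq_sum_opEval _ h, Finset.smul_sum,
    Fintype.sum_sum_type, ← Finset.sum_add_distrib]
  refine Finset.sum_congr rfl fun k _ => ?_
  have hb : ((Fin.cast (G.v_τ i).symm k : Fin (G.v (G.τ i))) : ℕ) = k := rfl
  generalize (Fin.cast (G.v_τ i).symm k : Fin (G.v (G.τ i))) = b at *
  have n1 : G.node i (Sum.inl k) = -G.q i k := by
    rw [node, Sum.elim_inl, q]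
    ring
  have n2 : G.node i (Sum.inr k) = G.q (G.τ i) b := by
    rw [node, Sum.elim_inr, q, G.x_τ rfl hb]
    ring
  have r1 := G.residue_inl i k hb
  have r2 := G.residue_inr i k hb
  rw [G.y_mul_y_τ i _ rfl k b hb, G.y_mul_y_τ _ i (G.τ_invol i).symm b k hb.symm, smul_smul,
    smul_smul, smul_smul, smul_smul, sub_eq_add_neg, ← neg_smul, opEval_WW_τ, opEval_WW_τ, n1, n2,
    neg_neg]
  rw [n1] at r1
  rw [n2] at r2
  congr 1
  · congr 1
    linear_combination (-G.q i k) ^ m * r1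
  · rw [(G.commute_opEval _ _ _ (G.commute_opEval _ _ _ (G.ofK_comm _ _)).symm).eq]
    congr 1
    linear_combination G.q (G.τ i) b ^ m * r2

end GaugeDatum

/-! ### The relations between the modes of the operators -/

theorem anticomm_smul {A : Type*} [Ring A] [Algebra Ch A] (s t : Ch) (a b : A) :
    anticomm (s • a) (t • b) = (s * t) • anticomm a b := by
  simp only [anticomm, smul_mul_smul_comm, mul_comm t s, smul_add]

theorem map_lie_of_algHom {A B : Type*} [Ring A] [Ring B] [Algebra Ch A] [Algebra Ch B]
    (f : A →ₐ[Ch] B) (a b : A) : f ⁅a, b⁆ = ⁅f a, f b⁆ := by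
  rw [Ring.lie_def, Ring.lie_def, map_sub, map_mul, map_mul]

theorem map_anticomm {A B : Type*} [Ring A] [Ring B] [Algebra Ch A] [Algebra Ch B]
    (f : A →ₐ[Ch] B) (a b : A) : f (anticomm a b) = anticomm (f a) (f b) := by
  rw [anticomm, anticomm, map_add, map_mul, map_mul]

namespace GaugeDatum

variable {Q₀ Q₁ : Type*} [Fintype Q₀] [DecidableEq Q₀] [Fintype Q₁] [DecidableEq Q₁]
  (G : GaugeDatum Q₀ Q₁)

/-- The action of `K` by left multiplication is compatible with the algebra structure over `ℂ(ħ)`. -/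
instance : IsScalarTower Ch G.K G.DiffW :=
  ⟨fun c α z => by
    rw [Algebra.smul_def, mul_smul, smul_def _ (algebraMap Ch G.K c), ofK_algebraMap,
      ← Algebra.smul_def]⟩

theorem algebraMap_smul_DiffW (c : Ch) (z : G.DiffW) : algebraMap Ch G.K c • z = c • z :=
  algebraMap_smul G.K c z

/-- The modes `∑_a q_{i,a}^s y_{i,a}` of `-B_i(u)`. -/
def X (i : Q₀) (s : ℕ) : G.DiffW :=
  modeSum (fun p : G.Idx => G.q p.1 p.2) (fun p => G.y p.1 p.2) (Sigma.mk i) s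

theorem B_coeff (i : Q₀) (s : ℕ) : (G.B i).coeff (s + 1) = -G.X i s := by
  rw [B, HahnSeries.coeff_sum, X, modeSum, ← Finset.sum_neg_distrib]
  refine Finset.sum_congr rfl fun a _ => ?_
  have h : -u G.K - HahnSeries.C (G.x i a) - HahnSeries.C (G.ħ / 2) =
      -(u G.K - HahnSeries.C (G.q i a)) := by
    rw [q, map_sub, map_neg]
    ring
  rw [h, inv_neg, inv_u_sub_C, HahnSeries.C_apply, HahnSeries.coeff_mul_single_zero,
    HahnSeries.map_coeff, HahnSeries.coeff_neg, geom_coeff, map_neg]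
  exact neg_mul (G.ofK (G.q i a ^ s)) (G.y i a)

theorem B_coeff_of_le (i : Q₀) (n : ℤ) (hn : n ≤ 0) : (G.B i).coeff n = 0 := by
  rw [B, HahnSeries.coeff_sum]
  refine Finset.sum_eq_zero fun a _ => ?_
  have h : -u G.K - HahnSeries.C (G.x i a) - HahnSeries.C (G.ħ / 2) =
      -(u G.K - HahnSeries.C (G.q i a)) := by
    rw [q, map_sub, map_neg]
    ring
  rw [h, inv_neg, inv_u_sub_C, HahnSeries.C_apply, HahnSeries.coeff_mul_single_zero,
    HahnSeries.map_coeff, HahnSeries.coeff_neg, geom_coeff_of_le _ _ hn, neg_zero, map_zero,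
    zero_mul]

theorem X_τ (i : Q₀) (s : ℕ) :
    G.X (G.τ i) s = modeSum (fun p : G.Idx => G.q p.1 p.2) (fun p => G.y p.1 p.2)
      (G.τIdx ∘ Sigma.mk i) s :=
  (Fintype.sum_equiv (finCongr (G.v_τ i).symm) _ _ fun _ => rfl).symm

theorem sigma_mk_ne {i j : Q₀} (h : i ≠ j) (a : Fin (G.v i)) (b : Fin (G.v j)) :
    (⟨j, b⟩ : G.Idx) ≠ ⟨i, a⟩ := fun e => h (congrArg Sigma.fst e).symm

theorem sigma_mk_ne_τ {i j : Q₀} (h : j ≠ G.τ i) (a : Fin (G.v i)) (b : Fin (G.v j)) :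
    (⟨j, b⟩ : G.Idx) ≠ G.τIdx ⟨i, a⟩ := fun e => h (congrArg Sigma.fst e)

theorem c_τ_left (i j : Q₀) : G.c (G.τ i) j = G.c i (G.τ j) := by
  exact (congrArg (G.c (G.τ i)) (G.τ_invol j).symm).trans (G.cartan.c_τ i (G.τ j))

/-- The relation between `h_i` and `b_j`. -/
theorem H_X_rel (i j : Q₀) (n : ℤ) (s : ℕ) :
    ⁅(G.H i).coeff (n + 2), G.X j s⁆ - ⁅(G.H i).coeff n, G.X j (s + 2)⁆ =
      (((G.c i j : Ch) - (G.c (G.τ i) j : Ch)) / 2 * hbar) •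
          anticomm ((G.H i).coeff (n + 1)) (G.X j s)
        + (((G.c i j : Ch) + (G.c (G.τ i) j : Ch)) / 2 * hbar) •
          anticomm ((G.H i).coeff n) (G.X j (s + 1))
        + ((G.c i j : Ch) * (G.c (G.τ i) j : Ch) / 4 * hbar ^ 2) •
          ⁅(G.H i).coeff n, G.X j s⁆ := by
  have hK : ∀ (n : ℤ) (α : G.K) (z : G.DiffW),
      (G.H i).coeff n * α • z = α • ((G.H i).coeff n * z) := fun n α z => by
    rw [H_coeff, twistCoeff_mul_smul]
  rw [c_τ_left]
  simp only [← G.algebraMap_smul_DiffW, map_mul, map_div₀, map_sub, map_add, map_intCast,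
    map_ofNat, map_pow]
  change _ = _ + (_ * G.ħ) • _ + _
  simp only [X, modeSum, Ring.lie_def, anticomm, Finset.mul_sum, Finset.sum_mul, hK,
    smul_mul_assoc]
  simp only [← Finset.sum_sub_distrib, ← Finset.sum_add_distrib, Finset.smul_sum]
  refine Finset.sum_congr rfl fun b _ => ?_
  have h := G.H_coeff_mul_y i j b n
  change _ = (_ * G.ħ) • _ + (_ * G.ħ) • _ + (_ * G.ħ ^ 2) • _
  linear_combination (norm := module) (G.q j b ^ s) • h

/-- The relation between `b_i` and `b_j` for `j ≠ τ i`. -/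
theorem X_X_rel_of_ne (i j : Q₀) (h : G.τ i ≠ j) (r s : ℕ) :
    ⁅G.X i (r + 1), G.X j s⁆ - ⁅G.X i r, G.X j (s + 1)⁆ =
      ((G.c i j : Ch) / 2 * hbar) • anticomm (G.X i r) (G.X j s) := by
  have hs : algebraMap Ch G.K ((G.c i j : Ch) / 2 * hbar) = (G.c i j : G.K) / 2 * G.ħ := by
    rw [map_mul, map_div₀, map_intCast, map_ofNat]
    rfl
  rw [← G.algebraMap_smul_DiffW, hs]
  by_cases hij : i = j
  · subst hij
    have hc : G.c i i = 2 := G.cartan.c_diag i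
    have := G.exchangeSystem.bb_self r s (Sigma.mk i) sigma_mk_injective
      (fun a b => G.sigma_mk_ne_τ h.symm a b) (fun _ _ => by rw [hc]; norm_num)
    rw [hc, Int.cast_ofNat]
    exact this
  · exact G.exchangeSystem.bb_of_ne _ r s (Sigma.mk i) (Sigma.mk j) (G.sigma_mk_ne hij)
      (G.sigma_mk_ne_τ h.symm) fun _ _ => rfl

theorem lie_X_of_ne (i j : Q₀) (hc : G.c i j = 0) (h : G.τ i ≠ j) (r s : ℕ) :
    ⁅G.X i r, G.X j s⁆ = 0 := by
  have hij : i ≠ j := by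
    rintro rfl
    have : G.c i i = 2 := G.cartan.c_diag i
    omega
  exact G.exchangeSystem.lie_modeSum_of_ne r s (Sigma.mk i) (Sigma.mk j) (G.sigma_mk_ne hij)
    (G.sigma_mk_ne_τ h.symm) fun _ _ => by rw [hc, Int.cast_zero]

/-- The relation between `b_i` and `b_{τ i}` for `c_{i,τ i} = 0`. -/
theorem lie_X_τ (i : Q₀) (hc : G.c i (G.τ i) = 0) (r s : ℕ) :
    ⁅G.X i r, G.X (G.τ i) s⁆ = ((-1 : Ch) ^ r * hbar) • (G.H (G.τ i)).coeff ((r : ℤ) + s + 1) := by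
  have h := G.exchangeSystem.lie_modeSum_τ r s (Sigma.mk i) sigma_mk_injective
    (fun a b => G.sigma_mk_ne_τ (G.τ_ne i).symm a b)
    (fun _ _ => by change ((G.c i (G.τ i) : ℤ) : G.K) = 0; rw [hc, Int.cast_zero])
  have hδ : G.δ i + G.δ (G.τ i) = 0 := by
    have := G.c_τ_eq i
    omega
  have h' := G.H_coeff_τ_eq_sum i (r + s)
  rw [hδ, Nat.cast_zero, add_zero, Nat.cast_add] at h'
  simp only [pow_zero, mul_one] at h'
  rw [← X_τ] at h
  refine h.trans ?_
  rw [mul_smul, ← G.algebraMap_smul_DiffW hbar, ← G.algebraMap_smul_DiffW ((-1) ^ r), map_pow,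
    map_neg, map_one]
  exact congrArg _ h'.symm

/-- The relation between `b_i` and `b_{τ i}`. For `c_{i,τ i} = 0` it follows from the stronger `lie_X_τ`. -/
theorem X_X_τ_rel (i : Q₀) (r s : ℕ) :
    ⁅G.X i (r + 1), G.X (G.τ i) s⁆ - ⁅G.X i r, G.X (G.τ i) (s + 1)⁆ =
      ((G.c i (G.τ i) : Ch) / 2 * hbar) • anticomm (G.X i r) (G.X (G.τ i) s)
        - (2 * (-1 : Ch) ^ r * hbar) • (G.H (G.τ i)).coeff ((r : ℤ) + s + 1 + 1) := by
  rcases G.cartan.c_off i (G.τ i) (G.τ_ne i).symm with hc | hc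
  · replace hc : G.c i (G.τ i) = 0 := hc
    rw [lie_X_τ _ _ hc, lie_X_τ _ _ hc, hc]
    push_cast
    rw [show (r : ℤ) + 1 + s + 1 = r + s + 1 + 1 by ring,
      show (r : ℤ) + (s + 1) + 1 = r + s + 1 + 1 by ring]
    simp only [← G.algebraMap_smul_DiffW, map_mul, map_pow, map_neg, map_one, map_ofNat, map_div₀,
      map_zero]
    module
  · replace hc : G.c i (G.τ i) = -1 := hc
    have h := G.exchangeSystem.bb_τ r s (Sigma.mk i) sigma_mk_injective
      (fun a b => G.sigma_mk_ne_τ (G.τ_ne i).symm a b)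
      (fun _ _ => by change ((G.c i (G.τ i) : ℤ) : G.K) = -1; rw [hc]; norm_num)
    have hδ : G.δ i + G.δ (G.τ i) = 1 := by
      have := G.c_τ_eq i
      omega
    have h' := G.H_coeff_τ_eq_sum i (r + s)
    rw [hδ, Nat.cast_one, Nat.cast_add] at h'
    simp only [pow_one] at h'
    rw [← X_τ, ← X_τ] at h
    refine h.trans ?_
    rw [sub_eq_add_neg, mul_smul (2 * (-1 : Ch) ^ r), ← G.algebraMap_smul_DiffW hbar]
    change _ = _ + -((_ : Ch) • (G.ħ • _))
    rw [h', hc, ← G.algebraMap_smul_DiffW, ← G.algebraMap_smul_DiffW]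
    simp only [map_mul, map_pow, map_neg, map_one, map_ofNat, map_div₀, map_intCast]
    push_cast
    congr 1
    rw [Finset.smul_sum, Finset.smul_sum, ← Finset.sum_neg_distrib]
    refine Finset.sum_congr rfl fun a _ => ?_
    change (-1 : G.K) ^ r • (((-G.q i a) ^ (r + s) * (2 * G.q i a + G.ħ / 2)) •
        (G.y i a * G.y (G.τ i) (Fin.cast (G.v_τ i).symm a)) +
      (G.q (G.τ i) (Fin.cast (G.v_τ i).symm a) ^ (r + s) *
        (2 * G.q (G.τ i) (Fin.cast (G.v_τ i).symm a) + G.ħ / 2)) •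
          (G.y (G.τ i) (Fin.cast (G.v_τ i).symm a) * G.y i a)) = _
    module

theorem usualSerre_X (i j : Q₀) (hc : G.c i j = -1) (h : j ≠ G.τ i) (k l r : ℕ) :
    sym₂ (fun k l => ⁅G.X i k, ⁅G.X i l, G.X j r⁆⁆) k l = 0 := by
  have hii : G.c i i = 2 := G.cartan.c_diag i
  have hij : i ≠ j := by
    rintro rfl
    omega
  exact G.exchangeSystem.usualSerre (Sigma.mk i) (Sigma.mk j) k l r
    (G.sigma_mk_ne_τ (G.τ_ne i).symm) (G.sigma_mk_ne hij) (G.sigma_mk_ne_τ h)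
    (fun _ _ => by rw [hii]; norm_num) (fun _ _ => by rw [hc]; norm_num)

/-- The Serre relation between `b_i` and `b_{τ i}` for `c_{i,τ i} = -1`. -/
theorem iSerre_X (i : Q₀) (hc : G.c i (G.τ i) = -1) (k l r : ℕ) :
    sym₂ (fun k l => ⁅G.X i k, ⁅G.X i l, G.X (G.τ i) r⁆⁆) k l =
      (4 / 3 * hbar) • sym₂ (fun k l => ((-1 : Ch) ^ k) •
        ∑ p ∈ Finset.range ((k : ℤ) + r + G.cartan.pairing (G.τ i) G.μ + 2).toNat,
          ((3 : Ch) ^ p)⁻¹ • ⁅G.X i (l + p), (G.H (G.τ i)).coeff ((k : ℤ) + r - p + 1)⁆) k l := by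
  have hii : G.c i i = 2 := G.cartan.c_diag i
  have hδ : G.δ i + G.δ (G.τ i) = 1 := by
    have := G.c_τ_eq i
    omega
  have h := G.exchangeSystem.iSerre (Sigma.mk i) sigma_mk_injective
    (G.sigma_mk_ne_τ (G.τ_ne i).symm) (fun _ _ => by rw [hii]; norm_num)
    (fun _ _ => by change ((G.c i (G.τ i) : ℤ) : G.K) = -1; rw [hc]; norm_num)
    (fun n => (G.H (G.τ i)).coeff (n + 1)) (-G.cartan.pairing (G.τ i) G.μ - 1)
    (fun n hn => G.H_coeff_of_lt _ _ (by omega))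
    (fun n α z => by rw [H_coeff, twistCoeff_mul_smul])
    (fun a m => by
      have h1 := G.H_coeff_mul_y (G.τ i) i a (m + 1)
      have h2 : G.c (G.τ i) i = -1 := by rw [c_τ_left, hc]
      have h3 : G.c (G.τ i) (G.τ i) = 2 := G.cartan.c_diag _
      rw [h2, h3] at h1
      push_cast at h1
      rw [show m + 1 + 2 = m + 2 + 1 by ring] at h1
      linear_combination (norm := module) -h1)
    (fun m => by
      have h1 := G.H_coeff_τ_eq_sum i m
      rw [hδ, Nat.cast_one] at h1
      refine h1.trans ?_
      rw [← Finset.sum_neg_distrib]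
      refine Finset.sum_congr rfl fun a _ => ?_
      change _ = -(_ • (G.y i a * G.y (G.τ i) (Fin.cast (G.v_τ i).symm a)) +
        _ • (G.y (G.τ i) (Fin.cast (G.v_τ i).symm a) * G.y i a))
      change _ = -(((G.q i a + G.ħ / 4) * (-G.q i a) ^ m) • _ +
        ((G.q (G.τ i) (Fin.cast (G.v_τ i).symm a) + G.ħ / 4) *
          (G.q (G.τ i) (Fin.cast (G.v_τ i).symm a)) ^ m) • _)
      module) k l r
  rw [← X_τ] at h
  refine h.trans ?_
  rw [← G.algebraMap_smul_DiffW]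
  simp only [← G.algebraMap_smul_DiffW]
  simp only [map_mul, map_div₀, map_ofNat, map_pow, map_inv₀, map_neg, map_one]
  have e : ∀ k : ℤ, k + r - (-G.cartan.pairing (G.τ i) G.μ - 1) + 1 =
      k + r + G.cartan.pairing (G.τ i) G.μ + 2 := fun k => by ring
  simp only [e]
  rfl

end GaugeDatum

/-! ### Homomorphisms out of the shifted twisted Yangian -/

section Lift

variable {I : Type*} [Fintype I] [DecidableEq I] {D : CartanInvolution I} {A : Type*} [Ring A]
  [Algebra Ch A]

theorem lie_smul_smul (s t : Ch) (a b : A) : ⁅s • a, t • b⁆ = (s * t) • ⁅a, b⁆ := by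
  simp only [Ring.lie_def, smul_mul_smul_comm, mul_comm t s, smul_sub]

/-- The images of the generators of the Yangian under a homomorphism for which the coefficients
of `h_i(z)` are `H i` and those of `b_i(z)` are `-X i`. -/
def genMap (H : I → ℤ → A) (X : I → ℕ → A) : YGen I → A
  | .h i r => hbar⁻¹ • H i (r + 1)
  | .b i s => (-hbar⁻¹) • X i s

/-- The homomorphism from the free algebra with prescribed values of the generating series. -/
def freeLift (H : I → ℤ → A) (X : I → ℕ → A) : YFree I →ₐ[Ch] A := FreeAlgebra.lift Ch (genMap H X)

theorem freeLift_fh (H : I → ℤ → A) (X : I → ℕ → A) (i : I) (r : ℤ) :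
    freeLift H X (fh i r) = hbar⁻¹ • H i (r + 1) := FreeAlgebra.lift_ι_apply _ _

theorem freeLift_fb (H : I → ℤ → A) (X : I → ℕ → A) (i : I) (s : ℕ) :
    freeLift H X (fb i s) = (-hbar⁻¹) • X i s := FreeAlgebra.lift_ι_apply _ _

theorem hbar_smul_freeLift_fb (H : I → ℤ → A) (X : I → ℕ → A) (i : I) (s : ℕ) :
    hbar • freeLift H X (fb i s) = -X i s := by
  rw [freeLift_fb, neg_smul, smul_neg, smul_inv_smul₀ GaugeDatum.hbar_ne_zero]

/-- The defining relations of the Yangian, in terms of the coefficients of the generating series. -/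
theorem freeLift_eq_of_rel (S : ShiftDatum D) (H : I → ℤ → A) (X : I → ℕ → A)
    (h_low : ∀ i n, n < -D.pairing i S.μ → H i n = 0)
    (h_lead : ∀ i, H i (-D.pairing i S.μ) = algebraMap Ch A (hbar * S.ζ i))
    (h_comm : ∀ i j m n, Commute (H i m) (H j n))
    (h_tau : ∀ i n, H i n = ((-1 : Ch) ^ n) • H (D.τ i) n)
    (hb : ∀ i j n s, ⁅H i (n + 2), X j s⁆ - ⁅H i n, X j (s + 2)⁆ =
      (((D.c i j : Ch) - (D.c (D.τ i) j : Ch)) / 2 * hbar) • anticomm (H i (n + 1)) (X j s)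
        + (((D.c i j : Ch) + (D.c (D.τ i) j : Ch)) / 2 * hbar) • anticomm (H i n) (X j (s + 1))
        + ((D.c i j : Ch) * (D.c (D.τ i) j : Ch) / 4 * hbar ^ 2) • ⁅H i n, X j s⁆)
    (bb : ∀ i j, D.τ i ≠ j → ∀ r s, ⁅X i (r + 1), X j s⁆ - ⁅X i r, X j (s + 1)⁆ =
      ((D.c i j : Ch) / 2 * hbar) • anticomm (X i r) (X j s))
    (bb_tau : ∀ i r s, ⁅X i (r + 1), X (D.τ i) s⁆ - ⁅X i r, X (D.τ i) (s + 1)⁆ =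
      ((D.c i (D.τ i) : Ch) / 2 * hbar) • anticomm (X i r) (X (D.τ i) s)
        - (2 * (-1 : Ch) ^ r * hbar) • H (D.τ i) ((r : ℤ) + s + 1 + 1))
    (lie : ∀ i j, D.c i j = 0 → D.τ i ≠ j → ∀ r s, ⁅X i r, X j s⁆ = 0)
    (lie_tau : ∀ i, D.c i (D.τ i) = 0 → ∀ r s, ⁅X i r, X (D.τ i) s⁆ =
      ((-1 : Ch) ^ r * hbar) • H (D.τ i) ((r : ℤ) + s + 1))
    (usualSerre : ∀ i j, D.c i j = -1 → j ≠ D.τ i → ∀ k l r,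
      sym₂ (fun k l => ⁅X i k, ⁅X i l, X j r⁆⁆) k l = 0)
    (iSerre : ∀ i, D.c i (D.τ i) = -1 → ∀ k l r,
      sym₂ (fun k l => ⁅X i k, ⁅X i l, X (D.τ i) r⁆⁆) k l =
        (4 / 3 * hbar) • sym₂ (fun k l => ((-1 : Ch) ^ k) •
          ∑ p ∈ Finset.range ((k : ℤ) + r + D.pairing (D.τ i) S.μ + 2).toNat,
            ((3 : Ch) ^ p)⁻¹ • ⁅X i (l + p), H (D.τ i) ((k : ℤ) + r - p + 1)⁆) k l)
    {a b : YFree I} (hab : YRel S a b) : freeLift H X a = freeLift H X b := by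
  have hħ : hbar ≠ 0 := GaugeDatum.hbar_ne_zero
  induction hab with
  | h_low i r hr => rw [freeLift_fh, map_zero, h_low i _ (by omega), smul_zero]
  | h_lead i =>
    rw [freeLift_fh, sub_add_cancel, h_lead, AlgHom.commutes, Algebra.smul_def, ← map_mul,
      inv_mul_cancel_left₀ hħ]
  | h_comm i j r s =>
    rw [map_lie_of_algHom, freeLift_fh, freeLift_fh, lie_smul_smul, Ring.lie_def, (h_comm ..).eq,
      sub_self, smul_zero, map_zero]
  | h_tau i s =>
    rw [map_smul, freeLift_fh, freeLift_fh, smul_comm, h_tau i]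
  | hb i j r s =>
    simp only [map_sub, map_add, map_smul, map_lie_of_algHom, map_anticomm, freeLift_fh,
      freeLift_fb, lie_smul_smul, anticomm_smul]
    have h := hb i j (r + 1) s
    rw [show r + 1 + 2 = r + 2 + 1 by ring] at h
    rw [← smul_sub, h, smul_add, smul_add]
    simp only [smul_smul]
    congr 2
    · congr 1
      ring
    · congr 1
      ring
    · ring
  | bb i j r s =>
    have hi := mul_inv_cancel₀ hħ
    split_ifs with h
    · subst h
      simp only [map_sub, map_smul, map_lie_of_algHom, map_anticomm, freeLift_fh, freeLift_fb,
        lie_smul_smul, anticomm_smul]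
      rw [← smul_sub, bb_tau, smul_sub, smul_smul, smul_smul, smul_smul, smul_smul]
      congr 2
      · ring
      · linear_combination 2 * (-1) ^ r * hbar⁻¹ * hi
    · simp only [map_sub, map_smul, map_lie_of_algHom, map_anticomm, freeLift_fb,
        lie_smul_smul, anticomm_smul, map_zero]
      rw [← smul_sub, bb i j h, smul_smul, smul_smul, sub_zero]
      congr 1
      ring
  | commSerre i j hij r s =>
    have hi := mul_inv_cancel₀ hħ
    rw [map_lie_of_algHom, freeLift_fb, freeLift_fb, lie_smul_smul]
    split_ifs with h
    · subst h
      rw [lie_tau i hij, map_smul, freeLift_fh, smul_smul, smul_smul]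
      congr 1
      linear_combination (-1) ^ r * hbar⁻¹ * hi
    · rw [lie i j hij h, smul_zero, map_zero]
  | usualSerre i j hij hj k l r =>
    have h := usualSerre i j hij hj k l r
    simp only [sym₂] at h ⊢
    simp only [map_add, map_lie_of_algHom, freeLift_fb, lie_smul_smul]
    rw [← smul_add, h, smul_zero, map_zero]
  | iSerre i hi k l r =>
    have h := iSerre i hi k l r
    simp only [sym₂] at h ⊢
    simp only [map_add, map_smul, map_sum, map_lie_of_algHom, freeLift_fb, freeLift_fh,
      lie_smul_smul]
    rw [← smul_add, h, smul_smul]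
    simp only [smul_comm _ (-hbar⁻¹ * hbar⁻¹), ← Finset.smul_sum]
    rw [← smul_add, smul_smul]
    congr 1
    have hi := mul_inv_cancel₀ hħ
    linear_combination -(4 / 3) * hbar⁻¹ ^ 2 * hi

end Lift

namespace GaugeDatum

variable {Q₀ Q₁ : Type*} [Fintype Q₀] [DecidableEq Q₀] [Fintype Q₁] [DecidableEq Q₁]
  (G : GaugeDatum Q₀ Q₁)

/-- The coefficients of `H_i(u)` and `B_i(u)` satisfy the relations of the Yangian. -/
theorem freeLift_rel {a b : YFree Q₀} (hab : YRel G.shiftDatum a b) :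
    freeLift (fun i => (G.H i).coeff) G.X a = freeLift (fun i => (G.H i).coeff) G.X b := by
  refine freeLift_eq_of_rel G.shiftDatum _ _ G.H_coeff_of_lt G.H_coeff_lead ?_ ?_ G.H_X_rel
    G.X_X_rel_of_ne G.X_X_τ_rel G.lie_X_of_ne G.lie_X_τ G.usualSerre_X G.iSerre_X hab
  · intro i j m n
    rw [H_coeff, H_coeff]
    exact G.twistCoeff_comm _ _ _ _ _ _
  · intro i n
    rw [H_coeff_τ, ← G.algebraMap_smul_DiffW, map_zpow₀, map_neg, map_one]
    rfl

/-- The homomorphism from the Yangian to the difference algebra. -/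
def yangianHom : Yangian G.shiftDatum →ₐ[Ch] G.DiffW :=
  RingQuot.liftAlgHom Ch ⟨freeLift (fun i => (G.H i).coeff) G.X, fun _ _ h => G.freeLift_rel h⟩

theorem yangianHom_ymk (a : YFree Q₀) :
    G.yangianHom (ymk G.shiftDatum a) = freeLift (fun i => (G.H i).coeff) G.X a :=
  RingQuot.liftAlgHom_mkAlgHom_apply Ch _ _ a

theorem yangianHom_hSeries (i : Q₀) (n : ℤ) :
    G.yangianHom ((hSeries G.shiftDatum i).coeff n) = (G.H i).coeff n := by
  change G.yangianHom (hbar • yh G.shiftDatum i (n - 1)) = _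
  rw [map_smul, yh, yangianHom_ymk, freeLift_fh, smul_inv_smul₀ hbar_ne_zero, sub_add_cancel]

theorem yangianHom_bSeries (i : Q₀) (n : ℤ) :
    G.yangianHom ((bSeries G.shiftDatum i).coeff n) = (G.B i).coeff n := by
  change G.yangianHom (if 1 ≤ n then hbar • yb G.shiftDatum i (n - 1).toNat else 0) = _
  split_ifs with h
  · obtain ⟨s, rfl⟩ : ∃ s : ℕ, n = s + 1 := ⟨(n - 1).toNat, by omega⟩
    rw [map_smul, yb, yangianHom_ymk, hbar_smul_freeLift_fb, B_coeff, add_sub_cancel_right,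
      Int.toNat_natCast]
  · rw [map_zero, B_coeff_of_le _ _ _ (by omega)]

-- The scalar multiplications have to be those of the algebra structures: the one that is found
-- for `ℚ` on `ℂ(ħ)` by default comes from the construction of `RatFunc`.
instance : @IsScalarTower ℚ Ch (Yangian G.shiftDatum) Algebra.toSMul Algebra.toSMul
    Algebra.toSMul :=
  @IsScalarTower.of_algebraMap_eq ℚ Ch (Yangian G.shiftDatum) _ _ _ _ _ _ fun _ => rfl

instance : @IsScalarTower ℚ Ch G.DiffW Algebra.toSMul Algebra.toSMul Algebra.toSMul :=
  @IsScalarTower.of_algebraMap_eq ℚ Ch G.DiffW _ _ _ _ _ _ fun _ => rfl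

/-- The homomorphism over `H_{G_W}^*(pt)`. -/
def yangianWHom : G.YangianW →ₐ[Ch] G.DiffW :=
  Algebra.TensorProduct.lift G.yangianHom Algebra.TensorProduct.includeRight
    fun x f => (G.ofHW_comm f (G.yangianHom x)).symm

theorem yangianWHom_tmul (x : Yangian G.shiftDatum) (f : G.HW) :
    G.yangianWHom (x ⊗ₜ[ℚ] f) = G.yangianHom x * G.ofHW f := rfl

/-- A homomorphism from the Yangian is determined by its values on the generating series. -/
theorem algHom_yangianW_ext {ψ ψ' : G.YangianW →ₐ[Ch] G.DiffW}
    (hf : ∀ f : G.HW, ψ (1 ⊗ₜ[ℚ] f) = ψ' (1 ⊗ₜ[ℚ] f))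
    (hh : ∀ i n, ψ ((hSeries G.shiftDatum i).coeff n ⊗ₜ[ℚ] 1) =
      ψ' ((hSeries G.shiftDatum i).coeff n ⊗ₜ[ℚ] 1))
    (hb : ∀ i n, ψ ((bSeries G.shiftDatum i).coeff n ⊗ₜ[ℚ] 1) =
      ψ' ((bSeries G.shiftDatum i).coeff n ⊗ₜ[ℚ] 1)) : ψ = ψ' := by
  have hs : ∀ (φ : G.YangianW →ₐ[Ch] G.DiffW) (x : Yangian G.shiftDatum),
      φ (x ⊗ₜ[ℚ] 1) = hbar⁻¹ • φ ((hbar • x) ⊗ₜ[ℚ] 1) := by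
    intro φ x
    rw [← map_smul, TensorProduct.smul_tmul', inv_smul_smul₀ hbar_ne_zero]
  refine Algebra.TensorProduct.ext ?_ (AlgHom.ext hf)
  refine RingQuot.ringQuot_ext' Ch _ _ (FreeAlgebra.hom_ext (funext ?_))
  rintro (⟨i, r⟩ | ⟨i, s⟩)
  · change ψ (yh G.shiftDatum i r ⊗ₜ[ℚ] 1) = ψ' (yh G.shiftDatum i r ⊗ₜ[ℚ] 1)
    have h := hh i (r + 1)
    change ψ ((hbar • yh G.shiftDatum i (r + 1 - 1)) ⊗ₜ[ℚ] 1) =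
      ψ' ((hbar • yh G.shiftDatum i (r + 1 - 1)) ⊗ₜ[ℚ] 1) at h
    rw [add_sub_cancel_right] at h
    rw [hs ψ, hs ψ', h]
  · change ψ (yb G.shiftDatum i s ⊗ₜ[ℚ] 1) = ψ' (yb G.shiftDatum i s ⊗ₜ[ℚ] 1)
    have h := hb i (s + 1)
    change ψ ((if (1 : ℤ) ≤ s + 1 then hbar • yb G.shiftDatum i ((s : ℤ) + 1 - 1).toNat else 0)
      ⊗ₜ[ℚ] 1) = ψ' ((if (1 : ℤ) ≤ s + 1 then hbar • yb G.shiftDatum i ((s : ℤ) + 1 - 1).toNat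
        else 0) ⊗ₜ[ℚ] 1) at h
    rw [if_pos (by omega), add_sub_cancel_right, Int.toNat_natCast] at h
    rw [hs ψ, hs ψ', h]

end GaugeDatum

end GKLO

end

theorem mainTheorem2 {Q₀ Q₁ : Type*} [Fintype Q₀] [DecidableEq Q₀] [Fintype Q₁] [DecidableEq Q₁]
    (G : GKLO.GaugeDatum Q₀ Q₁) :
    ∃! ψ : G.YangianW →ₐ[GKLO.Ch] G.DiffW,
      (∀ f : G.HW, ψ (1 ⊗ₜ[ℚ] f) = 1 ⊗ₜ[ℚ] f) ∧
      (∀ i : Q₀, (G.hSeriesW i).map ψ = G.H i) ∧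
      (∀ i : Q₀, (G.bSeriesW i).map ψ = G.B i) := by
  refine ⟨G.yangianWHom, ⟨fun f => ?_, fun i => ?_, fun i => ?_⟩, fun ψ ⟨hf, hh, hb⟩ => ?_⟩
  · rw [GKLO.GaugeDatum.yangianWHom_tmul, map_one, one_mul]
    rfl
  · ext n
    refine Eq.trans ?_ (G.yangianHom_hSeries i n)
    refine (G.yangianWHom_tmul ((GKLO.hSeries G.shiftDatum i).coeff n) 1).trans ?_
    rw [map_one, mul_one]
  · ext n
    refine Eq.trans ?_ (G.yangianHom_bSeries i n)
    refine (G.yangianWHom_tmul ((GKLO.bSeries G.shiftDatum i).coeff n) 1).trans ?_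
    rw [map_one, mul_one]
  · refine G.algHom_yangianW_ext (fun f => ?_) (fun i n => ?_) fun i n => ?_
    · rw [hf, GKLO.GaugeDatum.yangianWHom_tmul, map_one, one_mul]
      rfl
    · rw [GKLO.GaugeDatum.yangianWHom_tmul, map_one, mul_one, G.yangianHom_hSeries, ← hh i]
      rfl
    · rw [GKLO.GaugeDatum.yangianWHom_tmul, map_one, mul_one, G.yangianHom_bSeries, ← hb i]
      rfl
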